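/- Let $(X,Y)$ be a couple of square-integrable real random variables with $\operatorname{Var}(X)>0$. Put $\tilde X=X-\mathbb E X$, $\tilde Y=Y-\mathbb E Y$, $\tau=\operatorname{Cov}(Y,X)/\operatorname{Var}(X)$, $\varepsilon=\tilde Y-\tau\tilde X$, and let $\sigma_X,\sigma_Y,\sigma_\varepsilon$ be the standard deviations of $X,Y,\varepsilon$. Write $\|Z\|_q=(\mathbb E|Z|^q)^{1/q}\in[0,\infty]$ and let $\Phi$ be the standard normal distribution function. No independence between $X$ and $\varepsilon$ is assumed. Let $n\ge 1$, let $(X_1,Y_1),\dots,(X_n,Y_n)$ be independent copies of $(X,Y)$, $\bar X=\frac1n\sum_i X_i$, $\bar Y=\frac1n\sum_i Y_i$, and $$\hat\tau=\frac{\sum_i(X_i-\bar X)(Y_i-\bar Y)}{\sum_i(X_i-\bar X)^2},\quad \hat b=\bar Y-\hat\tau\bar X,\quad \hat\varepsilon_i=Y_i-\hat b-\hat\tau X_i,\quad \hat v=\frac{\frac1n\sum_i(X_i-\bar X)^2\hat\varepsilon_i^2}{\left(\frac1n\sum_i(X_i-\bar X)^2\right)^2}$$ (a quotient of real numbers with denominator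 $0$ is read as $0$ here). Numerical constants. Let $c_{BE}\ge0$ be any constant for which the Berry–Esseen inequality $$\left|\mathbb P\left(\tfrac{\sqrt n\,\bar Z}{\sigma_Z}\le x\right)-\Phi(x)\right|\le c_{BE}\frac{\mathbb E|Z_1|^3}{\sigma_Z^3\sqrt n}$$ holds for all $x\in\mathbb R$, $n\ge1$ and all i.i.d. centered $Z_1,\dots,Z_n$ with finite third moment and variance $\sigma_Z^2>0$. Let $c_1,c_2\ge0$ be any constants for which the Rosenthal inequality with exponent $4$, $$\Big\|\tfrac1n\sum_{i=1}^n Z_i\Big\|_4\le 2c_1\sqrt{\operatorname{Var}(Z_1)/n}+4c_2\,n^{-3/4}\|Z_1\|_4,$$ holds for all $n\ge1$ and all i.i.d. centered $Z_1,\dots,Z_n$ with finite fourth moment. Such constants exist. Define, in $[0,\infty]$ (with $a/0=\infty$ for $a\neq0$, $0/0=0\cdot\infty=\infty/\infty=0$), $$K=\frac{\|\tilde X\varepsilon\|_2}{4}\min\Big(\frac{\|\tilde X\varepsilon\|_2}{36\|\tilde X^2\tilde Y\|_1\sigma_Y},\frac{\|\tilde X\varepsilon\|_2\sigma_X}{72\|\tilde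 X^2\tilde Y\|_1\sigma_Y},\frac{\|\tilde X\varepsilon\|_2\sigma_X}{72\|\tilde X\|_3^3\sigma_Y^2},\frac{\|\tilde X\varepsilon\|_2}{36|\tau|\|\tilde X\|_3^3\sigma_Y},\frac{\sigma_X^2}{288\|\tilde X^3\tilde Y\|_1},\frac{\sigma_X^3}{288\|\tilde X\|_4^4\sigma_Y},\frac{\sigma_X^2}{72|\tau|\|\tilde X\|_4^4},\frac{\|\tilde X\varepsilon\|_2}{\|\tilde X\varepsilon\|_4^2},\frac{\|\tilde X\varepsilon\|_2}{8\|\tilde Y^2\tilde X\|_1\sigma_X}\Big),$$ $$H_1=\frac{3\sigma_\varepsilon\sigma_X}{\sqrt{2\pi}\|\tilde X\varepsilon\|_2}+\frac1{\sqrt{2\pi}K},$$ $$\begin{aligned}H_2={}&19+\frac{2\|\tilde Y^2\tilde X\|_2+\sigma_X\|\tilde Y\|_4^2+4\sigma_Y\|\tilde X\tilde Y\|_2}{\|\tilde Y^2\tilde X\|_1}+\frac{9c_{BE}\|\tilde X\varepsilon\|_3^3}{\|\tilde X\varepsilon\|_2^3}+\frac{6c_{BE}\|\varepsilon\|_3^3}{\sigma_\varepsilon^3}+\frac{16c_{BE}\|\tilde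 X\|_3^3}{\sigma_X^3}\\&+\frac{2c_{BE}\|\tilde X\varepsilon\|_6^6}{[\operatorname{Var}(\tilde X^2\varepsilon^2)]^{3/2}}+\frac{6c_{BE}\|\tilde Y\|_3^3}{\sigma_Y^3}+\frac{4\|\tilde X^2\tilde Y\|_2}{\|\tilde X^2\tilde Y\|_1}+\frac{2\sigma_Y\|\tilde X\|_4^2}{\|\tilde X^2\tilde Y\|_1}+\frac{13}{2}\frac{\sigma_X\|\tilde X\|_4^2}{\|\tilde X\|_3^3}+\frac{9\|\tilde X\|_6^3}{\|\tilde X\|_3^3}+\frac{12\|\tilde Y\|_4^2}{\sigma_Y^2}\\&+\frac{32\|\tilde X\|_4^2}{\sigma_X^2}+2^{11/2}\frac{\|\tilde X^3\tilde Y\|_{3/2}^{3/2}}{\|\tilde X^3\tilde Y\|_1^{3/2}}+\frac34\frac{\sigma_Y\|\tilde X\|_6^3}{\|\tilde X^3\tilde Y\|_1}+\frac{16\|\tilde X\|_6^6}{\|\tilde X\|_4^6}+\frac{\sigma_X\|\tilde X\|_6^3}{\|\tilde X\|_4^4}+\frac{64\|\tilde Y^2\tilde X\|_1\sigma_X}{\|\tilde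 X\varepsilon\|_2^2}\\&+\frac{1120\|\tilde X\|_3^3\sigma_Y^2}{\|\tilde X\varepsilon\|_2^2\sigma_X}+64\sqrt2\frac{\|\tilde X\varepsilon\|_3^3}{\|\tilde X\varepsilon\|_2^3}+\frac{288\sigma_Y\|\tilde X^2\tilde Y\|_1}{\|\tilde X\varepsilon\|_2^2}+\frac{432|\tau|\|\tilde X\|_3^3\sigma_Y}{\|\tilde X\varepsilon\|_2^2}+\frac{1152\|\tilde X^3\tilde Y\|_1}{\sigma_X^2\|\tilde X\varepsilon\|_2}\\&+\frac{1152\|\tilde X\|_4^4\sigma_Y}{\sigma_X^3\|\tilde X\varepsilon\|_2}+\frac{576|\tau|\|\tilde X\|_4^4}{\sigma_X^2\|\tilde X\varepsilon\|_2}+\frac{576\|\tilde X^2\tilde Y\|_1\sigma_Y}{\|\tilde X\varepsilon\|_2^2\sigma_X},\end{aligned}$$ $$H_3=\frac{288K\sigma_\varepsilon}{\|\tilde X\varepsilon\|_2^2\sigma_X}\Big[4\|\tilde X^3\tilde Y\|_1+\frac{4\sigma_Y\|\tilde X\|_4^4}{\sigma_X}+|\tau|\|\tilde X\|_4^4\Big],$$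 $$H_4=8\Big[4+\frac{144\|\tilde X^3\tilde Y\|_1\sigma_\varepsilon}{\sigma_X\|\tilde X\varepsilon\|_2^2}+\frac{144\sigma_Y\sigma_\varepsilon\|\tilde X\|_4^4}{\|\tilde X\varepsilon\|_2^2\sigma_X^2}+\frac{72|\tau|\sigma_\varepsilon\|\tilde X\|_4^4}{\sigma_X\|\tilde X\varepsilon\|_2^2}+\frac{c_1^2\sigma_X^3}{\|\tilde X\|_3^3}+\frac{2c_1^2\sigma_X\sigma_Y^2}{\|\tilde Y^2\tilde X\|_1}\Big],$$ $$H_5=32c_2^2\Big[\frac{\sigma_X\|\tilde X\|_4^2}{\|\tilde X\|_3^3}+\frac{2\sigma_X\|\tilde Y\|_4^2}{\|\tilde Y^2\tilde X\|_1}\Big].$$ Then $$\sup_{x\in\mathbb R}\left|\mathbb P\left(\frac{\sqrt n(\hat\tau-\tau)}{\sqrt{\hat v}}\le x\right)-\Phi(x)\right|\le\frac{\log n}{\sqrt n}H_1+\frac{H_2}{\sqrt n}+\frac{H_3}{\sqrt{n\log n}}+\frac{H_4}{n}+\frac{H_5}{n^{3/2}}.$$ Moreover, if $X$ and $Y$ have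 finite moments of order $12$ and $\tilde X\varepsilon$ is not almost surely $0$, then $H_1,H_3,H_4,H_5<\infty$, and $H_2<\infty$ if in addition $\operatorname{Var}(\tilde X^2\varepsilon^2)>0$. -/

import Mathlib

open MeasureTheory ProbabilityTheory
open scoped ENNReal NNReal

noncomputable section

namespace RobustSlope

/-! ### Empirical quantities: least squares for a sample `(x i, y i)`, `i = 1, …, n` -/

/-- Empirical mean. -/
def sampleMean {n : ℕ} (x : Fin n → ℝ) : ℝ := (∑ i, x i) / n

/-- Least-squares slope estimator. -/
def slopeHat {n : ℕ} (x y : Fin n → ℝ) : ℝ :=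
  (∑ i, (x i - sampleMean x) * (y i - sampleMean y)) / ∑ i, (x i - sampleMean x) ^ 2

/-- Least-squares intercept estimator. -/
def interceptHat {n : ℕ} (x y : Fin n → ℝ) : ℝ :=
  sampleMean y - slopeHat x y * sampleMean x

/-- Residuals of the linear regression. -/
def residual {n : ℕ} (x y : Fin n → ℝ) (i : Fin n) : ℝ :=
  y i - interceptHat x y - slopeHat x y * x i

/-- Heteroscedasticity-robust variance estimator. -/
def vHat {n : ℕ} (x y : Fin n → ℝ) : ℝ :=
  ((∑ i, (x i - sampleMean x) ^ 2 * residual x y i ^ 2) / n) /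
    ((∑ i, (x i - sampleMean x) ^ 2) / n) ^ 2

/-- Studentized statistic `√n (τ̂ - τ) / √v̂`. -/
def studentized {n : ℕ} (τ : ℝ) (x y : Fin n → ℝ) : ℝ :=
  √(n : ℝ) * (slopeHat x y - τ) / √(vHat x y)

/-! ### Population quantities of a couple `(X, Y)` of random variables -/

section Population

variable {Ω : Type*} [MeasurableSpace Ω]

/-- The centered variable `Z - E Z`. -/
def centered (μ : Measure Ω) (Z : Ω → ℝ) : Ω → ℝ := fun ω => Z ω - ∫ ω', Z ω' ∂μ

/-- The population slope `τ = Cov(Y, X) / Var(X)`. -/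
def slope (μ : Measure Ω) (X Y : Ω → ℝ) : ℝ := cov[Y, X; μ] / Var[X; μ]

/-- The error `ε = (Y - E Y) - τ (X - E X)`. -/
def err (μ : Measure Ω) (X Y : Ω → ℝ) : Ω → ℝ :=
  fun ω => centered μ Y ω - slope μ X Y * centered μ X ω

/-- The standard deviation, as an extended nonnegative number. -/
def sd (μ : Measure Ω) (Z : Ω → ℝ) : ℝ≥0∞ := ENNReal.ofReal (√(Var[Z; μ]))

/-! The ratios below take values in `[0, ∞]`, where `a / 0 = ∞` for `a ≠ 0`.
In all of them `N q Z` is the `L^q` norm of `Z`. -/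

/-- The constant `K`. -/
def K (μ : Measure Ω) (X Y : Ω → ℝ) : ℝ≥0∞ :=
  let N : ℝ≥0∞ → (Ω → ℝ) → ℝ≥0∞ := fun q Z => eLpNorm Z q μ
  let x := centered μ X
  let y := centered μ Y
  let e := err μ X Y
  let t := ENNReal.ofReal |slope μ X Y|
  let sX := sd μ X
  let sY := sd μ Y
  N 2 (x * e) / 4 *
    ( (N 2 (x * e) / (36 * N 1 (x ^ 2 * y) * sY)) ⊓
      (N 2 (x * e) * sX / (72 * N 1 (x ^ 2 * y) * sY)) ⊓
      (N 2 (x * e) * sX / (72 * N 3 x ^ 3 * sY ^ 2)) ⊓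
      (N 2 (x * e) / (36 * t * N 3 x ^ 3 * sY)) ⊓
      (sX ^ 2 / (288 * N 1 (x ^ 3 * y))) ⊓
      (sX ^ 3 / (288 * N 4 x ^ 4 * sY)) ⊓
      (sX ^ 2 / (72 * t * N 4 x ^ 4)) ⊓
      (N 2 (x * e) / N 4 (x * e) ^ 2) ⊓
      (N 2 (x * e) / (8 * N 1 (y ^ 2 * x) * sX)) )

/-- The ratio `H₁`. -/
def H₁ (μ : Measure Ω) (X Y : Ω → ℝ) : ℝ≥0∞ :=
  3 * sd μ (err μ X Y) * sd μ X /
      (ENNReal.ofReal (√(2 * Real.pi)) * eLpNorm (centered μ X * err μ X Y) 2 μ)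
    + 1 / (ENNReal.ofReal (√(2 * Real.pi)) * K μ X Y)

/-- The ratio `H₂`, with `c` the constant of the Berry–Esseen inequality. -/
def H₂ (c : ℝ≥0) (μ : Measure Ω) (X Y : Ω → ℝ) : ℝ≥0∞ :=
  let N : ℝ≥0∞ → (Ω → ℝ) → ℝ≥0∞ := fun q Z => eLpNorm Z q μ
  let x := centered μ X
  let y := centered μ Y
  let e := err μ X Y
  let t := ENNReal.ofReal |slope μ X Y|
  let sX := sd μ X
  let sY := sd μ Y
  let sE := sd μ e
  19
    + 1 / N 1 (y ^ 2 * x) * (2 * N 2 (y ^ 2 * x) + sX * N 4 y ^ 2 + 4 * sY * N 2 (x * y))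
    + 9 * c * N 3 (x * e) ^ 3 / N 2 (x * e) ^ 3
    + 6 * c * N 3 e ^ 3 / sE ^ 3
    + 16 * c * N 3 x ^ 3 / sX ^ 3
    + 2 * c * N 6 (x * e) ^ 6 / evariance (x ^ 2 * e ^ 2) μ ^ (3 / 2 : ℝ)
    + 6 * c * N 3 y ^ 3 / sY ^ 3
    + 4 * (N 2 (x ^ 2 * y) / N 1 (x ^ 2 * y))
    + 2 * (sY * N 4 x ^ 2 / N 1 (x ^ 2 * y))
    + 13 / 2 * (sX * N 4 x ^ 2 / N 3 x ^ 3)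
    + 9 * (N 6 x ^ 3 / N 3 x ^ 3)
    + 12 * (N 4 y ^ 2 / sY ^ 2)
    + 32 * (N 4 x ^ 2 / sX ^ 2)
    + 2 ^ (11 / 2 : ℝ) * (N (3 / 2) (x ^ 3 * y) ^ (3 / 2 : ℝ) / N 1 (x ^ 3 * y) ^ (3 / 2 : ℝ))
    + 3 / 4 * (sY * N 6 x ^ 3 / N 1 (x ^ 3 * y))
    + 16 * (N 6 x ^ 6 / N 4 x ^ 6)
    + sX * N 6 x ^ 3 / N 4 x ^ 4
    + 64 * N 1 (y ^ 2 * x) * sX / N 2 (x * e) ^ 2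
    + 1120 * N 3 x ^ 3 * sY ^ 2 / (N 2 (x * e) ^ 2 * sX)
    + 64 * ENNReal.ofReal (√2) * (N 3 (x * e) ^ 3 / N 2 (x * e) ^ 3)
    + 288 * sY * N 1 (x ^ 2 * y) / N 2 (x * e) ^ 2
    + 432 * t * N 3 x ^ 3 * sY / N 2 (x * e) ^ 2
    + 1152 * N 1 (x ^ 3 * y) / (sX ^ 2 * N 2 (x * e))
    + 1152 * N 4 x ^ 4 * sY / (sX ^ 3 * N 2 (x * e))
    + 576 * t * N 4 x ^ 4 / (sX ^ 2 * N 2 (x * e))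
    + 576 * N 1 (x ^ 2 * y) * sY / (N 2 (x * e) ^ 2 * sX)

/-- The ratio `H₃`. -/
def H₃ (μ : Measure Ω) (X Y : Ω → ℝ) : ℝ≥0∞ :=
  let N : ℝ≥0∞ → (Ω → ℝ) → ℝ≥0∞ := fun q Z => eLpNorm Z q μ
  let x := centered μ X
  let y := centered μ Y
  let e := err μ X Y
  let t := ENNReal.ofReal |slope μ X Y|
  let sX := sd μ X
  let sY := sd μ Y
  let sE := sd μ e
  288 * K μ X Y * sE / (N 2 (x * e) ^ 2 * sX) *
    (4 * N 1 (x ^ 3 * y) + 4 * (sY * N 4 x ^ 4 / sX) + t * N 4 x ^ 4)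

/-- The ratio `H₄`, with `c₁` the first constant of the Rosenthal inequality. -/
def H₄ (c₁ : ℝ≥0) (μ : Measure Ω) (X Y : Ω → ℝ) : ℝ≥0∞ :=
  let N : ℝ≥0∞ → (Ω → ℝ) → ℝ≥0∞ := fun q Z => eLpNorm Z q μ
  let x := centered μ X
  let y := centered μ Y
  let e := err μ X Y
  let t := ENNReal.ofReal |slope μ X Y|
  let sX := sd μ X
  let sY := sd μ Y
  let sE := sd μ e
  8 * ( 4
    + 144 * N 1 (x ^ 3 * y) * sE / (sX * N 2 (x * e) ^ 2)
    + 144 * sY * sE * N 4 x ^ 4 / (N 2 (x * e) ^ 2 * sX ^ 2)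
    + 72 * t * sE * N 4 x ^ 4 / (sX * N 2 (x * e) ^ 2)
    + c₁ ^ 2 * sX ^ 3 / N 3 x ^ 3
    + 2 * c₁ ^ 2 * sX * sY ^ 2 / N 1 (y ^ 2 * x) )

/-- The ratio `H₅`, with `c₂` the second constant of the Rosenthal inequality. -/
def H₅ (c₂ : ℝ≥0) (μ : Measure Ω) (X Y : Ω → ℝ) : ℝ≥0∞ :=
  let N : ℝ≥0∞ → (Ω → ℝ) → ℝ≥0∞ := fun q Z => eLpNorm Z q μ
  let x := centered μ X
  let y := centered μ Y
  let sX := sd μ X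
  32 * c₂ ^ 2 * (sX * N 4 x ^ 2 / N 3 x ^ 3 + 2 * sX * N 4 y ^ 2 / N 1 (y ^ 2 * x))

end Population

/-! ### The numerical constants

The coordinates of `Fin n → ℝ` under `Measure.pi (fun _ => ν)` are `n` i.i.d. variables of
law `ν`. -/

/-- `c` is admissible in the Berry–Esseen inequality for i.i.d. centered variables with a finite
third moment. -/
def IsBerryEsseenConstant (c : ℝ≥0) : Prop :=
  ∀ (ν : Measure ℝ) [IsProbabilityMeasure ν], MemLp (fun z : ℝ => z) 3 ν → ∫ z, z ∂ν = 0 →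
    0 < Var[fun z : ℝ => z; ν] → ∀ n : ℕ, 1 ≤ n → ∀ x : ℝ,
      |(Measure.pi (fun _ : Fin n => ν)).real
            {z | √(n : ℝ) * sampleMean z / √(Var[fun z : ℝ => z; ν]) ≤ x}
          - cdf (gaussianReal 0 1) x|
        ≤ c * (∫ z, |z| ^ 3 ∂ν) / (√(Var[fun z : ℝ => z; ν]) ^ 3 * √(n : ℝ))

/-- `c₁`, `c₂` are admissible in the Rosenthal inequality
`‖Z̄‖_q ≤ c₁ √q √(Var Z / n) + c₂ q n^(-(q-1)/q) ‖Z‖_q` with exponent `q`, for i.i.d. centered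
variables with a finite moment of order `q`. -/
def IsRosenthalConstant (q : ℝ) (c₁ c₂ : ℝ≥0) : Prop :=
  ∀ (ν : Measure ℝ) [IsProbabilityMeasure ν], MemLp (fun z : ℝ => z) (ENNReal.ofReal q) ν →
    ∫ z, z ∂ν = 0 → ∀ n : ℕ, 1 ≤ n →
      (eLpNorm (fun z : Fin n → ℝ => sampleMean z) (ENNReal.ofReal q)
            (Measure.pi (fun _ : Fin n => ν))).toReal
        ≤ c₁ * √q * √(Var[fun z : ℝ => z; ν] / n)
          + c₂ * q * (1 / (n : ℝ) ^ ((q - 1) / q)) *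
            (eLpNorm (fun z : ℝ => z) (ENNReal.ofReal q) ν).toReal

end RobustSlope

end

open RobustSlope

/-! ### Gaussian smoothing of bounded functions -/

namespace RobustSlope

/-! The left side is at most 1, so only the case in which the terms with `H₁` and `H₂` add up to
less than 1 needs proof, and there these two terms suffice. That case supplies everything else: `H₁`
and `H₂` are finite, which gives the required moments and the nonvanishing of the denominators; `H₂
≥ 19 + 64√2` gives `n ≥ 109²`; and the term with `1/K` gives `M r ≤ 5/6`, where `M = 1/K` and `r =
√(log n / n)`.

Write `x`, `y` for the centered variables, `e = y - τ x` and `s = ‖x e‖₂`. The empirical variance of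
`x` cancels in the studentized statistic, which equals `√n A / √B` with `A` the empirical covariance
of `x` and `e`, and `B` the mean of the squared products of centered regressors and residuals
(`studentized_eq`). On a good event, where a few sample moments are close to or dominated by their
expectations, `A` is within `sX sE r²` of the mean of `x e`, and `B` is within `0.7 M s² r` of `s²`
(`GoodSample.abs_numHat_sub_le`; the ratios in `K` are what this expansion needs). Hence the
statistic is within `√n r² (3 sX sE / s + M)` of the normalized sum `√n mean(x e) / s`. Since `√n r²
= log n / √n` and `Φ` has Lipschitz constant `1/√(2π)`, this distance costs exactly the term with
`H₁`.

The remaining cost is of order `1/√n` and is covered by `H₂`: the Berry–Esseen error of the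
normalized sum, and the probability of leaving the good event. For centered means that probability
comes from Berry–Esseen at `±√(log n)`, where the Gaussian tail is `1/√n` (`IsIIDCopies.tail_le`);
for the other means it comes from Chebyshev, with truncation where only a moment of order `3/2` is
used.

The numerical constants exist by self-contained arguments: Berry–Esseen by Lindeberg replacement
after Gaussian smoothing, closed by induction on `n` (`exists_berryEsseen_convPow`), and Rosenthal
with exponent 4 by expanding the fourth power of a sum (`moments_sum_of_iIndepFun`). -/

open Real in
lemma abs_exp_sub_taylor_two_le (a : ℝ) : |exp a - (1 + a + a ^ 2 / 2)| ≤ |a| ^ 3 * exp |a| := by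
  have h := Complex.norm_exp_sub_sum_le_norm_mul_exp (a : ℂ) 3
  have e : Complex.exp a - ∑ m ∈ Finset.range 3, (a : ℂ) ^ m / (m.factorial : ℂ)
      = ((exp a - (1 + a + a ^ 2 / 2) : ℝ) : ℂ) := by
    simp [Finset.sum_range_succ, Nat.factorial]
  rw [e] at h
  simpa only [Complex.norm_real, Real.norm_eq_abs] using h

-- The exponential is the density ratio of `N(u,1)` to `N(0,1)` and the generating function of the
-- Hermite polynomials. The terms up to `u²` are kept, and the remainder is cubic in `u` with a
-- Gaussian-integrable factor.
open Real in
lemma gaussian_kernel_taylor {u : ℝ} (hu : |u| ≤ 1) (w : ℝ) :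
    |exp (u * w - u ^ 2 / 2) - (1 + u * w + u ^ 2 * ((w ^ 2 - 1) / 2))|
      ≤ |u| ^ 3 * (7 * exp (2 * (|w| + 1))) := by
  set a := u * w - u ^ 2 / 2 with ha
  have hu0 := abs_nonneg u
  have hw0 := abs_nonneg w
  have hab : |a| ≤ |u| * (|w| + 1) := by
    calc |a| ≤ |u * w| + |u ^ 2 / 2| := abs_sub _ _
      _ = |u| * |w| + |u| * |u| / 2 := by
        rw [abs_mul, abs_div, abs_pow, abs_two]; ring
      _ ≤ _ := by nlinarith
  have hab' : |a| ≤ |w| + 1 := hab.trans (by nlinarith)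
  have h1 := abs_exp_sub_taylor_two_le a
  have hcube : (|w| + 1) ^ 3 ≤ 6 * exp (|w| + 1) := by
    have := Real.pow_div_factorial_le_exp (|w| + 1) (by positivity) 3
    simp [Nat.factorial] at this
    linarith
  have h2 : |a| ^ 3 * exp |a| ≤ |u| ^ 3 * (6 * exp (2 * (|w| + 1))) := by
    calc |a| ^ 3 * exp |a| ≤ (|u| * (|w| + 1)) ^ 3 * exp (|w| + 1) := by gcongr
      _ = |u| ^ 3 * ((|w| + 1) ^ 3 * exp (|w| + 1)) := by ring
      _ ≤ |u| ^ 3 * (6 * exp (|w| + 1) * exp (|w| + 1)) := by gcongr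
      _ = _ := by rw [mul_assoc 6, ← exp_add]; ring_nf
  have h3 : |(1 + a + a ^ 2 / 2) - (1 + u * w + u ^ 2 * ((w ^ 2 - 1) / 2))|
      ≤ |u| ^ 3 * exp (2 * (|w| + 1)) := by
    have : (1 + a + a ^ 2 / 2) - (1 + u * w + u ^ 2 * ((w ^ 2 - 1) / 2))
        = u ^ 3 * (u / 8 - w / 2) := by rw [ha]; ring
    rw [this, abs_mul, abs_pow]
    gcongr
    have h4 : |u / 8 - w / 2| ≤ |u| / 8 + |w| / 2 := by
      refine (abs_sub _ _).trans (le_of_eq ?_)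
      simp [abs_div]
    have h5 := Real.add_one_le_exp (2 * (|w| + 1))
    linarith
  calc _ = |(exp a - (1 + a + a ^ 2 / 2))
          + ((1 + a + a ^ 2 / 2) - (1 + u * w + u ^ 2 * ((w ^ 2 - 1) / 2)))| := by ring_nf
    _ ≤ _ := abs_add_le _ _
    _ ≤ _ := by linarith

lemma integrable_exp_abs_gaussian :
    Integrable (fun w : ℝ => 7 * Real.exp (2 * (|w| + 1))) (gaussianReal 0 1) := by
  have h1 := integrable_exp_mul_gaussianReal (μ := 0) (v := 1) 2
  have h2 := integrable_exp_mul_gaussianReal (μ := 0) (v := 1) (-2)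
  refine (((h1.add h2).const_mul (Real.exp 2)).mono' (by fun_prop) ?_).const_mul 7
  refine Filter.Eventually.of_forall fun w => ?_
  rw [Real.norm_eq_abs, abs_of_pos (Real.exp_pos _), mul_add, Real.exp_add, mul_comm (Real.exp _)]
  simp only [Pi.add_apply, mul_one]
  gcongr
  rcases abs_cases w with ⟨h, -⟩ | ⟨h, -⟩ <;> rw [h]
  · linarith [Real.exp_pos (-2 * w)]
  · rw [mul_neg, ← neg_mul]; linarith [Real.exp_pos (2 * w)]

/-- A change of variable moves the shift from `f` onto the density, so that smoothness in `u`
requires none of `f`. -/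
lemma integral_shift_gaussian (f : ℝ → ℝ) (u : ℝ) :
    ∫ w, f (w + u) ∂gaussianReal 0 1
      = ∫ w, f w * Real.exp (u * w - u ^ 2 / 2) ∂gaussianReal 0 1 := by
  rw [integral_gaussianReal_eq_integral_smul one_ne_zero,
    integral_gaussianReal_eq_integral_smul one_ne_zero,
    ← integral_sub_right_eq_self (fun w => gaussianPDFReal 0 1 w • f (w + u)) u]
  congr 1 with w
  simp only [sub_add_cancel, smul_eq_mul]
  have : gaussianPDFReal 0 1 (w - u)
      = gaussianPDFReal 0 1 w * Real.exp (u * w - u ^ 2 / 2) := by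
    simp only [gaussianPDFReal, mul_assoc, ← Real.exp_add]
    congr 3
    simp; ring
  rw [this]; ring

/-- Gaussian smoothing of a bounded function has a cubic Taylor remainder at `0`. -/
lemma exists_gaussian_smoothing_taylor : ∃ C : ℝ, 0 ≤ C ∧ ∀ (f : ℝ → ℝ) (D : ℝ), Measurable f →
    (∀ x, |f x| ≤ D) → ∃ a b c : ℝ, ∀ u,
      |∫ w, f (w + u) ∂gaussianReal 0 1 - (a + b * u + c * u ^ 2)| ≤ C * D * |u| ^ 3 := by
  set C₁ := ∫ w, 7 * Real.exp (2 * (|w| + 1)) ∂gaussianReal 0 1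
  have hC₁ : 0 ≤ C₁ := integral_nonneg fun w => by positivity
  refine ⟨C₁ + 1, by positivity, fun f D hf hD => ?_⟩
  have hD0 : 0 ≤ D := (abs_nonneg _).trans (hD 0)
  have hpoly : ∀ w : ℝ, 1 + |w| + (w ^ 2 + 1) / 2 ≤ 7 * Real.exp (2 * (|w| + 1)) := by
    intro w
    have h := Real.quadratic_le_exp_of_nonneg (x := 2 * (|w| + 1)) (by positivity)
    nlinarith [abs_nonneg w, sq_abs w]
  have hI : ∀ g : ℝ → ℝ, Measurable g → (∀ w, |g w| ≤ 7 * Real.exp (2 * (|w| + 1))) →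
      Integrable (fun w => f w * g w) (gaussianReal 0 1) := fun g hg hgb => by
    refine (integrable_exp_abs_gaussian.const_mul D).mono' (by fun_prop) ?_
    refine Filter.Eventually.of_forall fun w => ?_
    rw [norm_mul]
    exact mul_le_mul (hD w) (hgb w) (abs_nonneg _) hD0
  have i0 := hI (fun _ => 1) measurable_const (fun w => by
    rw [abs_one]; refine le_trans ?_ (hpoly w); nlinarith [abs_nonneg w])
  have i1 := hI (fun w => w) measurable_id (fun w => by
    refine le_trans ?_ (hpoly w); nlinarith [abs_nonneg w])
  have i2 := hI (fun w => (w ^ 2 - 1) / 2) (by fun_prop) (fun w => by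
    refine le_trans ?_ (hpoly w)
    rw [abs_le]; constructor <;> nlinarith [abs_nonneg w])
  have i01 (u : ℝ) : Integrable (fun w => f w * 1 + f w * w * u) (gaussianReal 0 1) :=
    i0.add (i1.mul_const u)
  -- The Taylor coefficients are the integrals of `f` against the Hermite polynomials `1`, `w`, `(w²
  -- - 1)/2`.
  refine ⟨∫ w, f w * 1 ∂gaussianReal 0 1, ∫ w, f w * w ∂gaussianReal 0 1,
    ∫ w, f w * ((w ^ 2 - 1) / 2) ∂gaussianReal 0 1, fun u => ?_⟩
  have hlin : (∫ w, f w * 1 ∂gaussianReal 0 1) + (∫ w, f w * w ∂gaussianReal 0 1) * u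
      + (∫ w, f w * ((w ^ 2 - 1) / 2) ∂gaussianReal 0 1) * u ^ 2
      = ∫ w, f w * (1 + u * w + u ^ 2 * ((w ^ 2 - 1) / 2)) ∂gaussianReal 0 1 := by
    rw [← integral_mul_const, ← integral_mul_const, ← integral_add i0 (i1.mul_const u),
      ← integral_add (i01 u) (i2.mul_const _)]
    congr 1 with w
    ring
  have ipoly : Integrable (fun w => f w * (1 + u * w + u ^ 2 * ((w ^ 2 - 1) / 2)))
      (gaussianReal 0 1) := by
    refine ((i01 u).add (i2.mul_const (u ^ 2))).congr (Filter.Eventually.of_forall fun w => ?_)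
    simp only [Pi.add_apply]; ring
  rw [hlin]
  -- Expansion of the kernel is needed only for small `u`. For `|u| ≥ 1` the integral and the
  -- polynomial are separately of order `D |u|³`.
  rcases le_total |u| 1 with hu | hu
  · have iexp : Integrable (fun w => f w * Real.exp (u * w - u ^ 2 / 2)) (gaussianReal 0 1) := by
      refine hI _ (by fun_prop) (fun w => ?_)
      rw [abs_of_pos (Real.exp_pos _)]
      have h1 : u * w ≤ |w| := by
        calc u * w ≤ |u * w| := le_abs_self _
          _ = |u| * |w| := abs_mul _ _
          _ ≤ _ := by nlinarith [abs_nonneg w]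
      have : Real.exp (u * w - u ^ 2 / 2) ≤ Real.exp (2 * (|w| + 1)) :=
        Real.exp_le_exp.2 (by nlinarith [abs_nonneg w, sq_nonneg u])
      linarith [Real.exp_pos (2 * (|w| + 1))]
    rw [integral_shift_gaussian, ← integral_sub iexp ipoly]
    have hb : ∀ w, ‖f w * Real.exp (u * w - u ^ 2 / 2)
        - f w * (1 + u * w + u ^ 2 * ((w ^ 2 - 1) / 2))‖
          ≤ D * |u| ^ 3 * (7 * Real.exp (2 * (|w| + 1))) := fun w => by
      rw [← mul_sub, norm_mul, mul_assoc]
      exact mul_le_mul (hD w) (gaussian_kernel_taylor hu w) (norm_nonneg _) hD0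
    have h := norm_integral_le_of_norm_le (integrable_exp_abs_gaussian.const_mul (D * |u| ^ 3))
      (Filter.Eventually.of_forall hb)
    rw [integral_const_mul] at h
    refine h.trans ?_
    have : 0 ≤ D * |u| ^ 3 := by positivity
    nlinarith
  · have h1 : |∫ w, f (w + u) ∂gaussianReal 0 1| ≤ D := by
      have := norm_integral_le_of_norm_le_const (μ := gaussianReal 0 1)
        (f := fun w => f (w + u)) (C := D) (Filter.Eventually.of_forall fun w => hD _)
      simpa using this
    have hu3 : 1 ≤ |u| ^ 3 := one_le_pow₀ hu
    have h2 : |∫ w, f w * (1 + u * w + u ^ 2 * ((w ^ 2 - 1) / 2)) ∂gaussianReal 0 1|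
        ≤ D * |u| ^ 3 * C₁ := by
      rw [← integral_const_mul]
      rw [← Real.norm_eq_abs]
      refine norm_integral_le_of_norm_le (integrable_exp_abs_gaussian.const_mul (D * |u| ^ 3))
        (Filter.Eventually.of_forall fun w => ?_)
      rw [norm_mul, mul_assoc]
      refine mul_le_mul (hD w) ?_ (norm_nonneg _) hD0
      have hup : |u| ≤ |u| ^ 3 := by nlinarith [abs_nonneg u, sq_nonneg (|u| - 1)]
      have hup2 : u ^ 2 ≤ |u| ^ 3 := by rw [← sq_abs]; nlinarith [abs_nonneg u]
      calc ‖1 + u * w + u ^ 2 * ((w ^ 2 - 1) / 2)‖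
          ≤ |1 + u * w| + |u ^ 2 * ((w ^ 2 - 1) / 2)| := abs_add_le _ _
        _ ≤ |1| + |u * w| + |u ^ 2 * ((w ^ 2 - 1) / 2)| := by gcongr; exact abs_add_le _ _
        _ = 1 + |u| * |w| + u ^ 2 * |(w ^ 2 - 1) / 2| := by
          rw [abs_one, abs_mul, abs_mul, abs_pow, sq_abs]
        _ ≤ |u| ^ 3 + |u| ^ 3 * |w| + |u| ^ 3 * ((w ^ 2 + 1) / 2) := by
          gcongr
          rw [abs_le]; constructor <;> nlinarith [sq_nonneg w]
        _ = |u| ^ 3 * (1 + |w| + (w ^ 2 + 1) / 2) := by ring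
        _ ≤ _ := by gcongr; exact hpoly w
    calc _ ≤ _ := abs_sub _ _
      _ ≤ D + D * |u| ^ 3 * C₁ := add_le_add h1 h2
      _ ≤ _ := by nlinarith
end RobustSlope

/-! ### Lindeberg replacement -/

namespace RobustSlope

lemma gaussianReal_eq_map_sqrt_mul (v : ℝ≥0) :
    gaussianReal 0 v = (gaussianReal 0 1).map (fun w => √(v : ℝ) * w) := by
  rw [gaussianReal_map_const_mul, mul_zero]
  congr 1
  ext
  simp

/-- Rescaling by `√v` turns a cubic remainder into a gain of `v^(-3/2)`; this decay is summable
along the replacement of the summands. -/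
lemma exists_gaussian_smoothing_taylor_scaled : ∃ C : ℝ, 0 ≤ C ∧ ∀ (f : ℝ → ℝ) (D : ℝ) (v : ℝ≥0),
    Measurable f → (∀ x, |f x| ≤ D) → v ≠ 0 → ∃ a b c : ℝ, ∀ u,
      |∫ w, f (u + w) ∂gaussianReal 0 v - (a + b * u + c * u ^ 2)|
        ≤ C * D / √(v : ℝ) ^ 3 * |u| ^ 3 := by
  obtain ⟨C, hC, h⟩ := exists_gaussian_smoothing_taylor
  refine ⟨C, hC, fun f D v hf hD hv => ?_⟩
  have hs : 0 < √(v : ℝ) := Real.sqrt_pos.2 (by exact_mod_cast pos_iff_ne_zero.2 hv)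
  obtain ⟨a, b, c, habc⟩ := h (fun x => f (√(v : ℝ) * x)) D (by fun_prop) (fun x => hD _)
  refine ⟨a, b / √(v : ℝ), c / √(v : ℝ) ^ 2, fun u => ?_⟩
  have h1 := habc (u / √(v : ℝ))
  have h2 : ∫ w, f (u + w) ∂gaussianReal 0 v
      = ∫ w, f (√(v : ℝ) * (w + u / √(v : ℝ))) ∂gaussianReal 0 1 := by
    have hfu : Measurable fun w => f (u + w) := hf.comp (measurable_const_add u)
    rw [gaussianReal_eq_map_sqrt_mul, integral_map (by fun_prop) hfu.aestronglyMeasurable]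
    congr 1 with w
    congr 1
    field_simp
    ring
  rw [h2]
  convert h1 using 1
  · congr 2; field_simp
  · rw [abs_div, abs_of_pos hs]; field_simp

/-- Centered, with unit second moment and finite third absolute moment. -/
structure IsStandardized (μ : Measure ℝ) : Prop where
  integrable_cube : Integrable (fun x : ℝ => |x| ^ 3) μ
  integral_id : ∫ x, x ∂μ = 0
  integral_sq : ∫ x, x ^ 2 ∂μ = 1

lemma IsStandardized.integrable_of_le {μ : Measure ℝ} [IsProbabilityMeasure μ]
    (h : IsStandardized μ) {g : ℝ → ℝ} (hg : Measurable g) {c : ℝ}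
    (hle : ∀ x, |g x| ≤ c * (1 + |x| ^ 3)) : Integrable g μ :=
  (((integrable_const 1).add h.integrable_cube).const_mul c).mono' hg.aestronglyMeasurable
    (Filter.Eventually.of_forall hle)

lemma IsStandardized.integrable_id {μ : Measure ℝ} [IsProbabilityMeasure μ]
    (h : IsStandardized μ) : Integrable (fun x : ℝ => x) μ :=
  h.integrable_of_le measurable_id (c := 1) fun x => by
    nlinarith [abs_nonneg x, mul_nonneg (abs_nonneg x) (sq_nonneg (|x| - 1))]

lemma IsStandardized.integrable_sq {μ : Measure ℝ} [IsProbabilityMeasure μ]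
    (h : IsStandardized μ) : Integrable (fun x : ℝ => x ^ 2) μ :=
  h.integrable_of_le (by fun_prop) (c := 1) fun x => by
    rw [abs_pow]; nlinarith [abs_nonneg x, mul_nonneg (abs_nonneg x) (sq_nonneg (|x| - 1))]

/-- The inequality `3/2 x² - 1/2 ≤ |x|³`, with contact at `|x| = 1`, is integrated. -/
lemma IsStandardized.one_le {μ : Measure ℝ} [IsProbabilityMeasure μ]
    (h : IsStandardized μ) : 1 ≤ ∫ x, |x| ^ 3 ∂μ := by
  have h1 : ∫ x, (3 / 2 * x ^ 2 - 1 / 2) ∂μ ≤ ∫ x, |x| ^ 3 ∂μ := by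
    refine integral_mono ((h.integrable_sq.const_mul _).sub (integrable_const _))
      h.integrable_cube fun x => ?_
    simp only
    rw [← sq_abs]
    nlinarith [abs_nonneg x, mul_nonneg (abs_nonneg x) (sq_nonneg (|x| - 1)), sq_nonneg (|x| - 1)]
  rw [integral_sub (h.integrable_sq.const_mul _) (integrable_const _), integral_const_mul,
    h.integral_sq] at h1
  simp at h1
  linarith

lemma isStandardized_gaussianReal : IsStandardized (gaussianReal 0 1) where
  integrable_cube := by
    have := (memLp_id_gaussianReal (μ := 0) (v := 1) 3).integrable_norm_pow (by norm_num)
    simpa using this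
  integral_id := integral_id_gaussianReal
  integral_sq := by
    have := variance_fun_id_gaussianReal (μ := 0) (v := 1)
    rw [variance_eq_integral (by fun_prop)] at this
    simpa using this

lemma integrable_of_bounded {α : Type*} [MeasurableSpace α] {μ : Measure α} [IsFiniteMeasure μ]
    {f : α → ℝ} (hf : Measurable f) {D : ℝ} (hD : ∀ x, |f x| ≤ D) : Integrable f μ :=
  (integrable_const D).mono' hf.aestronglyMeasurable (Filter.Eventually.of_forall hD)

lemma integral_conv_of_bounded {μ ν : Measure ℝ} [IsFiniteMeasure μ] [IsFiniteMeasure ν]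
    {f : ℝ → ℝ} (hf : Measurable f) {D : ℝ} (hD : ∀ x, |f x| ≤ D) :
    ∫ x, f x ∂(μ ∗ ν) = ∫ x, ∫ y, f (x + y) ∂ν ∂μ :=
  integral_conv (integrable_of_bounded hf hD)

/-- Replacing a standardized law by the Gaussian one, after Gaussian smoothing. -/
lemma exists_swap_bound : ∃ C : ℝ, 0 ≤ C ∧ ∀ (μ : Measure ℝ) [IsProbabilityMeasure μ]
    (f : ℝ → ℝ) (D : ℝ) (v : ℝ≥0), IsStandardized μ →
    Measurable f → (∀ x, |f x| ≤ D) → v ≠ 0 →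
      |∫ x, f x ∂(μ ∗ gaussianReal 0 v) - ∫ x, f x ∂(gaussianReal 0 1 ∗ gaussianReal 0 v)|
        ≤ C * (∫ x, |x| ^ 3 ∂μ) * (D / √(v : ℝ) ^ 3) := by
  obtain ⟨C, hC, h⟩ := exists_gaussian_smoothing_taylor_scaled
  set m := ∫ x, |x| ^ 3 ∂gaussianReal 0 1
  have hm : 1 ≤ m := isStandardized_gaussianReal.one_le
  -- The Gaussian third moment `m` is absorbed because the third moment of `μ` is at least 1.
  refine ⟨C * (1 + m), by positivity, fun μ _ f D v hμ hf hD hv => ?_⟩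
  have hD0 : 0 ≤ D := (abs_nonneg _).trans (hD 0)
  obtain ⟨a, b, c, habc⟩ := h f D v hf hD hv
  -- Every standardized law integrates `a + b u + c u²` to the same value `a + c`, so only the cubic
  -- remainder distinguishes two of them.
  have key : ∀ (ν : Measure ℝ) [IsProbabilityMeasure ν], IsStandardized ν →
      |∫ x, f x ∂(ν ∗ gaussianReal 0 v) - (a + c)|
        ≤ C * D / √(v : ℝ) ^ 3 * ∫ x, |x| ^ 3 ∂ν := by
    intro ν _ hν
    have hmeas : Measurable fun u => ∫ w, f (u + w) ∂gaussianReal 0 v :=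
      ((show Measurable fun p : ℝ × ℝ => f (p.1 + p.2) by
        fun_prop).stronglyMeasurable.integral_prod_right).measurable
    have hb : ∀ u, |∫ w, f (u + w) ∂gaussianReal 0 v| ≤ D := fun u => by
      have := norm_integral_le_of_norm_le_const (μ := gaussianReal 0 v)
        (f := fun w => f (u + w)) (C := D) (Filter.Eventually.of_forall fun w => hD _)
      simpa using this
    have i1 : Integrable (fun x : ℝ => a + b * x) ν :=
      (integrable_const a).add (hν.integrable_id.const_mul b)
    have i2 : Integrable (fun x : ℝ => a + b * x + c * x ^ 2) ν :=
      i1.add (hν.integrable_sq.const_mul c)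
    have e : a + c = ∫ x, (a + b * x + c * x ^ 2) ∂ν := by
      rw [integral_add i1 (hν.integrable_sq.const_mul c),
        integral_add (integrable_const a) (hν.integrable_id.const_mul b), integral_const_mul,
        integral_const_mul, hν.integral_id, hν.integral_sq]
      simp
    rw [integral_conv_of_bounded hf hD, e, ← integral_sub (integrable_of_bounded hmeas hb) i2,
      ← integral_const_mul]
    rw [← Real.norm_eq_abs]
    exact norm_integral_le_of_norm_le (hν.integrable_cube.const_mul (C * D / √(v : ℝ) ^ 3))
      (Filter.Eventually.of_forall habc)
  have h1 := key μ hμ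
  have h2 := key _ isStandardized_gaussianReal
  have h3 := hμ.one_le
  set q := √(v : ℝ) ^ 3
  have hq : 0 ≤ D / q := by positivity
  calc _ = |(∫ x, f x ∂(μ ∗ gaussianReal 0 v) - (a + c))
        - (∫ x, f x ∂(gaussianReal 0 1 ∗ gaussianReal 0 v) - (a + c))| := by ring_nf
    _ ≤ _ := abs_sub _ _
    _ ≤ C * D / q * (∫ x, |x| ^ 3 ∂μ) + C * D / q * m := add_le_add h1 h2
    _ = C * ((∫ x, |x| ^ 3 ∂μ) + m) * (D / q) := by ring
    _ ≤ _ := by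
      refine mul_le_mul_of_nonneg_right ?_ hq
      rw [mul_assoc]
      gcongr
      nlinarith

lemma real_conv_Iic (α β : Measure ℝ) [IsProbabilityMeasure α] [IsProbabilityMeasure β] (x : ℝ) :
    (α ∗ β).real (Set.Iic x) = ∫ w, cdf α (x - w) ∂β := by
  rw [Measure.conv_comm, ← integral_indicator_one measurableSet_Iic,
    integral_conv_of_bounded (D := 1) (f := (Set.Iic x).indicator 1)
      (measurable_const.indicator measurableSet_Iic)]
  · congr 1 with w
    rw [cdf_eq_real, ← integral_indicator_one measurableSet_Iic]
    congr 1 with y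
    simp only [Set.indicator, Set.mem_Iic]
    congr 1
    exact propext ⟨fun h => by linarith, fun h => by linarith⟩
  · intro y
    by_cases h : y ∈ Set.Iic x <;> simp [h]

lemma abs_indicator_one_le (s : Set ℝ) (x : ℝ) : |s.indicator (1 : ℝ → ℝ) x| ≤ 1 := by
  by_cases h : x ∈ s <;> simp [h]

lemma measurable_cdf (α : Measure ℝ) : Measurable (cdf α) := (monotone_cdf α).measurable

lemma abs_cdf_sub_le_one (α β : Measure ℝ) (x : ℝ) : |cdf α x - cdf β x| ≤ 1 := by
  rw [abs_le]
  constructor <;> linarith [cdf_nonneg α x, cdf_nonneg β x, cdf_le_one α x, cdf_le_one β x]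

/-- One step of the Lindeberg replacement, with the cumulative distribution function of the other
summands compared to a Gaussian one. -/
lemma exists_lindeberg_step : ∃ C : ℝ, 0 ≤ C ∧ ∀ (μ α : Measure ℝ) [IsProbabilityMeasure μ]
    [IsProbabilityMeasure α] (k v : ℝ≥0) (δ : ℝ), IsStandardized μ → v ≠ 0 →
    (∀ x, |cdf α x - cdf (gaussianReal 0 k) x| ≤ δ) → ∀ x,
      |(α ∗ (μ ∗ gaussianReal 0 v)).real (Set.Iic x)
          - (α ∗ (gaussianReal 0 1 ∗ gaussianReal 0 v)).real (Set.Iic x)|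
        ≤ C * (∫ x, |x| ^ 3 ∂μ) * (δ / √(v : ℝ) ^ 3 + 1 / √((k + v : ℝ≥0) : ℝ) ^ 3) := by
  obtain ⟨C, hC, h⟩ := exists_swap_bound
  refine ⟨C, hC, fun μ α _ _ k v δ hμ hv hδ x => ?_⟩
  -- The distribution function of `α` is a Gaussian one plus an error of size `δ`. The error is
  -- smoothed by the variance `v` alone, whereas in the main part the variances `k` and `v` combine.
  have split : ∀ (β : Measure ℝ) [IsProbabilityMeasure β],
      (α ∗ β).real (Set.Iic x) = ∫ w, (cdf α (x - w) - cdf (gaussianReal 0 k) (x - w)) ∂β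
        + (gaussianReal 0 k ∗ β).real (Set.Iic x) := by
    intro β _
    have hi : ∀ α : Measure ℝ, Integrable (fun w => cdf α (x - w)) β := fun α =>
      integrable_of_bounded (D := 1) ((measurable_cdf α).comp (by fun_prop)) fun w => by
        rw [abs_of_nonneg (cdf_nonneg _ _)]; exact cdf_le_one _ _
    rw [real_conv_Iic, real_conv_Iic, integral_sub (hi _) (hi _)]
    ring
  have gauss : ∀ (ν : Measure ℝ) [IsProbabilityMeasure ν],
      (gaussianReal 0 k ∗ (ν ∗ gaussianReal 0 v)).real (Set.Iic x)
        = ∫ y, (Set.Iic x).indicator 1 y ∂(ν ∗ gaussianReal 0 (k + v)) := by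
    intro ν _
    rw [Measure.conv_comm (gaussianReal 0 k), Measure.conv_assoc, gaussianReal_conv_gaussianReal,
      integral_indicator_one measurableSet_Iic]
    congr 3
    · simp
    · exact add_comm _ _
  rw [split, split (gaussianReal 0 1 ∗ gaussianReal 0 v), gauss, gauss]
  have h1 := h μ (fun w => cdf α (x - w) - cdf (gaussianReal 0 k) (x - w)) δ v hμ
    (((measurable_cdf _).comp (by fun_prop)).sub ((measurable_cdf _).comp (by fun_prop)))
    (fun w => hδ _) hv
  have h2 := h μ ((Set.Iic x).indicator 1) 1 (k + v) hμ
    (measurable_const.indicator measurableSet_Iic) (abs_indicator_one_le _) (by simp [hv])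
  rw [add_sub_add_comm, mul_add]
  exact (abs_add_le _ _).trans (add_le_add h1 h2)

/-- Convolution powers. -/
noncomputable def convPow (μ : Measure ℝ) : ℕ → Measure ℝ
  | 0 => Measure.dirac 0
  | n + 1 => convPow μ n ∗ μ

instance (μ : Measure ℝ) [IsProbabilityMeasure μ] (n : ℕ) : IsProbabilityMeasure (convPow μ n) := by
  induction n with
  | zero => exact inferInstanceAs (IsProbabilityMeasure (Measure.dirac 0))
  | succ n ih => exact inferInstanceAs (IsProbabilityMeasure (convPow μ n ∗ μ))

/-- The summands are exchanged one at a time and the differences telescope. With `k` original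
summands on the left, the Gaussian variance on the right is `e + (n - 1 - k)`; as `e ≥ 1`, the
combined variance is at least `n`. Only the powers `k < n` enter, as an induction requires. -/
lemma exists_lindeberg_sum : ∃ C : ℝ, 0 ≤ C ∧ ∀ (μ : Measure ℝ) [IsProbabilityMeasure μ]
    (δ : ℕ → ℝ) (n : ℕ) (e : ℝ≥0), IsStandardized μ → 1 ≤ e →
    (∀ k < n, ∀ x, |cdf (convPow μ k) x - cdf (gaussianReal 0 k) x| ≤ δ k) → ∀ x,
      |(convPow μ n ∗ gaussianReal 0 e).real (Set.Iic x)
          - (gaussianReal 0 n ∗ gaussianReal 0 e).real (Set.Iic x)|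
        ≤ C * (∫ x, |x| ^ 3 ∂μ) * ∑ k ∈ Finset.range n,
            (δ k / √((e + (n - 1 - k : ℕ) : ℝ≥0) : ℝ) ^ 3 + 1 / √(n : ℝ) ^ 3) := by
  obtain ⟨C, hC, h⟩ := exists_lindeberg_step
  refine ⟨C, hC, fun μ _ δ n e hμ he hδ x => ?_⟩
  set a : ℕ → ℝ := fun k => (convPow μ k ∗ gaussianReal 0 (e + (n - k : ℕ))).real (Set.Iic x)
  have h0 : (gaussianReal 0 n ∗ gaussianReal 0 e).real (Set.Iic x) = a 0 := by
    simp only [a, convPow, Measure.dirac_zero_conv, gaussianReal_conv_gaussianReal]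
    congr 2
    · simp
    · simp [add_comm]
  have hn : (convPow μ n ∗ gaussianReal 0 e).real (Set.Iic x) = a n := by simp [a]
  rw [h0, hn, ← Finset.sum_range_sub, Finset.mul_sum]
  refine (Finset.abs_sum_le_sum_abs _ _).trans (Finset.sum_le_sum fun k hk => ?_)
  have hk : k < n := Finset.mem_range.1 hk
  have he0 : e + ((n - 1 - k : ℕ) : ℝ≥0) ≠ 0 := by positivity
  have h1 := h μ (convPow μ k) k (e + (n - 1 - k : ℕ)) (δ k) hμ he0 (hδ k hk) x
  have e1 : a (k + 1) = (convPow μ k ∗ (μ ∗ gaussianReal 0 (e + (n - 1 - k : ℕ)))).real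
      (Set.Iic x) := by
    simp only [a, convPow, Measure.conv_assoc]
    rw [show n - (k + 1) = n - 1 - k by omega]
  have e2 : a k = (convPow μ k ∗ (gaussianReal 0 1 ∗ gaussianReal 0 (e + (n - 1 - k : ℕ)))).real
      (Set.Iic x) := by
    simp only [a, gaussianReal_conv_gaussianReal]
    congr 3
    · simp
    · rw [show n - k = (n - 1 - k) + 1 by omega]; push_cast; ring
  rw [e1, e2]
  refine h1.trans ?_
  have hV : (n : ℝ) ≤ ((k + (e + (n - 1 - k : ℕ)) : ℝ≥0) : ℝ) := by
    have : (n : ℝ) = (k : ℝ) + 1 + (n - 1 - k : ℕ) := by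
      have : n = k + 1 + (n - 1 - k) := by omega
      exact_mod_cast this
    have he' : (1 : ℝ) ≤ e := by exact_mod_cast he
    simp only [NNReal.coe_add, NNReal.coe_natCast]
    linarith
  have hn0 : 0 < (n : ℝ) := by exact_mod_cast (by omega : 0 < n)
  have := hμ.one_le
  gcongr
end RobustSlope

/-! ### Removal of the smoothing, and the induction for Berry–Esseen -/

namespace RobustSlope

lemma cdf_gaussianReal_sub_le {v : ℝ≥0} (hv : v ≠ 0) {a b : ℝ} (hab : a ≤ b) :
    cdf (gaussianReal 0 v) b - cdf (gaussianReal 0 v) a ≤ (b - a) / √(2 * Real.pi * v) := by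
  rw [cdf_eq_real, cdf_eq_real, ← measureReal_sdiff (Set.Iic_subset_Iic.2 hab) measurableSet_Iic,
    Set.Iic_sdiff_Iic, measureReal_def, gaussianReal_apply_eq_integral _ hv, ENNReal.toReal_ofReal
      (integral_nonneg fun x => gaussianPDFReal_nonneg _ _ _)]
  have hb : ∀ x, gaussianPDFReal 0 v x ≤ 1 / √(2 * Real.pi * v) := fun x => by
    rw [gaussianPDFReal, one_div]
    refine mul_le_of_le_one_right (by positivity) (Real.exp_le_one_iff.2 ?_)
    rw [neg_div]; exact neg_nonpos.2 (by positivity)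
  calc ∫ x in Set.Ioc a b, gaussianPDFReal 0 v x
      ≤ ∫ x in Set.Ioc a b, 1 / √(2 * Real.pi * v) :=
        integral_mono (integrable_gaussianPDFReal 0 v).integrableOn
          (integrable_const _) fun x => hb x
    _ = _ := by
      simp only [integral_const, MeasurableSet.univ, measureReal_restrict_apply, Set.univ_inter,
        smul_eq_mul]
      rw [Real.volume_real_Ioc_of_le hab]; ring

/-- The two lower bounds on `g` combine into `g w ≥ c - (c + D) w² / (4e)` for all `w`; the integral
of the right side is `c - (c + D)/4`. -/
lemma lower_bound_gaussian_average {e : ℝ≥0} (he : e ≠ 0) {g : ℝ → ℝ} (hg : Measurable g)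
    {D c : ℝ} (hD : ∀ w, |g w| ≤ D) (hc : -D ≤ c)
    (hgc : ∀ w, |w| ≤ 2 * √(e : ℝ) → c ≤ g w) :
    3 / 4 * c - D / 4 ≤ ∫ w, g w ∂gaussianReal 0 e := by
  have hs : 0 < (e : ℝ) := by exact_mod_cast pos_iff_ne_zero.2 he
  have hi : Integrable (fun w : ℝ => w ^ 2) (gaussianReal 0 e) :=
    (memLp_id_gaussianReal (μ := 0) (v := e) 2).integrable_sq
  have hvar : ∫ w, w ^ 2 ∂gaussianReal 0 e = e := by
    have := variance_fun_id_gaussianReal (μ := 0) (v := e)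
    rw [variance_eq_integral (by fun_prop)] at this
    simpa using this
  have h : ∫ w, (c - (c + D) / (4 * e) * w ^ 2) ∂gaussianReal 0 e
      ≤ ∫ w, g w ∂gaussianReal 0 e := by
    refine integral_mono ((integrable_const _).sub (hi.const_mul _))
      (integrable_of_bounded hg hD) fun w => ?_
    simp only
    rcases le_or_gt |w| (2 * √(e : ℝ)) with hw | hw
    · have : 0 ≤ (c + D) / (4 * e) * w ^ 2 := by
        have : 0 ≤ c + D := by linarith
        positivity
      linarith [hgc w hw]
    · have hw2 : 4 * e ≤ w ^ 2 := by
        rw [← sq_abs]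
        calc (4 * e : ℝ) = (2 * √(e : ℝ)) ^ 2 := by rw [mul_pow, Real.sq_sqrt hs.le]; norm_num
          _ ≤ _ := by gcongr
      have : c + D ≤ (c + D) / (4 * e) * w ^ 2 := by
        rw [div_mul_eq_mul_div, le_div_iff₀ (by positivity)]
        exact mul_le_mul_of_nonneg_left hw2 (by linarith)
      linarith [neg_le_of_abs_le (hD w)]
  rw [integral_sub (integrable_const _) (hi.const_mul _), integral_const_mul, hvar] at h
  have e1 : (c + D) / (4 * e) * e = (c + D) / 4 := by field_simp
  rw [e1] at h
  simp at h
  linarith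

/-- Removing a Gaussian smoothing from a comparison of cumulative distribution functions. -/
lemma abs_cdf_sub_le_of_smoothed {α β : Measure ℝ} [IsProbabilityMeasure α]
    [IsProbabilityMeasure β] {e : ℝ≥0} (he : e ≠ 0) {l η : ℝ} (hl : 0 ≤ l)
    (hlip : ∀ a b, a ≤ b → cdf β b - cdf β a ≤ l * (b - a))
    (hη : ∀ x, |(α ∗ gaussianReal 0 e).real (Set.Iic x)
      - (β ∗ gaussianReal 0 e).real (Set.Iic x)| ≤ η) (x : ℝ) :
    |cdf α x - cdf β x| ≤ 2 * η + 6 * l * √(e : ℝ) := by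
  set D : ℝ → ℝ := fun x => cdf α x - cdf β x with hDdef
  have hDm : Measurable D := (measurable_cdf α).sub (measurable_cdf β)
  have hbdd : BddAbove (Set.range fun x => |D x|) :=
    ⟨1, by rintro _ ⟨x, rfl⟩; exact abs_cdf_sub_le_one α β x⟩
  set S := ⨆ x, |D x|
  have hS : ∀ x, |D x| ≤ S := fun x => le_ciSup hbdd x
  have hS0 : 0 ≤ S := (abs_nonneg _).trans (hS 0)
  have hint : ∀ y, |∫ w, D (y - w) ∂gaussianReal 0 e| ≤ η := fun y => by
    have hi : ∀ α : Measure ℝ, Integrable (fun w => cdf α (y - w)) (gaussianReal 0 e) := fun α =>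
      integrable_of_bounded (D := 1) ((measurable_cdf α).comp (by fun_prop)) fun w => by
        rw [abs_of_nonneg (cdf_nonneg _ _)]; exact cdf_le_one _ _
    have := hη y
    rwa [real_conv_Iic, real_conv_Iic, ← integral_sub (hi α) (hi β)] at this
  have hη0 : 0 ≤ η := (abs_nonneg _).trans (hint 0)
  set a := 2 * √(e : ℝ) with ha
  have ha0 : 0 ≤ a := by positivity
  -- On an interval of length `2a` to the right of `y`, monotonicity of `cdf α` and the Lipschitz
  -- bound on `cdf β` keep `D` above `D y - 2 a l`; to the left the same holds for `-D`. Averaging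
  -- there bounds `|D y|` with the supremum `S` entering by the factor `1/3`, so that it can be
  -- absorbed.
  have key : ∀ y, |D y| ≤ 4 / 3 * η + 2 * a * l + S / 3 := by
    intro y
    have hla : 0 ≤ 2 * a * l := by positivity
    rw [abs_le']
    constructor
    · by_cases hneg : D y - 2 * a * l < -S
      · linarith
      have h := lower_bound_gaussian_average he (g := fun w => D (y + a - w)) (by fun_prop)
        (fun w => hS _) (not_lt.1 hneg) (fun w hw => by
          obtain ⟨h1, h2⟩ := abs_le.1 hw
          have h3 := monotone_cdf α (by linarith : y ≤ y + a - w)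
          have h4 := hlip y (y + a - w) (by linarith)
          have h5 : l * (y + a - w - y) ≤ 2 * a * l := by nlinarith
          simp only [hDdef]
          linarith)
      have := (abs_le.1 (hint (y + a))).2
      linarith
    · by_cases hneg : -D y - 2 * a * l < -S
      · linarith
      have h := lower_bound_gaussian_average he (g := fun w => -D (y - a - w)) (by fun_prop)
        (fun w => by rw [abs_neg]; exact hS _) (not_lt.1 hneg) (fun w hw => by
          obtain ⟨h1, h2⟩ := abs_le.1 hw
          have h3 := monotone_cdf α (by linarith : y - a - w ≤ y)
          have h4 := hlip (y - a - w) y (by linarith)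
          have h5 : l * (y - (y - a - w)) ≤ 2 * a * l := by nlinarith
          simp only [hDdef]
          linarith)
      rw [integral_neg] at h
      have := (abs_le.1 (hint (y - a))).1
      linarith
  have hSle : S ≤ 4 / 3 * η + 2 * a * l + S / 3 := ciSup_le key
  have := hS x
  have : S ≤ 2 * η + 3 * a * l := by linarith
  calc |D x| ≤ S := hS x
    _ ≤ _ := this
    _ = _ := by rw [ha]; ring

/-- A telescoping form of the comparison with an integral: `t^(-3/2) ≤ 4/√t - 4/√(t+1)` for `t ≥ 1`.
-/
lemma sum_inv_sqrt_cube_le {e : ℝ} (he : 1 ≤ e) (n : ℕ) :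
    ∑ m ∈ Finset.range n, 1 / √(e + m) ^ 3 ≤ 4 / √e - 4 / √(e + n) := by
  induction n with
  | zero => simp
  | succ n ih =>
    rw [Finset.sum_range_succ]
    have ht : 1 ≤ e + n := by have : (0 : ℝ) ≤ n := Nat.cast_nonneg n; linarith
    set t := e + n with htdef
    have e1 : e + (n + 1 : ℕ) = t + 1 := by push_cast; rw [htdef]; ring
    rw [e1]
    set p := √t
    set q := √(t + 1)
    have hp2 : p ^ 2 = t := Real.sq_sqrt (by linarith)
    have hq2 : q ^ 2 = t + 1 := Real.sq_sqrt (by linarith)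
    have hp : 0 < p := Real.sqrt_pos.2 (by linarith)
    have hq : 0 < q := Real.sqrt_pos.2 (by linarith)
    have hqp : q ≤ 3 / 2 * p := by
      refine abs_le_of_sq_le_sq' ?_ (by positivity) |>.2
      nlinarith
    have hkey : 1 / p ^ 3 ≤ 4 / p - 4 / q := by
      have h1 : (q - p) * (q + p) = 1 := by nlinarith
      have h2 : q - p = 1 / (q + p) := by field_simp; linarith
      rw [div_sub_div _ _ hp.ne' hq.ne', show 4 * q - p * 4 = 4 * (q - p) by ring, h2,
        div_le_div_iff₀ (by positivity) (by positivity)]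
      have h3 : q * (q + p) ≤ 4 * p ^ 2 := by nlinarith
      have : 4 * (1 / (q + p)) * p ^ 3 = p * (4 * p ^ 2 / (q + p)) := by ring
      rw [this, one_mul]
      gcongr
      rwa [le_div_iff₀ (by positivity)]
    linarith

/-- The Berry–Esseen inequality for standardized summands, in terms of convolution powers. -/
lemma exists_berryEsseen_convPow : ∃ B : ℝ, 0 ≤ B ∧ ∀ (μ : Measure ℝ) [IsProbabilityMeasure μ],
    IsStandardized μ → ∀ n : ℕ, 1 ≤ n → ∀ x,
      |cdf (convPow μ n) x - cdf (gaussianReal 0 n) x| ≤ B * (∫ x, |x| ^ 3 ∂μ) / √(n : ℝ) := by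
  obtain ⟨C, hC, h⟩ := exists_lindeberg_sum
  -- The recursion returns `(8C + 6A + 16CB/A) ρ/√n`. The choice of `A` makes `16CB/A ≤ B/2`, and
  -- `B` is twice the remaining part, so the induction closes.
  set A : ℝ := 32 * C + 1
  set B : ℝ := 2 * (8 * C + 6 * A) with hBdef
  have hA : 1 ≤ A := by simp only [A]; linarith
  have hB : 0 ≤ B := by positivity
  refine ⟨B, hB, fun μ _ hμ n => ?_⟩
  set ρ := ∫ x, |x| ^ 3 ∂μ
  have hρ : 1 ≤ ρ := hμ.one_le
  induction n using Nat.strong_induction_on with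
  | _ n ih =>
  intro hn x
  have hn0 : (0 : ℝ) < n := by exact_mod_cast hn
  have hsn : 0 < √(n : ℝ) := Real.sqrt_pos.2 hn0
  -- For `k < n/2` the trivial bound is enough, since the Gaussian variance on the right is then at
  -- least `n/2`. For larger `k` the inductive bound applies, and `√k` is comparable to `√n`.
  set δ : ℕ → ℝ := fun k => if 2 * k < n then 1 else B * ρ / √(k : ℝ) with hδ
  -- With `√e = Aρ`, the smoothing costs a multiple of `Aρ/√n`, while the sum of `(e + m)^(-3/2)` is
  -- at most `4/(Aρ)` and so cancels the `ρ` of the inductive bound.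
  set e : ℝ≥0 := ⟨(A * ρ) ^ 2, by positivity⟩ with hedef
  have hAρ : 1 ≤ A * ρ := one_le_mul_of_one_le_of_one_le hA hρ
  have he1 : (1 : ℝ) ≤ (e : ℝ) := by simp only [hedef]; exact one_le_pow₀ hAρ
  have hse : √(e : ℝ) = A * ρ := Real.sqrt_sq (by positivity)
  have hdk : ∀ k < n, ∀ x, |cdf (convPow μ k) x - cdf (gaussianReal 0 k) x| ≤ δ k := by
    intro k hk y
    simp only [hδ]
    split_ifs with hkn
    · exact abs_cdf_sub_le_one _ _ _
    · exact ih k hk (by omega) y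
  have hsum : ∑ k ∈ Finset.range n,
      (δ k / √((e + (n - 1 - k : ℕ) : ℝ≥0) : ℝ) ^ 3 + 1 / √(n : ℝ) ^ 3)
      ≤ 4 / √(n : ℝ) + 8 * B / A / √(n : ℝ) := by
    have hterm : ∀ k ∈ Finset.range n,
        δ k / √((e + (n - 1 - k : ℕ) : ℝ≥0) : ℝ) ^ 3 + 1 / √(n : ℝ) ^ 3
          ≤ 4 / √(n : ℝ) ^ 3 + 2 * B * ρ / √(n : ℝ) * (1 / √((e : ℝ) + (n - 1 - k : ℕ)) ^ 3) := by
      intro k hk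
      have hk := Finset.mem_range.1 hk
      simp only [NNReal.coe_add, NNReal.coe_natCast]
      have hm0 : (0 : ℝ) ≤ ((n - 1 - k : ℕ) : ℝ) := Nat.cast_nonneg _
      have hpos : 0 < √((e : ℝ) + (n - 1 - k : ℕ)) := Real.sqrt_pos.2 (by linarith)
      simp only [hδ]
      split_ifs with hkn
      · have h1 : (n : ℝ) / 2 ≤ (e : ℝ) + (n - 1 - k : ℕ) := by
          have : (n : ℝ) ≤ 2 * (1 + (n - 1 - k : ℕ)) := by
            have : n ≤ 2 * (1 + (n - 1 - k)) := by omega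
            exact_mod_cast this
          linarith
        -- The factor exceeds `√2`, and its cube is below 3.
        have h2 : √(n : ℝ) ≤ 7 / 5 * 1.02 * √((e : ℝ) + (n - 1 - k : ℕ)) := by
          rw [← Real.sqrt_sq (show (0 : ℝ) ≤ 7 / 5 * 1.02 by norm_num),
            ← Real.sqrt_mul (by norm_num)]
          exact Real.sqrt_le_sqrt (by nlinarith)
        have h3 : 1 / √((e : ℝ) + (n - 1 - k : ℕ)) ^ 3 ≤ 3 / √(n : ℝ) ^ 3 := by
          rw [div_le_div_iff₀ (by positivity) (by positivity), one_mul]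
          calc √(n : ℝ) ^ 3 ≤ (7 / 5 * 1.02 * √((e : ℝ) + (n - 1 - k : ℕ))) ^ 3 := by gcongr
            _ ≤ _ := by rw [mul_pow]; gcongr; norm_num
        have h4 : 0 ≤ 2 * B * ρ / √(n : ℝ) * (1 / √((e : ℝ) + (n - 1 - k : ℕ)) ^ 3) := by
          positivity
        have h5 : 4 / √(n : ℝ) ^ 3 = 3 / √(n : ℝ) ^ 3 + 1 / √(n : ℝ) ^ 3 := by ring
        linarith
      · have hk0 : 0 < √(k : ℝ) := Real.sqrt_pos.2 (by exact_mod_cast (by omega : 0 < k))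
        have h2 : √(n : ℝ) ≤ 2 * √(k : ℝ) := by
          rw [← Real.sqrt_sq (show (0 : ℝ) ≤ 2 by norm_num), ← Real.sqrt_mul (by norm_num)]
          refine Real.sqrt_le_sqrt ?_
          have : (n : ℝ) ≤ 2 * k := by exact_mod_cast (by omega : n ≤ 2 * k)
          linarith [(Nat.cast_nonneg k : (0 : ℝ) ≤ k)]
        have h3 : B * ρ / √(k : ℝ) ≤ 2 * B * ρ / √(n : ℝ) := by
          rw [div_le_div_iff₀ hk0 hsn]
          calc B * ρ * √(n : ℝ) ≤ B * ρ * (2 * √(k : ℝ)) := by gcongr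
            _ = _ := by ring
        have h4 : B * ρ / √(k : ℝ) / √((e : ℝ) + (n - 1 - k : ℕ)) ^ 3
            ≤ 2 * B * ρ / √(n : ℝ) * (1 / √((e : ℝ) + (n - 1 - k : ℕ)) ^ 3) := by
          rw [mul_one_div]; gcongr
        have h5 : 1 / √(n : ℝ) ^ 3 ≤ 4 / √(n : ℝ) ^ 3 := by gcongr; norm_num
        linarith
    refine (Finset.sum_le_sum hterm).trans ?_
    rw [Finset.sum_add_distrib, Finset.sum_const, Finset.card_range, ← Finset.mul_sum,
      Finset.sum_range_reflect (fun m => 1 / √((e : ℝ) + (m : ℕ)) ^ 3), nsmul_eq_mul]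
    have h1 := sum_inv_sqrt_cube_le he1 n
    have h2 : ∑ m ∈ Finset.range n, 1 / √((e : ℝ) + m) ^ 3 ≤ 4 / (A * ρ) := by
      rw [← hse]
      have : 0 ≤ 4 / √((e : ℝ) + n) := by positivity
      linarith
    have h3 : (n : ℝ) * (4 / √(n : ℝ) ^ 3) = 4 / √(n : ℝ) := by
      have : (n : ℝ) = √(n : ℝ) ^ 2 := (Real.sq_sqrt hn0.le).symm
      rw [this, Real.sqrt_sq hsn.le]
      field_simp
    have h4 : 2 * B * ρ / √(n : ℝ) * (4 / (A * ρ)) = 8 * B / A / √(n : ℝ) := by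
      field_simp; ring
    rw [h3, ← h4]
    gcongr
  have hsm : ∀ x, |(convPow μ n ∗ gaussianReal 0 e).real (Set.Iic x)
      - (gaussianReal 0 n ∗ gaussianReal 0 e).real (Set.Iic x)|
        ≤ C * ρ * (4 / √(n : ℝ) + 8 * B / A / √(n : ℝ)) := fun x =>
    (h μ δ n e hμ (by exact_mod_cast he1) hdk x).trans (by gcongr)
  have hlip : ∀ a b, a ≤ b → cdf (gaussianReal 0 n) b - cdf (gaussianReal 0 n) a
      ≤ 1 / √(n : ℝ) * (b - a) := by
    intro a b hab
    refine (cdf_gaussianReal_sub_le (by exact_mod_cast hn0.ne') hab).trans ?_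
    rw [one_div_mul_eq_div]
    have : 0 ≤ b - a := by linarith
    gcongr
    simp only [NNReal.coe_natCast]
    nlinarith [Real.pi_gt_three]
  have hfin := abs_cdf_sub_le_of_smoothed
    (show e ≠ 0 from fun h0 => by rw [h0] at he1; norm_num at he1) (by positivity) hlip hsm x
  refine hfin.trans ?_
  rw [hse]
  have hCA : 16 * C * B / A ≤ B / 2 := by
    rw [div_le_div_iff₀ (by positivity) (by norm_num)]
    have : 32 * C ≤ A := by simp only [A]; linarith
    nlinarith
  have e1 : 2 * (C * ρ * (4 / √(n : ℝ) + 8 * B / A / √(n : ℝ))) + 6 * (1 / √(n : ℝ)) * (A * ρ)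
      = (8 * C + 6 * A + 16 * C * B / A) * ρ / √(n : ℝ) := by ring
  rw [e1]
  gcongr
  linarith

end RobustSlope

/-! ### Berry–Esseen for samples -/

namespace RobustSlope

section BerryEsseen
variable {Ω : Type*} [MeasurableSpace Ω] {P : Measure Ω} [IsProbabilityMeasure P]

lemma map_sum_eq_convPow {ι : Type*} {f : ι → Ω → ℝ} {μ : Measure ℝ} [IsProbabilityMeasure μ]
    (hf : ∀ i, AEMeasurable (f i) P)
    (hlaw : ∀ i, P.map (f i) = μ) (hind : iIndepFun f P) (s : Finset ι) :
    P.map (∑ i ∈ s, f i) = convPow μ s.card := by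
  classical
  induction s using Finset.induction_on with
  | empty =>
    simp only [Finset.sum_empty, Finset.card_empty, convPow]
    rw [show (0 : Ω → ℝ) = fun _ => 0 from rfl, Measure.map_const]
    simp
  | insert i s hi ih =>
    rw [Finset.card_insert_of_notMem hi, Finset.sum_insert hi, convPow, ← ih, ← hlaw i, add_comm]
    exact (hind.indepFun_finsetSum_of_notMem₀ hf hi).map_add_eq_map_conv_map₀
      (Finset.aemeasurable_sum _ fun j _ => hf j) (hf i)

lemma cdf_gaussianReal_mul_sqrt {v : ℝ≥0} (hv : v ≠ 0) (x : ℝ) :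
    cdf (gaussianReal 0 v) (√(v : ℝ) * x) = cdf (gaussianReal 0 1) x := by
  have hs : 0 < √(v : ℝ) := Real.sqrt_pos.2 (by exact_mod_cast pos_iff_ne_zero.2 hv)
  rw [cdf_eq_real, cdf_eq_real, gaussianReal_eq_map_sqrt_mul,
    map_measureReal_apply (by fun_prop) measurableSet_Iic]
  congr 1
  ext y
  exact mul_le_mul_iff_right₀ hs

/-- The Berry–Esseen theorem. -/
theorem exists_isBerryEsseenConstant : ∃ c : ℝ≥0, IsBerryEsseenConstant c := by
  obtain ⟨B, hB, h⟩ := exists_berryEsseen_convPow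
  refine ⟨⟨B, hB⟩, fun ν _ hν hmean hvar n hn x => ?_⟩
  set σ := √(Var[fun z : ℝ => z; ν]) with hσdef
  have hσ : 0 < σ := Real.sqrt_pos.2 hvar
  have hn0 : (0 : ℝ) < n := by exact_mod_cast hn
  have hsn : 0 < √(n : ℝ) := Real.sqrt_pos.2 hn0
  set μ := ν.map (fun z => z / σ) with hμ
  have : IsProbabilityMeasure μ := Measure.isProbabilityMeasure_map (by fun_prop)
  have h3 : ∫ x, |x| ^ 3 ∂μ = (∫ z, |z| ^ 3 ∂ν) / σ ^ 3 := by
    rw [hμ, integral_map (by fun_prop) (by fun_prop), ← integral_div]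
    congr 1 with z
    rw [abs_div, abs_of_pos hσ, div_pow]
  have hst : IsStandardized μ := by
    refine ⟨?_, ?_, ?_⟩
    · rw [hμ, integrable_map_measure (by fun_prop) (by fun_prop)]
      have := (hν.integrable_norm_pow (by norm_num)).div_const (σ ^ 3)
      refine this.congr (Filter.Eventually.of_forall fun z => ?_)
      simp [abs_div, abs_of_pos hσ, div_pow]
    · rw [hμ, integral_map (by fun_prop) (by fun_prop), integral_div, hmean, zero_div]
    · rw [hμ, integral_map (by fun_prop) (by fun_prop)]
      have hv := variance_eq_integral (X := fun z : ℝ => z) (μ := ν) (by fun_prop)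
      simp only [hmean, sub_zero] at hv
      simp only [div_pow]
      rw [integral_div, ← hv, hσdef, Real.sq_sqrt hvar.le, div_self hvar.ne']
  have hind : iIndepFun (fun (i : Fin n) (z : Fin n → ℝ) => z i / σ)
      (Measure.pi fun _ : Fin n => ν) :=
    iIndepFun_pi (μ := fun _ => ν) (X := fun _ z => z / σ)
      fun _ => (measurable_id.div_const σ).aemeasurable
  have hlaw := map_sum_eq_convPow (μ := μ) (fun i => ((measurable_pi_apply i).div_const σ).aemeasurable) (fun i => by
    have := (measurePreserving_eval (fun _ : Fin n => ν) i).map_eq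
    rw [show (fun z : Fin n → ℝ => z i / σ) = (fun z => z / σ) ∘ Function.eval i from rfl,
      ← Measure.map_map (by fun_prop) (by fun_prop), this]) hind Finset.univ
  rw [Finset.card_univ, Fintype.card_fin] at hlaw
  have hset : {z : Fin n → ℝ | √(n : ℝ) * sampleMean z / σ ≤ x}
      = (∑ i, fun z : Fin n → ℝ => z i / σ) ⁻¹' Set.Iic (√((n : ℝ≥0) : ℝ) * x) := by
    ext z
    simp only [Set.mem_ofPred_eq, Set.mem_preimage, Finset.sum_apply, Set.mem_Iic,
      NNReal.coe_natCast, sampleMean, ← Finset.sum_div]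
    rw [← div_le_iff₀' hsn]
    have : √(n : ℝ) * ((∑ i, z i) / n) / σ = (∑ i, z i) / σ / √(n : ℝ) := by
      have h2 := Real.sq_sqrt hn0.le
      field_simp
      rw [h2]; ring
    rw [this]
  have hprob : IsProbabilityMeasure ((Measure.pi fun _ : Fin n => ν).map
      (∑ i, fun z : Fin n → ℝ => z i / σ)) := Measure.isProbabilityMeasure_map (by fun_prop)
  have hmain := h μ hst n hn (√((n : ℝ≥0) : ℝ) * x)
  rw [cdf_gaussianReal_mul_sqrt (by exact_mod_cast hn0.ne'), ← hlaw, cdf_eq_real,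
    map_measureReal_apply (by fun_prop) measurableSet_Iic, h3] at hmain
  rw [hset]
  refine hmain.trans (le_of_eq ?_)
  field_simp
  exact mul_comm _ _

end BerryEsseen

/-! ### The Rosenthal inequality with exponent 4 -/

lemma eLpNorm_four_toReal_pow {Ω : Type*} [MeasurableSpace Ω] {P : Measure Ω} {f : Ω → ℝ} (hf : MemLp f 4 P) :
    (eLpNorm f 4 P).toReal ^ 4 = ∫ ω, f ω ^ 4 ∂P := by
  rw [hf.eLpNorm_eq_integral_rpow_norm (by norm_num) (by norm_num)]
  have h0 : 0 ≤ ∫ ω, f ω ^ 4 ∂P := integral_nonneg fun ω => by positivity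
  have e : ∀ ω, ‖f ω‖ ^ (4 : ℝ≥0∞).toReal = f ω ^ 4 := fun ω => by
    rw [show (4 : ℝ≥0∞).toReal = ((4 : ℕ) : ℝ) by simp, Real.rpow_natCast, Real.norm_eq_abs,
      Even.pow_abs (by decide)]
  simp only [e]
  rw [ENNReal.toReal_ofReal (by positivity), ← Real.rpow_natCast, ← Real.rpow_mul h0]
  norm_num

section Rosenthal
variable {Ω : Type*} [MeasurableSpace Ω] {P : Measure Ω} [IsProbabilityMeasure P]

lemma integrable_pow_of_memLp_four {f : Ω → ℝ} (hf : MemLp f 4 P) {k : ℕ} (hk : k ≤ 4) :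
    Integrable (fun ω => f ω ^ k) P := by
  rcases Nat.eq_zero_or_pos k with rfl | hk0
  · simp
  have h1 : MemLp f (k : ℝ≥0∞) P := hf.mono_exponent (by exact_mod_cast hk)
  have h2 := h1.integrable_norm_pow hk0.ne'
  refine h2.mono (hf.1.pow k) (Filter.Eventually.of_forall fun ω => ?_)
  simp

/-- Second and fourth moments of a sum of independent centered variables. -/
lemma moments_sum_of_iIndepFun {ι : Type*} {f : ι → Ω → ℝ} {v m : ℝ}
    (hf : ∀ i, MemLp (f i) 4 P) (hmean : ∀ i, ∫ ω, f i ω ∂P = 0)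
    (hv : ∀ i, ∫ ω, f i ω ^ 2 ∂P = v) (hm : ∀ i, ∫ ω, f i ω ^ 4 ∂P = m)
    (hind : iIndepFun f P) (s : Finset ι) :
    MemLp (∑ i ∈ s, f i) 4 P ∧ ∫ ω, (∑ i ∈ s, f i) ω ∂P = 0 ∧
      ∫ ω, (∑ i ∈ s, f i) ω ^ 2 ∂P = s.card * v ∧
      ∫ ω, (∑ i ∈ s, f i) ω ^ 4 ∂P ≤ s.card * m + 3 * (s.card : ℝ) ^ 2 * v ^ 2 := by
  classical
  induction s using Finset.induction_on with
  | empty => simp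
  | insert i s hi ih =>
    obtain ⟨h4, h1, h2, hle⟩ := ih
    set S := ∑ j ∈ s, f j
    have hIS : IndepFun S (f i) P :=
      hind.indepFun_finsetSum_of_notMem₀ (fun j => (hf j).1.aemeasurable) hi
    have iS := fun {k : ℕ} (hk : k ≤ 4) => integrable_pow_of_memLp_four h4 hk
    have iF := fun {k : ℕ} (hk : k ≤ 4) => integrable_pow_of_memLp_four (hf i) hk
    have hprod : ∀ j k : ℕ, j ≤ 4 → k ≤ 4 → Integrable (fun ω => S ω ^ j * f i ω ^ k) P ∧
        ∫ ω, S ω ^ j * f i ω ^ k ∂P = (∫ ω, S ω ^ j ∂P) * ∫ ω, f i ω ^ k ∂P := by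
      intro j k hj hk
      have hI : IndepFun (fun ω => S ω ^ j) (fun ω => f i ω ^ k) P :=
        hIS.comp (measurable_id.pow_const j) (measurable_id.pow_const k)
      exact ⟨hI.integrable_mul (iS hj) (iF hk),
        hI.integral_fun_mul_eq_mul_integral (iS hj).1 (iF hk).1⟩
    have hmem : MemLp (∑ j ∈ insert i s, f j) 4 P := by
      rw [Finset.sum_insert hi]; exact (hf i).add h4
    have i4 : Integrable (fun ω => S ω ^ 4) P := iS le_rfl
    have i2 : Integrable (fun ω => S ω ^ 2) P := iS (by norm_num)
    have j4 : Integrable (fun ω => f i ω ^ 4) P := iF le_rfl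
    have j2 : Integrable (fun ω => f i ω ^ 2) P := iF (by norm_num)
    have i1 : Integrable S P := h4.integrable (by norm_num)
    have j1 : Integrable (f i) P := (hf i).integrable (by norm_num)
    obtain ⟨a11, b11⟩ := hprod 1 1 (by norm_num) (by norm_num)
    obtain ⟨a31, b31⟩ := hprod 3 1 (by norm_num) (by norm_num)
    obtain ⟨a22, b22⟩ := hprod 2 2 (by norm_num) (by norm_num)
    obtain ⟨a13, b13⟩ := hprod 1 3 (by norm_num) (by norm_num)
    simp only [pow_one, h1, hmean, zero_mul, mul_zero] at b11 b31 b13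
    refine ⟨hmem, ?_, ?_, ?_⟩
    · simp only [Finset.sum_insert hi, Pi.add_apply]
      rw [integral_add j1 i1, hmean, h1, add_zero]
    · have e : ∀ ω, (∑ j ∈ insert i s, f j) ω ^ 2
          = (S ω ^ 2 + 2 * (S ω ^ 1 * f i ω ^ 1)) + f i ω ^ 2 := fun ω => by
        rw [Finset.sum_insert hi, Pi.add_apply]; ring
      simp only [e]
      rw [integral_add (i2.fun_add (a11.const_mul 2)) j2, integral_add i2 (a11.const_mul 2),
        integral_const_mul, h2, hv]
      simp only [pow_one]
      rw [b11, Finset.card_insert_of_notMem hi]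
      push_cast; ring
    -- Terms with a first power of `S` or of `f i` integrate to zero. The surviving mixed term
    -- contributes `6 k v²` with `k = s.card`, and `3k² + 6k ≤ 3(k + 1)²`.
    · have e : ∀ ω, (∑ j ∈ insert i s, f j) ω ^ 4
          = (((S ω ^ 4 + 4 * (S ω ^ 3 * f i ω ^ 1)) + 6 * (S ω ^ 2 * f i ω ^ 2))
            + 4 * (S ω ^ 1 * f i ω ^ 3)) + f i ω ^ 4 := fun ω => by
        rw [Finset.sum_insert hi, Pi.add_apply]; ring
      simp only [e]
      have k1 := i4.fun_add (a31.const_mul 4)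
      have k2 := k1.fun_add (a22.const_mul 6)
      have k3 := k2.fun_add (a13.const_mul 4)
      rw [integral_add k3 j4, integral_add k2 (a13.const_mul 4), integral_add k1 (a22.const_mul 6),
        integral_add i4 (a31.const_mul 4), integral_const_mul, integral_const_mul,
        integral_const_mul, b22, h2, hv, hm]
      simp only [pow_one]
      rw [b31, b13, Finset.card_insert_of_notMem hi]
      push_cast
      nlinarith [sq_nonneg v]

/-- The Rosenthal inequality with exponent `4`. -/
theorem exists_isRosenthalConstant_four : ∃ c₁ c₂ : ℝ≥0, IsRosenthalConstant 4 c₁ c₂ := by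
  refine ⟨1, 1, fun ν _ hν hmean n hn => ?_⟩
  have e4 : ENNReal.ofReal 4 = 4 := by norm_num
  rw [e4] at hν ⊢
  have hn0 : (0 : ℝ) < n := by exact_mod_cast hn
  set Q := Measure.pi fun _ : Fin n => ν
  have hmp : ∀ i, MeasurePreserving (fun z : Fin n → ℝ => z i) Q ν :=
    fun i => measurePreserving_eval (fun _ : Fin n => ν) i
  have hf : ∀ i, MemLp (fun z : Fin n → ℝ => z i) 4 Q := fun i => hν.comp_measurePreserving (hmp i)
  have hint : ∀ (g : ℝ → ℝ), Measurable g → ∀ i, ∫ z : Fin n → ℝ, g (z i) ∂Q = ∫ z, g z ∂ν := by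
    intro g hg i
    rw [← (hmp i).map_eq, integral_map (measurable_pi_apply i).aemeasurable hg.aestronglyMeasurable]
  have hind : iIndepFun (fun (i : Fin n) (z : Fin n → ℝ) => z i) Q :=
    iIndepFun_pi (μ := fun _ => ν) (X := fun _ z => z) fun _ => measurable_id.aemeasurable
  obtain ⟨hS, -, -, hle⟩ := moments_sum_of_iIndepFun hf
    (fun i => (hint (fun z => z) (by fun_prop) i).trans hmean)
    (hint (fun z => z ^ 2) (by fun_prop)) (hint (fun z => z ^ 4) (by fun_prop)) hind Finset.univ
  rw [Finset.card_univ, Fintype.card_fin] at hle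
  set v := ∫ z, z ^ 2 ∂ν
  have hv : Var[fun z : ℝ => z; ν] = v := by
    rw [variance_eq_integral (by fun_prop), hmean]; simp [v]
  set N := (eLpNorm (fun z : ℝ => z) 4 ν).toReal
  have hN0 : 0 ≤ N := ENNReal.toReal_nonneg
  have hN : N ^ 4 = ∫ z, z ^ 4 ∂ν := eLpNorm_four_toReal_pow hν
  have hv0 : 0 ≤ v := integral_nonneg fun z => sq_nonneg z
  rw [← hN] at hle
  rw [hv]
  have hmeanfun : (fun z : Fin n → ℝ => sampleMean z)
      = (n : ℝ)⁻¹ • (∑ i : Fin n, fun z : Fin n → ℝ => z i) := by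
    ext z; simp [sampleMean, div_eq_inv_mul]
  rw [hmeanfun, eLpNorm_const_smul, ENNReal.toReal_mul, toReal_enorm, Real.norm_of_nonneg
    (by positivity)]
  set M := (eLpNorm (∑ i : Fin n, fun z : Fin n → ℝ => z i) 4 Q).toReal
  have hM : M ^ 4 ≤ n * N ^ 4 + 3 * (n : ℝ) ^ 2 * v ^ 2 := by
    rw [eLpNorm_four_toReal_pow hS]; exact hle
  set t := (n : ℝ) ^ (1 / 4 : ℝ) with ht
  have ht0 : 0 < t := Real.rpow_pos_of_pos hn0 _
  have ht4 : t ^ 4 = n := by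
    rw [ht, ← Real.rpow_natCast, ← Real.rpow_mul hn0.le]; norm_num
  set u := √v
  have hu0 : 0 ≤ u := Real.sqrt_nonneg _
  have hu : u ^ 2 = v := Real.sq_sqrt hv0
  have ht3 : (n : ℝ) ^ (((4 : ℝ) - 1) / 4) = t ^ 3 := by
    rw [ht, ← Real.rpow_natCast, ← Real.rpow_mul hn0.le]; norm_num
  have hsq4 : √(4 : ℝ) = 2 := by
    rw [show (4 : ℝ) = 2 ^ 2 by norm_num]; exact Real.sqrt_sq (by norm_num)
  have hsvn : √(v / n) = u / t ^ 2 := by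
    rw [Real.sqrt_div hv0, ← ht4, show t ^ 4 = (t ^ 2) ^ 2 by ring, Real.sqrt_sq (by positivity)]
  -- With `t = n^(1/4)` and `u = √v`, the fourth power of the right side contains `(tN)⁴` and `16
  -- (t²u)⁴`, which dominate `n N⁴` and `3 n² v²`.
  have hMle : M ≤ t * N + 2 * (t ^ 2 * u) := by
    refine le_of_pow_le_pow_left₀ (n := 4) (by norm_num) (by positivity) (hM.trans ?_)
    rw [← ht4, ← hu]
    have h1 : 0 ≤ t * N := by positivity
    have h2 : 0 ≤ t ^ 2 * u := by positivity
    have e : (t * N + 2 * (t ^ 2 * u)) ^ 4 = (t * N) ^ 4 + 16 * (t ^ 2 * u) ^ 4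
        + (8 * (t * N) ^ 3 * (t ^ 2 * u) + 24 * (t * N) ^ 2 * (t ^ 2 * u) ^ 2
          + 32 * (t * N) * (t ^ 2 * u) ^ 3) := by ring
    have h3 : 0 ≤ 8 * (t * N) ^ 3 * (t ^ 2 * u) + 24 * (t * N) ^ 2 * (t ^ 2 * u) ^ 2
          + 32 * (t * N) * (t ^ 2 * u) ^ 3 := by positivity
    have h4 : 0 ≤ (t ^ 2 * u) ^ 4 := by positivity
    rw [e]
    nlinarith
  rw [ht3, hsq4, hsvn, ← ht4]
  calc (t ^ 4)⁻¹ * M ≤ (t ^ 4)⁻¹ * (t * N + 2 * (t ^ 2 * u)) := by gcongr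
    _ = N / t ^ 3 + 2 * (u / t ^ 2) := by field_simp
    _ ≤ _ := by
      simp only [NNReal.coe_one]
      have : 0 ≤ N / t ^ 3 := by positivity
      have e : 1 * 4 * (1 / t ^ 3) * N = 4 * (N / t ^ 3) := by ring
      rw [e]; linarith

end Rosenthal
end RobustSlope

/-! ### Algebra of sample means and moments of a good sample -/

namespace RobustSlope

section SampleMean
variable {n : ℕ}

lemma sampleMean_add (f g : Fin n → ℝ) :
    sampleMean (fun i => f i + g i) = sampleMean f + sampleMean g := by
  simp only [sampleMean, Finset.sum_add_distrib, add_div]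

lemma sampleMean_sub (f g : Fin n → ℝ) :
    sampleMean (fun i => f i - g i) = sampleMean f - sampleMean g := by
  simp only [sampleMean, Finset.sum_sub_distrib, sub_div]

lemma sampleMean_const_mul (c : ℝ) (f : Fin n → ℝ) :
    sampleMean (fun i => c * f i) = c * sampleMean f := by
  simp only [sampleMean, ← Finset.mul_sum, mul_div_assoc]

lemma sampleMean_const (hn : 1 ≤ n) (c : ℝ) : sampleMean (fun _ : Fin n => c) = c := by
  have : (n : ℝ) ≠ 0 := by exact_mod_cast (by omega : n ≠ 0)
  simp only [sampleMean, Finset.sum_const, Finset.card_univ, Fintype.card_fin, nsmul_eq_mul]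
  field_simp

lemma sampleMean_mono {f g : Fin n → ℝ} (h : ∀ i, f i ≤ g i) : sampleMean f ≤ sampleMean g :=
  div_le_div_of_nonneg_right (Finset.sum_le_sum fun i _ => h i) (Nat.cast_nonneg n)

lemma sampleMean_nonneg {f : Fin n → ℝ} (h : ∀ i, 0 ≤ f i) : 0 ≤ sampleMean f :=
  div_nonneg (Finset.sum_nonneg fun i _ => h i) (Nat.cast_nonneg n)

lemma abs_sampleMean_le {f g : Fin n → ℝ} (h : ∀ i, |f i| ≤ g i) :
    |sampleMean f| ≤ sampleMean g := by
  rw [sampleMean, abs_div, Nat.abs_cast]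
  exact div_le_div_of_nonneg_right ((Finset.abs_sum_le_sum_abs _ _).trans
    (Finset.sum_le_sum fun i _ => h i)) (Nat.cast_nonneg n)

lemma sampleMean_mul_sq_le (f g : Fin n → ℝ) :
    sampleMean (fun i => f i * g i) ^ 2
      ≤ sampleMean (fun i => f i ^ 2) * sampleMean (fun i => g i ^ 2) := by
  simp only [sampleMean, div_pow, div_mul_div_comm, ← pow_two (n : ℝ)]
  exact div_le_div_of_nonneg_right (Finset.sum_mul_sq_le_sq_mul_sq _ _ _) (by positivity)

lemma sampleMean_centered_mul (hn : 1 ≤ n) (f g : Fin n → ℝ) :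
    sampleMean (fun i => (f i - sampleMean f) * (g i - sampleMean g))
      = sampleMean (fun i => f i * g i) - sampleMean f * sampleMean g := by
  have e : ∀ i, (f i - sampleMean f) * (g i - sampleMean g)
      = f i * g i + (-sampleMean g * f i + (-sampleMean f * g i + sampleMean f * sampleMean g)) :=
    fun i => by ring
  simp only [e, sampleMean_add, sampleMean_const_mul, sampleMean_const hn]
  ring

lemma sampleMean_centered_sq (hn : 1 ≤ n) (f : Fin n → ℝ) :
    sampleMean (fun i => (f i - sampleMean f) ^ 2)
      = sampleMean (fun i => f i ^ 2) - sampleMean f ^ 2 := by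
  simp only [pow_two]
  exact sampleMean_centered_mul hn f f

/-- The studentized statistic in terms of the errors. -/
lemma studentized_eq (hn : 1 ≤ n) (τ : ℝ) {X Y x e : Fin n → ℝ} {a b : ℝ}
    (hX : ∀ i, X i = x i + a) (hY : ∀ i, Y i = τ * x i + e i + b)
    (hS : 0 < sampleMean fun i => (x i - sampleMean x) ^ 2) :
    studentized τ X Y = √(n : ℝ) *
      sampleMean (fun i => (x i - sampleMean x) * (e i - sampleMean e)) /
      √(sampleMean fun i => ((x i - sampleMean x) * (e i - sampleMean e -
          sampleMean (fun i => (x i - sampleMean x) * (e i - sampleMean e)) /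
            sampleMean (fun i => (x i - sampleMean x) ^ 2) * (x i - sampleMean x))) ^ 2) := by
  have hn0 : (n : ℝ) ≠ 0 := by exact_mod_cast (by omega : n ≠ 0)
  have hmX : sampleMean X = sampleMean x + a := by
    rw [show X = fun i => x i + a from funext hX, sampleMean_add, sampleMean_const hn]
  have hmY : sampleMean Y = τ * sampleMean x + sampleMean e + b := by
    rw [show Y = fun i => τ * x i + e i + b from funext hY, sampleMean_add, sampleMean_add,
      sampleMean_const_mul, sampleMean_const hn]
  set u : Fin n → ℝ := fun i => x i - sampleMean x with hu
  set w : Fin n → ℝ := fun i => e i - sampleMean e with hw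
  have hXu : ∀ i, X i - sampleMean X = u i := fun i => by rw [hX, hmX, hu]; ring
  have hYw : ∀ i, Y i - sampleMean Y = τ * u i + w i := fun i => by rw [hY, hmY, hu, hw]; ring
  set S := sampleMean fun i => u i ^ 2 with hSdef
  set A := sampleMean fun i => u i * w i with hAdef
  have hslope : slopeHat X Y = τ + A / S := by
    have h1 : slopeHat X Y
        = sampleMean (fun i => u i * (τ * u i + w i)) / sampleMean (fun i => u i ^ 2) := by
      simp only [slopeHat, hXu, hYw]
      simp only [sampleMean]
      rw [div_div_div_cancel_right₀ hn0]
    have h2 : ∀ i, u i * (τ * u i + w i) = τ * u i ^ 2 + u i * w i := fun i => by ring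
    rw [h1]
    simp only [h2]
    rw [sampleMean_add, sampleMean_const_mul, ← hSdef, ← hAdef]
    field_simp
  have hres : ∀ i, residual X Y i = w i - A / S * u i := fun i => by
    have h1 := hXu i
    have h2 := hYw i
    simp only [residual, interceptHat]
    have h3 : Y i - (sampleMean Y - slopeHat X Y * sampleMean X) - slopeHat X Y * X i
        = (Y i - sampleMean Y) - slopeHat X Y * (X i - sampleMean X) := by ring
    rw [h3, h1, h2, hslope]
    ring
  have hv : vHat X Y = sampleMean (fun i => (u i * (w i - A / S * u i)) ^ 2) / S ^ 2 := by
    simp only [vHat, hXu, hres]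
    congr 1
    simp only [sampleMean, mul_pow]
  -- The slope error is `A/S` and `√v̂` has denominator `S`; the two cancel.
  rw [studentized, hslope, hv, Real.sqrt_div (sampleMean_nonneg fun i => sq_nonneg _),
    Real.sqrt_sq hS.le, add_sub_cancel_left]
  rw [div_div_eq_mul_div]
  congr 1
  field_simp

end SampleMean

/-- Relations between the moments `a_jk = E|x|^j|y|^k`, the standard deviations, the slope `t`, the
scale `r` and the constant `M = 1 / K`. -/
structure MomentBounds (sX sY sE s t M r a21 a30 a12 a31 a40 v : ℝ) : Prop where
  sX_pos : 0 < sX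
  sY_pos : 0 < sY
  sE_nonneg : 0 ≤ sE
  s_pos : 0 < s
  r_pos : 0 < r
  r_le : r ≤ 1 / 30
  four_le : 4 ≤ M
  Mr_le : M * r ≤ 5 / 6
  sE_le : sE ≤ sY
  slope_le : |t| * sX ≤ sY
  cube_le : sX ^ 3 ≤ a30
  fourth_le : sX ^ 4 ≤ a40
  b21 : 144 * (a21 * sY) ≤ M * s ^ 2
  b30 : 288 * (a30 * sY ^ 2) ≤ M * s ^ 2 * sX
  b30t : 144 * (|t| * a30 * sY) ≤ M * s ^ 2
  b31 : 1152 * a31 ≤ M * s * sX ^ 2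
  b40 : 1152 * (a40 * sY) ≤ M * s * sX ^ 3
  b40t : 288 * (|t| * a40) ≤ M * s * sX ^ 2
  bv : 4 * v ≤ M * s ^ 2
  b12 : 32 * (a12 * sX) ≤ M * s ^ 2

/-- The sample moments are close to, or dominated by, the population moments. -/
structure GoodSample {n : ℕ} (x y : Fin n → ℝ)
    (sX sY sE s t r a21 a30 a12 a31 a40 v : ℝ) : Prop where
  mx : |sampleMean x| ≤ sX * r
  me : |sampleMean fun i => y i - t * x i| ≤ sE * r
  mxe : |sampleMean fun i => x i * (y i - t * x i)| ≤ s * r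
  mxe2 : |(sampleMean fun i => (x i * (y i - t * x i)) ^ 2) - s ^ 2| ≤ v * r
  m21 : (sampleMean fun i => |x i| ^ 2 * |y i|) ≤ 2 * a21
  m30 : (sampleMean fun i => |x i| ^ 3) ≤ 2 * a30
  m12 : (sampleMean fun i => |x i| * |y i| ^ 2) ≤ 2 * a12
  m31 : (sampleMean fun i => |x i| ^ 3 * |y i|) ≤ 2 * a31
  m40 : (sampleMean fun i => |x i| ^ 4) ≤ 2 * a40
  m20_ge : 7 / 8 * sX ^ 2 ≤ sampleMean fun i => |x i| ^ 2
  m20_le : (sampleMean fun i => |x i| ^ 2) ≤ 9 / 8 * sX ^ 2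
  m02 : (sampleMean fun i => |y i| ^ 2) ≤ 9 / 8 * sY ^ 2

section Deterministic
variable {n : ℕ} {x y : Fin n → ℝ} {sX sY sE s t M r a21 a30 a12 a31 a40 v : ℝ}

/-- `b30` together with `sX³ ≤ a30`, after division by `sX`. It controls the second-order products
of the centering errors. -/
lemma MomentBounds.sq_mul_sq_le (h : MomentBounds sX sY sE s t M r a21 a30 a12 a31 a40 v) :
    288 * (sX ^ 2 * sY ^ 2) ≤ M * s ^ 2 := by
  have h1 := h.sX_pos
  have h2 := mul_le_mul_of_nonneg_right h.cube_le (sq_nonneg sY)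
  have h3 : 288 * (sX ^ 2 * sY ^ 2) * sX ≤ M * s ^ 2 * sX := by
    have := h.b30
    nlinarith
  exact le_of_mul_le_mul_right h3 h1

/-- By `sq_mul_sq_le`, the square of the left side is at most `r (M r) s² / 288`. Since `r (M r) ≤
1/36` and `36 · 288 ≥ 100²`, this is at most `(s/100)²`. -/
lemma MomentBounds.r_mul_le (h : MomentBounds sX sY sE s t M r a21 a30 a12 a31 a40 v) :
    r * (sX * sY) ≤ s / 100 := by
  have h0 := h.s_pos
  have hr := h.r_pos
  refine abs_le_of_sq_le_sq' ?_ (by positivity) |>.2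
  have h1 := h.sq_mul_sq_le
  have h2 : r ^ 2 * (288 * (sX ^ 2 * sY ^ 2)) ≤ r ^ 2 * (M * s ^ 2) := by gcongr
  have h3 : r ^ 2 * (M * s ^ 2) = r * (M * r) * s ^ 2 := by ring
  have h4 : r * (M * r) ≤ 1 / 30 * (5 / 6) := by
    have := h.four_le
    exact mul_le_mul h.r_le h.Mr_le (by positivity) (by norm_num)
  have h5 : r * (M * r) * s ^ 2 ≤ 1 / 30 * (5 / 6) * s ^ 2 := by gcongr
  nlinarith

lemma GoodSample.mean_abs_xxe (g : GoodSample x y sX sY sE s t r a21 a30 a12 a31 a40 v) :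
    (sampleMean fun i => |x i| ^ 2 * |y i - t * x i|) ≤ 2 * a21 + |t| * (2 * a30) := by
  calc _ ≤ sampleMean fun i => |x i| ^ 2 * |y i| + |t| * |x i| ^ 3 := by
        refine sampleMean_mono fun i => ?_
        have := abs_sub (y i) (t * x i)
        rw [abs_mul] at this
        nlinarith [sq_nonneg |x i|]
    _ ≤ _ := by
        rw [sampleMean_add, sampleMean_const_mul]
        have := g.m21; have := g.m30
        gcongr

lemma GoodSample.mean_abs_xxxe (g : GoodSample x y sX sY sE s t r a21 a30 a12 a31 a40 v) :
    (sampleMean fun i => |x i| ^ 3 * |y i - t * x i|) ≤ 2 * a31 + |t| * (2 * a40) := by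
  calc _ ≤ sampleMean fun i => |x i| ^ 3 * |y i| + |t| * |x i| ^ 4 := by
        refine sampleMean_mono fun i => ?_
        have := abs_sub (y i) (t * x i)
        rw [abs_mul] at this
        have h3 : 0 ≤ |x i| ^ 3 := by positivity
        nlinarith
    _ ≤ _ := by
        rw [sampleMean_add, sampleMean_const_mul]
        have := g.m31; have := g.m40
        gcongr

/-- Young's inequality with unequal weights: the first term gets the small one, because `b12` bounds
`a12` with a much worse constant than `b30` gives for `a30`. -/
lemma sq_sub_mul_le (a b c : ℝ) : (a - b * c) ^ 2 ≤ 5 / 4 * |a| ^ 2 + 5 * b ^ 2 * |c| ^ 2 := by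
  rw [sq_abs, sq_abs]; nlinarith [sq_nonneg (a / 2 + 2 * (b * c))]

lemma GoodSample.mean_abs_xee (g : GoodSample x y sX sY sE s t r a21 a30 a12 a31 a40 v) :
    (sampleMean fun i => |x i| * (y i - t * x i) ^ 2) ≤ 5 / 2 * a12 + 10 * t ^ 2 * a30 := by
  calc _ ≤ sampleMean fun i => 5 / 4 * (|x i| * |y i| ^ 2) + 5 * t ^ 2 * |x i| ^ 3 := by
        refine sampleMean_mono fun i => ?_
        have := mul_le_mul_of_nonneg_left (sq_sub_mul_le (y i) t (x i)) (abs_nonneg (x i))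
        linarith
    _ ≤ _ := by
        rw [sampleMean_add, sampleMean_const_mul, sampleMean_const_mul]
        have h1 := g.m12
        have h2 := mul_le_mul_of_nonneg_left g.m30 (show 0 ≤ 5 * t ^ 2 by positivity)
        linarith

lemma MomentBounds.slope_sq_le (h : MomentBounds sX sY sE s t M r a21 a30 a12 a31 a40 v) :
    t ^ 2 * sX ^ 2 ≤ sY ^ 2 := by
  have h1 := h.slope_le
  have h2 := h.sX_pos
  calc t ^ 2 * sX ^ 2 = (|t| * sX) ^ 2 := by rw [mul_pow, sq_abs]
    _ ≤ _ := by gcongr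

lemma GoodSample.mean_ee (g : GoodSample x y sX sY sE s t r a21 a30 a12 a31 a40 v)
    (h : MomentBounds sX sY sE s t M r a21 a30 a12 a31 a40 v) :
    (sampleMean fun i => (y i - t * x i) ^ 2) ≤ 7.04 * sY ^ 2 := by
  calc _ ≤ sampleMean fun i => 5 / 4 * |y i| ^ 2 + 5 * t ^ 2 * |x i| ^ 2 :=
        sampleMean_mono fun i => sq_sub_mul_le _ _ _
    _ ≤ _ := by
        rw [sampleMean_add, sampleMean_const_mul, sampleMean_const_mul]
        have h1 := g.m02
        have h2 := mul_le_mul_of_nonneg_left g.m20_le (show 0 ≤ 5 * t ^ 2 by positivity)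
        have h3 := h.slope_sq_le
        nlinarith [sq_nonneg sY]

lemma GoodSample.mean_abs_xe (g : GoodSample x y sX sY sE s t r a21 a30 a12 a31 a40 v)
    (h : MomentBounds sX sY sE s t M r a21 a30 a12 a31 a40 v) :
    (sampleMean fun i => |x i| * |y i - t * x i|) ≤ 9 / 4 * (sX * sY) := by
  have hX := h.sX_pos
  have hY := h.sY_pos
  calc _ ≤ sampleMean fun i => (sY / (2 * sX) + |t|) * |x i| ^ 2 + sX / (2 * sY) * |y i| ^ 2 := by
        refine sampleMean_mono fun i => ?_
        have h1 := abs_sub (y i) (t * x i)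
        rw [abs_mul] at h1
        have h2 : |x i| * |y i| ≤ sY / (2 * sX) * |x i| ^ 2 + sX / (2 * sY) * |y i| ^ 2 := by
          have e : sY / (2 * sX) * |x i| ^ 2 + sX / (2 * sY) * |y i| ^ 2 - |x i| * |y i|
              = (sY * |x i| - sX * |y i|) ^ 2 / (2 * sX * sY) := by field_simp; ring
          have : 0 ≤ (sY * |x i| - sX * |y i|) ^ 2 / (2 * sX * sY) := by positivity
          linarith
        have h3 := mul_le_mul_of_nonneg_left h1 (abs_nonneg (x i))
        linarith
    _ ≤ _ := by
        rw [sampleMean_add, sampleMean_const_mul, sampleMean_const_mul]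
        have h1 := mul_le_mul_of_nonneg_left g.m20_le
          (show 0 ≤ sY / (2 * sX) + |t| by positivity)
        have h2 := mul_le_mul_of_nonneg_left g.m02 (show 0 ≤ sX / (2 * sY) by positivity)
        have h3 := mul_le_mul_of_nonneg_right h.slope_le hX.le
        have e1 : (sY / (2 * sX) + |t|) * (9 / 8 * sX ^ 2)
            = 9 / 16 * (sX * sY) + 9 / 8 * (|t| * sX * sX) := by field_simp; ring
        have e2 : sX / (2 * sY) * (9 / 8 * sY ^ 2) = 9 / 16 * (sX * sY) := by field_simp; ring
        linarith

end Deterministic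
end RobustSlope

/-! ### Deterministic expansion of the statistic on a good sample -/

namespace RobustSlope
variable {n : ℕ} {x y : Fin n → ℝ} {sX sY sE s t M r a21 a30 a12 a31 a40 v : ℝ}

/-- The empirical covariance of `x` and the errors. -/
noncomputable def covHat {n : ℕ} (x e : Fin n → ℝ) : ℝ :=
  sampleMean fun i => (x i - sampleMean x) * (e i - sampleMean e)

/-- The empirical variance of `x`. -/
noncomputable def varHat {n : ℕ} (x : Fin n → ℝ) : ℝ := sampleMean fun i => (x i - sampleMean x) ^ 2

/-- The numerator of the robust variance estimator. -/
noncomputable def numHat {n : ℕ} (x e : Fin n → ℝ) : ℝ :=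
  sampleMean fun i => ((x i - sampleMean x) * (e i - sampleMean e -
    covHat x e / varHat x * (x i - sampleMean x))) ^ 2

lemma GoodSample.varHat_ge (g : GoodSample x y sX sY sE s t r a21 a30 a12 a31 a40 v)
    (h : MomentBounds sX sY sE s t M r a21 a30 a12 a31 a40 v) (hn : 1 ≤ n) :
    87 / 100 * sX ^ 2 ≤ varHat x := by
  have h1 := g.m20_ge
  have h0 := h.sX_pos
  have hr := h.r_pos
  simp only [sq_abs] at h1
  rw [varHat, sampleMean_centered_sq hn]
  have h2 : sampleMean x ^ 2 ≤ (sX * r) ^ 2 := by rw [← sq_abs]; gcongr; exact g.mx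
  have h3 : (sX * r) ^ 2 ≤ (sX * (1 / 30)) ^ 2 := by gcongr; exact h.r_le
  nlinarith

lemma GoodSample.varHat_pos (g : GoodSample x y sX sY sE s t r a21 a30 a12 a31 a40 v)
    (h : MomentBounds sX sY sE s t M r a21 a30 a12 a31 a40 v) (hn : 1 ≤ n) :
    0 < varHat x := by
  have := g.varHat_ge h hn
  have := h.sX_pos
  have : 0 < 87 / 100 * sX ^ 2 := by positivity
  linarith

lemma GoodSample.abs_covHat_sub_le (g : GoodSample x y sX sY sE s t r a21 a30 a12 a31 a40 v)
    (hn : 1 ≤ n) :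
    |covHat x (fun i => y i - t * x i) - sampleMean fun i => x i * (y i - t * x i)|
      ≤ sX * sE * r ^ 2 := by
  rw [covHat, sampleMean_centered_mul hn, sub_sub_cancel_left, abs_neg, abs_mul]
  calc _ ≤ (sX * r) * (sE * r) :=
        mul_le_mul g.mx g.me (abs_nonneg _) ((abs_nonneg _).trans g.mx)
    _ = _ := by ring

lemma GoodSample.abs_covHat_le (g : GoodSample x y sX sY sE s t r a21 a30 a12 a31 a40 v)
    (h : MomentBounds sX sY sE s t M r a21 a30 a12 a31 a40 v) (hn : 1 ≤ n) :
    |covHat x (fun i => y i - t * x i)| ≤ 101 / 100 * (s * r) := by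
  have h1 := g.abs_covHat_sub_le hn
  have h2 := g.mxe
  have h3 := abs_sub_abs_le_abs_sub (covHat x (fun i => y i - t * x i))
    (sampleMean fun i => x i * (y i - t * x i))
  have h4 : sX * sE * r ^ 2 ≤ s / 100 * r := by
    have := h.r_mul_le
    have := h.sE_le
    have := h.sX_pos
    have := h.r_pos
    calc sX * sE * r ^ 2 ≤ sX * sY * r ^ 2 := by gcongr
      _ = r * (sX * sY) * r := by ring
      _ ≤ _ := by gcongr
  linarith

lemma GoodSample.abs_slopeErr_le (g : GoodSample x y sX sY sE s t r a21 a30 a12 a31 a40 v)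
    (h : MomentBounds sX sY sE s t M r a21 a30 a12 a31 a40 v) (hn : 1 ≤ n) :
    |covHat x (fun i => y i - t * x i) / varHat x| ≤ 6 / 5 * (s * r / sX ^ 2) := by
  have h1 := g.varHat_ge h hn
  have h2 := g.abs_covHat_le h hn
  have h0 := h.sX_pos
  have hr := h.r_pos
  have hs := h.s_pos
  rw [abs_div, abs_of_pos (g.varHat_pos h hn), div_le_iff₀ (g.varHat_pos h hn)]
  calc _ ≤ 101 / 100 * (s * r) := h2
    _ ≤ 6 / 5 * (s * r / sX ^ 2) * (87 / 100 * sX ^ 2) := by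
      have : 6 / 5 * (s * r / sX ^ 2) * (87 / 100 * sX ^ 2) = 6 / 5 * (87 / 100) * (s * r) := by
        field_simp
      rw [this]
      have : 0 < s * r := by positivity
      linarith
    _ ≤ _ := by gcongr

/-- Cauchy–Schwarz gives this cruder bound without the factor `r`. Its product with
`abs_slopeErr_le` bounds the squared slope error by a multiple of `s r sY / sX³`, precisely the form
in which `b40` handles the fourth moment. -/
lemma GoodSample.abs_slopeErr_le' (g : GoodSample x y sX sY sE s t r a21 a30 a12 a31 a40 v)
    (h : MomentBounds sX sY sE s t M r a21 a30 a12 a31 a40 v) (hn : 1 ≤ n) :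
    |covHat x (fun i => y i - t * x i) / varHat x| ≤ 3 * (sY / sX) := by
  have h1 := g.varHat_ge h hn
  have h0 := h.sX_pos
  have hY := h.sY_pos
  have hV := g.varHat_pos h hn
  set e := fun i => y i - t * x i with he
  refine abs_le_of_sq_le_sq ?_ (by positivity)
  rw [div_pow, div_le_iff₀ (by positivity)]
  have h2 : covHat x e ^ 2 ≤ varHat x * sampleMean (fun i => (e i - sampleMean e) ^ 2) :=
    sampleMean_mul_sq_le _ _
  have h3 : sampleMean (fun i => (e i - sampleMean e) ^ 2) ≤ 7.04 * sY ^ 2 := by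
    rw [sampleMean_centered_sq hn]
    have := g.mean_ee h
    have := sq_nonneg (sampleMean e)
    simp only [he] at *
    linarith
  calc _ ≤ _ := h2
    _ ≤ varHat x * (7.04 * sY ^ 2) := by gcongr
    _ ≤ varHat x * ((3 * (sY / sX)) ^ 2 * (87 / 100 * sX ^ 2)) := by
      refine mul_le_mul_of_nonneg_left ?_ hV.le
      have : (3 * (sY / sX)) ^ 2 * (87 / 100 * sX ^ 2) = 9 * (87 / 100) * sY ^ 2 := by
        field_simp; norm_num
      rw [this]
      nlinarith
    _ = (3 * (sY / sX)) ^ 2 * (87 / 100 * sX ^ 2) * varHat x := by ring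
    _ ≤ (3 * (sY / sX)) ^ 2 * varHat x * varHat x := by gcongr
    _ = _ := by ring

/-- The cross term with the centering errors. -/
lemma GoodSample.abs_mean_cross_le (g : GoodSample x y sX sY sE s t r a21 a30 a12 a31 a40 v)
    (h : MomentBounds sX sY sE s t M r a21 a30 a12 a31 a40 v) {a b : ℝ}
    (ha : |a| ≤ sX * r) (hb : |b| ≤ sY * r) :
    |sampleMean fun i => x i * (y i - t * x i) * (-b * x i - a * (y i - t * x i) + a * b)|
      ≤ 0.1416 * (M * s ^ 2 * r) := by
  have h0 := h.sX_pos
  have hY := h.sY_pos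
  have hs := h.s_pos
  have hr := h.r_pos
  have hM := h.four_le
  calc _ ≤ sampleMean fun i => |b| * (|x i| ^ 2 * |y i - t * x i|)
        + |a| * (|x i| * (y i - t * x i) ^ 2) + |a| * |b| * (|x i| * |y i - t * x i|) := by
        refine abs_sampleMean_le fun i => ?_
        set e := y i - t * x i
        rw [abs_mul, abs_mul]
        have h1 : |-b * x i - a * e + a * b| ≤ |b| * |x i| + |a| * |e| + |a| * |b| := by
          refine (abs_add_le _ _).trans (add_le_add ((abs_sub _ _).trans ?_) (abs_mul _ _).le)
          rw [abs_mul, abs_mul, abs_neg]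
        calc |x i| * |e| * |-b * x i - a * e + a * b|
            ≤ |x i| * |e| * (|b| * |x i| + |a| * |e| + |a| * |b|) := by gcongr
          _ = _ := by rw [← sq_abs e]; ring
    _ = |b| * (sampleMean fun i => |x i| ^ 2 * |y i - t * x i|)
        + |a| * (sampleMean fun i => |x i| * (y i - t * x i) ^ 2)
        + |a| * |b| * (sampleMean fun i => |x i| * |y i - t * x i|) := by
        simp only [sampleMean_add, sampleMean_const_mul]
    _ ≤ sY * r * (2 * a21 + |t| * (2 * a30)) + sX * r * (5 / 2 * a12 + 10 * t ^ 2 * a30)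
        + sX * r * (sY * r) * (9 / 4 * (sX * sY)) := by
        have n1 : 0 ≤ sampleMean fun i => |x i| ^ 2 * |y i - t * x i| :=
          sampleMean_nonneg fun i => by positivity
        have n2 : 0 ≤ sampleMean fun i => |x i| * (y i - t * x i) ^ 2 :=
          sampleMean_nonneg fun i => by positivity
        have n3 : 0 ≤ sampleMean fun i => |x i| * |y i - t * x i| :=
          sampleMean_nonneg fun i => by positivity
        exact add_le_add (add_le_add (mul_le_mul hb g.mean_abs_xxe n1 (by positivity))
          (mul_le_mul ha g.mean_abs_xee n2 (by positivity)))
          (mul_le_mul (mul_le_mul ha hb (abs_nonneg _) (by positivity)) (g.mean_abs_xe h) n3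
            (by positivity))
    _ ≤ _ := by
        -- The coefficients add up to `2/144 + 2/144 + 5/64 + 10/288 + 1/3840 < 0.1416`.
        have k1 := mul_le_mul_of_nonneg_left h.b21 hr.le
        have k2 := mul_le_mul_of_nonneg_left h.b30t hr.le
        have k3 := mul_le_mul_of_nonneg_left h.b12 hr.le
        have k4 : r * (288 * (t ^ 2 * sX * a30)) ≤ r * (M * s ^ 2) := by
          refine mul_le_mul_of_nonneg_left ?_ hr.le
          have ha30 : 0 ≤ a30 := le_trans (by positivity) h.cube_le
          refine le_of_mul_le_mul_right ?_ h0
          calc 288 * (t ^ 2 * sX * a30) * sX = 288 * (a30 * (t ^ 2 * sX ^ 2)) := by ring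
            _ ≤ 288 * (a30 * sY ^ 2) := by
              have := h.slope_sq_le
              gcongr
            _ ≤ _ := h.b30
        have k5 : r ^ 2 * (288 * (sX ^ 2 * sY ^ 2)) ≤ 1 / 30 * (r * (M * s ^ 2)) := by
          calc r ^ 2 * (288 * (sX ^ 2 * sY ^ 2)) ≤ r ^ 2 * (M * s ^ 2) :=
                mul_le_mul_of_nonneg_left h.sq_mul_sq_le (sq_nonneg r)
            _ = r * (r * (M * s ^ 2)) := by ring
            _ ≤ _ := by gcongr; exact h.r_le
        have hQ : 0 < r * (M * s ^ 2) := by positivity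
        linarith

/-- The cross term with the slope error. -/
lemma GoodSample.abs_mean_slope_cross_le (g : GoodSample x y sX sY sE s t r a21 a30 a12 a31 a40 v)
    (h : MomentBounds sX sY sE s t M r a21 a30 a12 a31 a40 v) {a d : ℝ}
    (ha : |a| ≤ sX * r) (hd : |d| ≤ 6 / 5 * (s * r / sX ^ 2)) :
    |sampleMean fun i => x i * (y i - t * x i) * (-d * (x i - a) ^ 2)|
      ≤ 0.0214 * (M * s ^ 2 * r) := by
  have h0 := h.sX_pos
  have hY := h.sY_pos
  have hs := h.s_pos
  have hr := h.r_pos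
  have hM := h.four_le
  have ha2 : a ^ 2 ≤ (sX * r) ^ 2 := by rw [← sq_abs]; gcongr
  calc _ ≤ sampleMean fun i => |d| * (2 * (|x i| ^ 3 * |y i - t * x i|)
        + 2 * a ^ 2 * (|x i| * |y i - t * x i|)) := by
        refine abs_sampleMean_le fun i => ?_
        set e := y i - t * x i
        rw [abs_mul, abs_mul, abs_mul, abs_neg, abs_pow, sq_abs]
        have h1 : (x i - a) ^ 2 ≤ 2 * |x i| ^ 2 + 2 * a ^ 2 := by
          rw [sq_abs]; nlinarith [sq_nonneg (x i + a)]
        calc |x i| * |e| * (|d| * (x i - a) ^ 2)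
            ≤ |x i| * |e| * (|d| * (2 * |x i| ^ 2 + 2 * a ^ 2)) := by gcongr
          _ = _ := by ring
    _ = |d| * (2 * (sampleMean fun i => |x i| ^ 3 * |y i - t * x i|)
        + 2 * a ^ 2 * (sampleMean fun i => |x i| * |y i - t * x i|)) := by
        simp only [sampleMean_add, sampleMean_const_mul]
    _ ≤ 6 / 5 * (s * r / sX ^ 2) * (2 * (2 * a31 + |t| * (2 * a40))
        + 2 * (sX * r) ^ 2 * (9 / 4 * (sX * sY))) := by
        have n1 : 0 ≤ sampleMean fun i => |x i| ^ 3 * |y i - t * x i| :=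
          sampleMean_nonneg fun i => by positivity
        have n3 : 0 ≤ sampleMean fun i => |x i| * |y i - t * x i| :=
          sampleMean_nonneg fun i => by positivity
        have := g.mean_abs_xxxe
        have := g.mean_abs_xe h
        gcongr
    _ = 24 / 5 * (s * r) * (a31 / sX ^ 2) + 24 / 5 * (s * r) * (|t| * a40 / sX ^ 2)
        + 27 / 5 * (s * r ^ 2) * (r * (sX * sY)) := by field_simp; ring
    _ ≤ 24 / 5 * (s * r) * (M * s / 1152) + 24 / 5 * (s * r) * (M * s / 288)
        + 27 / 5 * (s * (1 / 30 * r)) * (s / 100) := by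
        have k1 : a31 / sX ^ 2 ≤ M * s / 1152 := by
          rw [div_le_div_iff₀ (by positivity) (by norm_num)]
          linarith [h.b31]
        have k2 : |t| * a40 / sX ^ 2 ≤ M * s / 288 := by
          rw [div_le_div_iff₀ (by positivity) (by norm_num)]
          linarith [h.b40t]
        have k3 : r ^ 2 ≤ 1 / 30 * r := by rw [pow_two]; gcongr; exact h.r_le
        have := h.r_mul_le
        gcongr
    _ ≤ _ := by
        -- The last summand, `0.0018 s² r`, has no factor `M`; it is absorbed through `M ≥ 4`.
        have : s ^ 2 * r * 4 ≤ s ^ 2 * r * M := by gcongr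
        have hQ : 0 < s ^ 2 * r := by positivity
        nlinarith

lemma sub_pow_four_le (x a : ℝ) : (x - a) ^ 4 ≤ 8 * (x ^ 4 + a ^ 4) := by
  have h4 : (x - a) ^ 2 ≤ 2 * (x ^ 2 + a ^ 2) := by nlinarith [sq_nonneg (x + a)]
  calc (x - a) ^ 4 = ((x - a) ^ 2) ^ 2 := by ring
    _ ≤ (2 * (x ^ 2 + a ^ 2)) ^ 2 := by gcongr
    _ ≤ _ := by nlinarith [sq_nonneg (x ^ 2 - a ^ 2)]

lemma sq_add_le_quartic (x e a b d : ℝ) :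
    ((-b * x - a * e + a * b) + -d * (x - a) ^ 2) ^ 2
      ≤ 15 * b ^ 2 * x ^ 2 + 15 * a ^ 2 * e ^ 2 + 15 * (a ^ 2 * b ^ 2)
        + (10 * d ^ 2 * x ^ 4 + 10 * d ^ 2 * a ^ 4) := by
  have h1 : ∀ G F : ℝ, (G + F) ^ 2 ≤ 5 * G ^ 2 + 5 / 4 * F ^ 2 := fun G F => by
    nlinarith [sq_nonneg (4 * G - F)]
  have h2 : ∀ p q w : ℝ, (p + q + w) ^ 2 ≤ 3 * (p ^ 2 + q ^ 2 + w ^ 2) := fun p q w => by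
    nlinarith [sq_nonneg (p - q), sq_nonneg (p - w), sq_nonneg (q - w)]
  have h3 := mul_le_mul_of_nonneg_left (sub_pow_four_le x a) (sq_nonneg d)
  have h4 := h1 (-b * x + -(a * e) + a * b) (-d * (x - a) ^ 2)
  have h5 := h2 (-b * x) (-(a * e)) (a * b)
  have e1 : (-d * (x - a) ^ 2) ^ 2 = d ^ 2 * (x - a) ^ 4 := by ring
  have e2 : (-b * x) ^ 2 + (-(a * e)) ^ 2 + (a * b) ^ 2
      = b ^ 2 * x ^ 2 + a ^ 2 * e ^ 2 + a ^ 2 * b ^ 2 := by ring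
  rw [e1] at h4
  rw [e2] at h5
  rw [show -b * x - a * e + a * b = -b * x + -(a * e) + a * b by ring]
  linarith

/-- The quadratic term. -/
lemma GoodSample.mean_sq_le (g : GoodSample x y sX sY sE s t r a21 a30 a12 a31 a40 v)
    (h : MomentBounds sX sY sE s t M r a21 a30 a12 a31 a40 v) (hn : 1 ≤ n) {a b d : ℝ}
    (ha : |a| ≤ sX * r) (hb : |b| ≤ sY * r) (hd : |d| ≤ 6 / 5 * (s * r / sX ^ 2))
    (hd' : |d| ≤ 3 * (sY / sX)) :
    (sampleMean fun i => ((-b * x i - a * (y i - t * x i) + a * b) + -d * (x i - a) ^ 2) ^ 2)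
      ≤ 0.08 * (M * s ^ 2 * r) := by
  have h0 := h.sX_pos
  have hY := h.sY_pos
  have hs := h.s_pos
  have hr := h.r_pos
  have hM := h.four_le
  have ha2 : a ^ 2 ≤ (sX * r) ^ 2 := by rw [← sq_abs]; gcongr
  have hb2 : b ^ 2 ≤ (sY * r) ^ 2 := by rw [← sq_abs]; gcongr
  have hd2 : d ^ 2 ≤ 6 / 5 * (s * r / sX ^ 2) * (3 * (sY / sX)) := by
    rw [← sq_abs, pow_two]; exact mul_le_mul hd hd' (abs_nonneg _) (by positivity)
  have ha40 : 0 ≤ a40 := le_trans (by positivity) h.fourth_le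
  have ha4 : a ^ 4 ≤ 1 / 1000 * a40 := by
    have hr2 : r ^ 2 ≤ (1 / 30) ^ 2 := by gcongr; exact h.r_le
    calc a ^ 4 = (a ^ 2) ^ 2 := by ring
      _ ≤ ((sX * r) ^ 2) ^ 2 := by gcongr
      _ = sX ^ 4 * (r ^ 2) ^ 2 := by ring
      _ ≤ a40 * ((1 / 30) ^ 2) ^ 2 := by gcongr; exact h.fourth_le
      _ ≤ _ := by nlinarith
  calc _ ≤ sampleMean fun i => 15 * b ^ 2 * |x i| ^ 2 + 15 * a ^ 2 * (y i - t * x i) ^ 2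
        + 15 * (a ^ 2 * b ^ 2) + (10 * d ^ 2 * |x i| ^ 4 + 10 * d ^ 2 * a ^ 4) := by
        refine sampleMean_mono fun i => ?_
        rw [sq_abs, Even.pow_abs (by decide)]
        exact sq_add_le_quartic (x i) (y i - t * x i) a b d
    _ = 15 * b ^ 2 * (sampleMean fun i => |x i| ^ 2)
        + 15 * a ^ 2 * (sampleMean fun i => (y i - t * x i) ^ 2) + 15 * (a ^ 2 * b ^ 2)
        + (10 * d ^ 2 * (sampleMean fun i => |x i| ^ 4) + 10 * d ^ 2 * a ^ 4) := by
        simp only [sampleMean_add, sampleMean_const_mul, sampleMean_const hn]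
    _ ≤ 15 * (sY * r) ^ 2 * (9 / 8 * sX ^ 2) + 15 * (sX * r) ^ 2 * (7.04 * sY ^ 2)
        + 15 * ((sX * r) ^ 2 * (sY * r) ^ 2)
        + 10 * (6 / 5 * (s * r / sX ^ 2) * (3 * (sY / sX))) * (2.001 * a40) := by
        have n1 : 0 ≤ sampleMean fun i => |x i| ^ 2 := sampleMean_nonneg fun i => by positivity
        have n2 : 0 ≤ sampleMean fun i => (y i - t * x i) ^ 2 :=
          sampleMean_nonneg fun i => by positivity
        have n3 : 0 ≤ sampleMean fun i => |x i| ^ 4 := sampleMean_nonneg fun i => by positivity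
        have h1 := g.m20_le
        have h2 := g.mean_ee h
        have h3 : (sampleMean fun i => |x i| ^ 4) + a ^ 4 ≤ 2.001 * a40 := by
          linarith [g.m40]
        have h4 : 10 * d ^ 2 * (sampleMean fun i => |x i| ^ 4) + 10 * d ^ 2 * a ^ 4
            ≤ 10 * (6 / 5 * (s * r / sX ^ 2) * (3 * (sY / sX))) * (2.001 * a40) := by
          rw [← mul_add]; gcongr
        have h5 : 15 * b ^ 2 * (sampleMean fun i => |x i| ^ 2)
            ≤ 15 * (sY * r) ^ 2 * (9 / 8 * sX ^ 2) := by gcongr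
        have h6 : 15 * a ^ 2 * (sampleMean fun i => (y i - t * x i) ^ 2)
            ≤ 15 * (sX * r) ^ 2 * (7.04 * sY ^ 2) := by gcongr
        have h7 : 15 * (a ^ 2 * b ^ 2) ≤ 15 * ((sX * r) ^ 2 * (sY * r) ^ 2) := by gcongr
        linarith
    _ = r ^ 2 * (sX ^ 2 * sY ^ 2) * (15 * (9 / 8 + 7.04 + r ^ 2))
        + 72.036 * (s * r) * (a40 * sY / sX ^ 3) := by field_simp; ring
    _ ≤ 1 / 30 * (r * (M * s ^ 2) / 288) * (15 * (9 / 8 + 7.04 + 1))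
        + 72.036 * (s * r) * (M * s / 1152) := by
        have k1 : a40 * sY / sX ^ 3 ≤ M * s / 1152 := by
          rw [div_le_div_iff₀ (by positivity) (by norm_num)]
          linarith [h.b40]
        have k2 : r ^ 2 ≤ 1 := pow_le_one₀ hr.le (by linarith [h.r_le])
        have k5 : r ^ 2 * (sX ^ 2 * sY ^ 2) ≤ 1 / 30 * (r * (M * s ^ 2) / 288) := by
          have h9 := h.sq_mul_sq_le
          calc r ^ 2 * (sX ^ 2 * sY ^ 2) ≤ r ^ 2 * (M * s ^ 2 / 288) := by gcongr; linarith
            _ = r * (r * (M * s ^ 2) / 288) := by ring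
            _ ≤ _ := by gcongr; exact h.r_le
        gcongr
    _ ≤ _ := by
        have hQ : 0 < M * s ^ 2 * r := by positivity
        nlinarith

/-- The robust variance estimator is close to its population counterpart. -/
lemma GoodSample.abs_numHat_sub_le (g : GoodSample x y sX sY sE s t r a21 a30 a12 a31 a40 v)
    (h : MomentBounds sX sY sE s t M r a21 a30 a12 a31 a40 v) (hn : 1 ≤ n) :
    |numHat x (fun i => y i - t * x i) - s ^ 2| ≤ 7 / 10 * (M * s ^ 2 * r) := by
  have hr := h.r_pos
  set e : Fin n → ℝ := fun i => y i - t * x i with he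
  set d := covHat x e / varHat x with hd
  set a := sampleMean x with ha
  set b := sampleMean e with hb
  have hme : |b| ≤ sY * r := g.me.trans (by gcongr; exact h.sE_le)
  -- Each product of centered regressor and residual is `x e + G + F`, with `G` due to the centering
  -- and `F` to the slope error. The square is split into the leading part, two cross terms and `(G
  -- + F)²`. The errors total `1/4 + 2 · 0.1416 + 2 · 0.0214 + 0.08 < 0.7` in units of `M s² r`.
  have e0 : ∀ a b d : ℝ, (sampleMean fun i => ((x i - a) * (e i - b - d * (x i - a))) ^ 2)
      = (sampleMean fun i => (x i * e i) ^ 2)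
      + 2 * (sampleMean fun i => x i * e i * (-b * x i - a * e i + a * b))
      + 2 * (sampleMean fun i => x i * e i * (-d * (x i - a) ^ 2))
      + sampleMean fun i => ((-b * x i - a * e i + a * b) + -d * (x i - a) ^ 2) ^ 2 := by
    intro a b d
    simp only [← sampleMean_const_mul, ← sampleMean_add]
    congr 1 with i
    ring
  have e1 : numHat x e = _ := e0 a b d
  have k0 := g.mxe2
  have k1 := g.abs_mean_cross_le h g.mx hme
  have k2 := g.abs_mean_slope_cross_le h g.mx (g.abs_slopeErr_le h hn)
  have k3 := g.mean_sq_le h hn g.mx hme (g.abs_slopeErr_le h hn) (g.abs_slopeErr_le' h hn)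
  have k4 : 0 ≤ sampleMean fun i => ((-b * x i - a * e i + a * b) + -d * (x i - a) ^ 2) ^ 2 :=
    sampleMean_nonneg fun i => sq_nonneg _
  have k5 : v * r ≤ 1 / 4 * (M * s ^ 2 * r) := by
    have := mul_le_mul_of_nonneg_right h.bv hr.le
    linarith
  have hs := h.s_pos
  have hM := h.four_le
  have hQ : 0 < M * s ^ 2 * r := by positivity
  rw [e1]
  simp only [he] at *
  rw [abs_le] at k0 k1 k2 ⊢
  constructor <;> linarith [k0.1, k0.2, k1.1, k1.2, k2.1, k2.2]

/-- Here `1/√u - 1 = (1 - u) / (√u (1 + √u))`, and for `u ≥ 5/12` the denominator is at least 1. The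
threshold `7/12` is `0.7 · 5/6`, the product of the relative error of `numHat` and the bound on `M
r`. -/
lemma abs_inv_sqrt_sub_one_le {u q : ℝ} (hq : q ≤ 7 / 12) (h : |u - 1| ≤ q) :
    |1 / √u - 1| ≤ q := by
  have h1 := abs_le.1 h
  have hu : 5 / 12 ≤ u := by linarith
  set p := √u
  have hp2 : p ^ 2 = u := Real.sq_sqrt (by linarith)
  have hp : 64 / 100 ≤ p := Real.le_sqrt_of_sq_le (by norm_num; linarith)
  have e : 1 / p - 1 = (1 - u) / (p * (1 + p)) := by
    rw [← hp2]; field_simp; ring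
  rw [e, abs_div, abs_of_pos (by positivity : 0 < p * (1 + p)), abs_sub_comm]
  refine (div_le_self (abs_nonneg _) ?_).trans h
  nlinarith

/-- On a good sample the studentized statistic is close to a normalized sum. -/
lemma GoodSample.abs_studentized_sub_le
    (g : GoodSample x y sX sY sE s t r a21 a30 a12 a31 a40 v)
    (h : MomentBounds sX sY sE s t M r a21 a30 a12 a31 a40 v) (hn : 1 ≤ n) {X Y : Fin n → ℝ}
    {a b : ℝ} (hX : ∀ i, X i = x i + a) (hY : ∀ i, Y i = y i + b) :
    |studentized t X Y - √(n : ℝ) * (sampleMean fun i => x i * (y i - t * x i)) / s|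
      ≤ √(n : ℝ) * r ^ 2 * (3 * (sX * sE) / s + M) := by
  have hs := h.s_pos
  have hr := h.r_pos
  have hM := h.four_le
  set e : Fin n → ℝ := fun i => y i - t * x i with he
  have hst : studentized t X Y = √(n : ℝ) * covHat x e / √(numHat x e) :=
    studentized_eq hn t hX (fun i => by rw [hY, he]; ring) (g.varHat_pos h hn)
  set A := covHat x e
  set B := numHat x e
  set U := sampleMean fun i => x i * e i
  have hB := g.abs_numHat_sub_le h hn
  have hA := g.abs_covHat_sub_le hn
  have hU : |U| ≤ s * r := g.mxe
  have hu : |B / s ^ 2 - 1| ≤ 7 / 10 * (M * r) := by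
    rw [div_sub_one (by positivity), abs_div, abs_of_pos (by positivity : 0 < s ^ 2),
      div_le_iff₀ (by positivity)]
    linarith
  have hinv := abs_inv_sqrt_sub_one_le (by linarith [h.Mr_le]) hu
  rw [Real.sqrt_div' _ (by positivity), Real.sqrt_sq hs.le] at hinv
  set D := sX * sE * r ^ 2 with hD
  have hAle : |A| ≤ s * r + D := by
    have := abs_sub_abs_le_abs_sub A U
    linarith
  have hD0 : 0 ≤ D := (abs_nonneg _).trans hA
  have e1 : √(n : ℝ) * A / √B - √(n : ℝ) * U / s
      = √(n : ℝ) / s * (A * (1 / (√B / s) - 1) + (A - U)) := by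
    rw [one_div_div]; field_simp; ring
  rw [hst, e1, abs_mul, abs_of_nonneg (by positivity)]
  have h1 : |A * (1 / (√B / s) - 1) + (A - U)| ≤ (s * r + D) * (7 / 10 * (M * r)) + D := by
    refine (abs_add_le _ _).trans (add_le_add ?_ hA)
    rw [abs_mul]
    exact mul_le_mul hAle hinv (abs_nonneg _) (by positivity)
  have h2 : (s * r + D) * (7 / 10 * (M * r)) + D ≤ M * s * r ^ 2 + 3 * D := by
    have h3 : D * (7 / 10 * (M * r)) ≤ D * 1 := by
      gcongr
      linarith [h.Mr_le]
    have h4 : 0 < M * s * r ^ 2 := by positivity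
    nlinarith
  calc _ ≤ √(n : ℝ) / s * (M * s * r ^ 2 + 3 * D) := by gcongr; exact h1.trans h2
    _ = _ := by rw [hD]; field_simp; ring

end RobustSlope

/-! ### Deviation inequalities for means of independent copies -/

namespace RobustSlope

variable {Ω Ω₀ β : Type*} [MeasurableSpace Ω] [MeasurableSpace Ω₀] [MeasurableSpace β]
  {P : Measure Ω} {P₀ : Measure Ω₀} {n : ℕ}

/-- The `W i` are independent copies of `W₀`. -/
structure IsIIDCopies (P : Measure Ω) (P₀ : Measure Ω₀) (W : Fin n → Ω → β) (W₀ : Ω₀ → β) :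
    Prop where
  ident : ∀ i, IdentDistrib (W i) W₀ P P₀
  indep : iIndepFun W P

lemma IsIIDCopies.comp {γ : Type*} [MeasurableSpace γ] {W : Fin n → Ω → β} {W₀ : Ω₀ → β}
    (h : IsIIDCopies P P₀ W W₀) {g : β → γ} (hg : Measurable g) :
    IsIIDCopies P P₀ (fun i ω => g (W i ω)) (fun ω => g (W₀ ω)) :=
  ⟨fun i => (h.ident i).comp hg, h.indep.comp (fun _ => g) fun _ => hg⟩

lemma measurable_sampleMean : Measurable (sampleMean : (Fin n → ℝ) → ℝ) := by
  unfold sampleMean; fun_prop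

lemma IsIIDCopies.aemeasurable_sampleMean {W : Fin n → Ω → ℝ} {W₀ : Ω₀ → ℝ}
    (h : IsIIDCopies P P₀ W W₀) : AEMeasurable (fun ω => sampleMean fun i => W i ω) P :=
  measurable_sampleMean.comp_aemeasurable
    (aemeasurable_pi_lambda _ fun i => (h.ident i).aemeasurable_fst)

section Gaussian
variable {W : Fin n → Ω → ℝ} {W₀ : Ω₀ → ℝ} {c : ℝ≥0}

lemma IsIIDCopies.berryEsseen [IsProbabilityMeasure P₀] (h : IsIIDCopies P P₀ W W₀) (hc : IsBerryEsseenConstant c)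
    (h3 : MemLp W₀ 3 P₀) (hmean : ∫ ω, W₀ ω ∂P₀ = 0) (hvar : 0 < Var[W₀; P₀]) (hn : 1 ≤ n)
    (x : ℝ) :
    |P.real {ω | √(n : ℝ) * (sampleMean fun i => W i ω) / √Var[W₀; P₀] ≤ x}
        - cdf (gaussianReal 0 1) x|
      ≤ c * (∫ ω, |W₀ ω| ^ 3 ∂P₀) / (√Var[W₀; P₀] ^ 3 * √(n : ℝ)) := by
  have hW := h3.1.aemeasurable
  set ν := P₀.map W₀ with hν
  have : IsProbabilityMeasure ν := Measure.isProbabilityMeasure_map hW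
  have hid : IdentDistrib (fun z : ℝ => z) W₀ ν P₀ :=
    ⟨aemeasurable_id, hW, by rw [hν]; exact Measure.map_id⟩
  have hv := hid.variance_eq
  have hmap : P.map (fun ω i => W i ω) = Measure.pi fun _ : Fin n => ν := by
    rw [h.indep.map_fun_eq_pi_map fun i => (h.ident i).aemeasurable_fst]
    congr 1 with i : 1
    exact (h.ident i).map_eq
  have hmain := hc ν (hid.memLp_iff.2 h3) (hid.integral_eq.trans hmean) (by rwa [hv]) n hn x
  have hcube : ∫ z, |z| ^ 3 ∂ν = ∫ ω, |W₀ ω| ^ 3 ∂P₀ :=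
    (hid.comp (u := fun z => |z| ^ 3) (by fun_prop)).integral_eq
  rw [hv, hcube, ← hmap, map_measureReal_apply_of_aemeasurable
    (aemeasurable_pi_lambda _ fun i => (h.ident i).aemeasurable_fst)] at hmain
  · exact hmain
  · exact measurableSet_le (((measurable_sampleMean).const_mul _).div_const _) measurable_const

lemma gaussian_tail_le {a : ℝ} (ha : 0 ≤ a) :
    1 - cdf (gaussianReal 0 1) a ≤ Real.exp (-a ^ 2 / 2) ∧
      cdf (gaussianReal 0 1) (-a) ≤ Real.exp (-a ^ 2 / 2) := by
  have hint : ∀ t : ℝ, Integrable (fun ω : ℝ => Real.exp (t * id ω)) (gaussianReal 0 1) :=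
    fun t => integrable_exp_mul_gaussianReal t
  have hexp : Real.exp (-a * a) * Real.exp (0 * a + (1 : ℝ≥0) * a ^ 2 / 2)
      = Real.exp (-a ^ 2 / 2) := by
    rw [← Real.exp_add]; congr 1; simp; ring
  constructor
  · have h := measure_ge_le_exp_mul_mgf (X := id) (μ := gaussianReal 0 1) a ha (hint a)
    rw [mgf_id_gaussianReal] at h
    simp only [hexp] at h
    refine le_trans ?_ h
    rw [cdf_eq_real, ← probReal_compl_eq_one_sub measurableSet_Iic]
    refine measureReal_mono fun y hy => ?_
    simp only [Set.mem_compl_iff, Set.mem_Iic, not_le] at hy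
    exact hy.le
  · have h := measure_le_le_exp_mul_mgf (X := id) (μ := gaussianReal 0 1) (t := -a) (-a)
      (by linarith) (hint (-a))
    rw [mgf_id_gaussianReal] at h
    have e : Real.exp (- -a * -a) * Real.exp (0 * -a + (1 : ℝ≥0) * (-a) ^ 2 / 2)
        = Real.exp (-a ^ 2 / 2) := by
      rw [← hexp]; congr 2 <;> ring
    simp only [e] at h
    rw [cdf_eq_real]
    exact h

variable [IsProbabilityMeasure P] [IsProbabilityMeasure P₀]

/-- Moderate deviations of a sample mean, from the Berry–Esseen inequality. -/
lemma IsIIDCopies.tail_le (h : IsIIDCopies P P₀ W W₀) (hc : IsBerryEsseenConstant c)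
    (h3 : MemLp W₀ 3 P₀) (hmean : ∫ ω, W₀ ω ∂P₀ = 0) (hvar : 0 < Var[W₀; P₀]) (hn : 1 ≤ n) :
    P.real {ω | ¬ |sampleMean fun i => W i ω| ≤ √Var[W₀; P₀] * √(Real.log n / n)}
      ≤ 2 / √(n : ℝ) + 2 * (c * (∫ ω, |W₀ ω| ^ 3 ∂P₀) / √Var[W₀; P₀] ^ 3) / √(n : ℝ) := by
  set σ := √Var[W₀; P₀]
  have hσ : 0 < σ := Real.sqrt_pos.2 hvar
  have hn0 : (0 : ℝ) < n := by exact_mod_cast hn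
  have hL : 0 ≤ Real.log n := Real.log_nonneg (by exact_mod_cast hn)
  set a := √(Real.log n)
  -- The level `√(log n)` is the one at which the Gaussian tail bound equals `1/√n`.
  have hexp : Real.exp (-a ^ 2 / 2) = 1 / √(n : ℝ) := by
    rw [Real.sq_sqrt hL, Real.sqrt_eq_rpow, Real.rpow_def_of_pos hn0, one_div, ← Real.exp_neg]
    congr 1; ring
  set T : Ω → ℝ := fun ω => √(n : ℝ) * (sampleMean fun i => W i ω) / σ with hT
  have hTm : AEMeasurable T P := (h.aemeasurable_sampleMean.const_mul _).div_const _
  set b := c * (∫ ω, |W₀ ω| ^ 3 ∂P₀) / (σ ^ 3 * √(n : ℝ)) with hb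
  have h1 := h.berryEsseen hc h3 hmean hvar hn a
  have h2 := h.berryEsseen hc h3 hmean hvar hn (-a)
  obtain ⟨t1, t2⟩ := gaussian_tail_le (Real.sqrt_nonneg (Real.log n))
  rw [hexp] at t1 t2
  have hsub : {ω | ¬ |sampleMean fun i => W i ω| ≤ σ * √(Real.log n / n)}
      ⊆ {ω | T ω ≤ a}ᶜ ∪ {ω | T ω ≤ -a} := by
    intro ω hω
    simp only [Set.mem_ofPred_eq, not_le] at hω
    have key : a < |T ω| := by
      have hsn : 0 < √(n : ℝ) := Real.sqrt_pos.2 hn0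
      rw [hT, abs_div, abs_mul, abs_of_pos hσ, abs_of_pos hsn, lt_div_iff₀ hσ]
      calc a * σ = √(n : ℝ) * (σ * √(Real.log n / n)) := by
            rw [Real.sqrt_div hL]; field_simp; rfl
        _ < _ := by gcongr
    rcases lt_abs.1 key with h | h
    · exact Or.inl (not_le.2 h)
    · exact Or.inr (by simp only [Set.mem_ofPred_eq]; linarith)
  have hcompl : P.real {ω | T ω ≤ a}ᶜ = 1 - P.real {ω | T ω ≤ a} :=
    probReal_compl_eq_one_sub₀ (nullMeasurableSet_le hTm aemeasurable_const)
  calc _ ≤ P.real ({ω | T ω ≤ a}ᶜ ∪ {ω | T ω ≤ -a}) := measureReal_mono hsub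
    _ ≤ P.real {ω | T ω ≤ a}ᶜ + P.real {ω | T ω ≤ -a} := measureReal_union_le _ _
    _ ≤ (1 / √(n : ℝ) + b) + (1 / √(n : ℝ) + b) := by
      rw [hcompl]
      have := (abs_le.1 h1).1
      have := (abs_le.1 h2).2
      gcongr <;> linarith
    _ = _ := by rw [hb]; ring

end Gaussian

section Chebyshev
variable [IsProbabilityMeasure P] [IsProbabilityMeasure P₀]
variable {W : Fin n → Ω → ℝ} {W₀ : Ω₀ → ℝ}

lemma IsIIDCopies.chebyshev (h : IsIIDCopies P P₀ W W₀) (h2 : MemLp W₀ 2 P₀) (hn : 1 ≤ n)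
    {η : ℝ} (hη : 0 < η) :
    P.real {ω | ¬ |(sampleMean fun i => W i ω) - ∫ ω, W₀ ω ∂P₀| ≤ η}
      ≤ (∫ ω, W₀ ω ^ 2 ∂P₀) / (n * η ^ 2) := by
  have hn0 : (0 : ℝ) < n := by exact_mod_cast hn
  have hmem : ∀ i, MemLp (W i) 2 P := fun i => (h.ident i).memLp_iff.2 h2
  set S : Ω → ℝ := ∑ i, W i with hS
  have hSm : MemLp S 2 P := memLp_finsetSum' _ fun i _ => hmem i
  have hES : ∫ ω, S ω ∂P = n * ∫ ω, W₀ ω ∂P₀ := by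
    simp only [hS, Finset.sum_apply]
    rw [integral_finsetSum _ fun i _ => (hmem i).integrable (by norm_num)]
    simp [(h.ident _).integral_eq]
  have hVS : Var[S; P] ≤ n * ∫ ω, W₀ ω ^ 2 ∂P₀ := by
    rw [hS, IndepFun.variance_sum (fun i _ => hmem i) fun i _ j _ hij => h.indep.indepFun hij]
    simp only [(h.ident _).variance_eq, Finset.sum_const, Finset.card_univ, Fintype.card_fin,
      nsmul_eq_mul]
    gcongr
    exact variance_le_expectation_sq h2.1
  have hch := meas_ge_le_variance_div_sq hSm (c := n * η) (by positivity)
  have hset : {ω | ¬ |(sampleMean fun i => W i ω) - ∫ ω, W₀ ω ∂P₀| ≤ η}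
      ⊆ {ω | n * η ≤ |S ω - ∫ ω, S ω ∂P|} := by
    intro ω hω
    simp only [Set.mem_ofPred_eq, not_le] at hω ⊢
    have e : S ω - ∫ ω, S ω ∂P = n * ((sampleMean fun i => W i ω) - ∫ ω, W₀ ω ∂P₀) := by
      rw [hES, hS, Finset.sum_apply, sampleMean]; field_simp
    rw [e, abs_mul, abs_of_pos hn0]
    gcongr
  calc _ ≤ P.real {ω | n * η ≤ |S ω - ∫ ω, S ω ∂P|} := measureReal_mono hset
    _ ≤ Var[S; P] / (n * η) ^ 2 :=
      ENNReal.toReal_le_of_le_ofReal (div_nonneg (variance_nonneg _ _) (by positivity)) hch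
    _ ≤ (n * ∫ ω, W₀ ω ^ 2 ∂P₀) / (n * η) ^ 2 := by gcongr
    _ = _ := by field_simp

/-- Chebyshev gives `q²` for the present bound `q`, and a probability that is at most `min(1, q²)`
is at most `q`. This trades the rate `1/n` for a constant linear in the `L²` norm, as in `H₂`. -/
lemma IsIIDCopies.chebyshev_sqrt (h : IsIIDCopies P P₀ W W₀) (h2 : MemLp W₀ 2 P₀) (hn : 1 ≤ n)
    {η : ℝ} (hη : 0 < η) :
    P.real {ω | ¬ |(sampleMean fun i => W i ω) - ∫ ω, W₀ ω ∂P₀| ≤ η}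
      ≤ √(∫ ω, W₀ ω ^ 2 ∂P₀) / η / √(n : ℝ) := by
  have hn0 : (0 : ℝ) < n := by exact_mod_cast hn
  have h0 : 0 ≤ ∫ ω, W₀ ω ^ 2 ∂P₀ := integral_nonneg fun ω => sq_nonneg _
  set q := √(∫ ω, W₀ ω ^ 2 ∂P₀) / η / √(n : ℝ) with hq
  have hq2 : q ^ 2 = (∫ ω, W₀ ω ^ 2 ∂P₀) / (n * η ^ 2) := by
    rw [hq, div_pow, div_pow, Real.sq_sqrt h0, Real.sq_sqrt hn0.le]
    field_simp
  have hq0 : 0 ≤ q := by positivity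
  rcases le_total 1 q with h1 | h1
  · exact measureReal_le_one.trans h1
  · refine (h.chebyshev h2 hn hη).trans ?_
    rw [← hq2]; nlinarith

/-- A sample mean of nonnegative variables with a moment of order `3/2` is at most twice the
expectation, with high probability. -/
lemma IsIIDCopies.mean_le_two_mul (h : IsIIDCopies P P₀ W W₀) (hW0 : ∀ ω, 0 ≤ W₀ ω)
    (hi : Integrable W₀ P₀) (h32 : Integrable (fun ω => W₀ ω ^ (3 / 2 : ℝ)) P₀)
    (hpos : 0 < ∫ ω, W₀ ω ∂P₀) (hn : 1 ≤ n) :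
    P.real {ω | ¬ (sampleMean fun i => W i ω) ≤ 2 * ∫ ω, W₀ ω ∂P₀}
      ≤ 2 * ((∫ ω, W₀ ω ^ (3 / 2 : ℝ) ∂P₀) / (∫ ω, W₀ ω ∂P₀) ^ (3 / 2 : ℝ)) / √(n : ℝ) := by
  have hn0 : (0 : ℝ) < n := by exact_mod_cast hn
  set m := ∫ ω, W₀ ω ∂P₀
  -- Truncation at `b = n m`. Some copy exceeds `b` with probability at most `n R / b^(3/2)`, and
  -- the truncated copies have second moment at most `b^(1/2) R`. At this level both contributions
  -- equal `R / m^(3/2) / √n`.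
  set R := ∫ ω, W₀ ω ^ (3 / 2 : ℝ) ∂P₀
  set b := n * m with hb
  have hb0 : 0 < b := by positivity
  set g : ℝ → ℝ := fun z => if z ≤ b then z else 0 with hg
  have hgm : Measurable g := Measurable.ite measurableSet_Iic measurable_id measurable_const
  have hV := h.comp hgm
  have hgb : ∀ ω, 0 ≤ g (W₀ ω) ∧ g (W₀ ω) ≤ W₀ ω ∧
      g (W₀ ω) ^ 2 ≤ b ^ (1 / 2 : ℝ) * W₀ ω ^ (3 / 2 : ℝ) := by
    intro ω
    have h0 := hW0 ω
    simp only [hg]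
    split_ifs with hle
    · refine ⟨h0, le_rfl, ?_⟩
      calc W₀ ω ^ 2 = W₀ ω ^ (1 / 2 : ℝ) * W₀ ω ^ (3 / 2 : ℝ) := by
            rw [← Real.rpow_add_of_nonneg h0 (by norm_num) (by norm_num), ← Real.rpow_natCast]
            norm_num
        _ ≤ _ := by gcongr
    · exact ⟨le_rfl, h0, by rw [zero_pow two_ne_zero]; positivity⟩
  have hWm := hi.1.aemeasurable
  have hgW : AEMeasurable (fun ω => g (W₀ ω)) P₀ := hgm.comp_aemeasurable hWm
  have hVint : Integrable (fun ω => g (W₀ ω)) P₀ :=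
    hi.mono' hgW.aestronglyMeasurable
      (Filter.Eventually.of_forall fun ω => by
        rw [Real.norm_of_nonneg (hgb ω).1]; exact (hgb ω).2.1)
  have hV2 : MemLp (fun ω => g (W₀ ω)) 2 P₀ := by
    rw [memLp_two_iff_integrable_sq hgW.aestronglyMeasurable]
    refine (h32.const_mul (b ^ (1 / 2 : ℝ))).mono'
      (hgW.pow_const 2).aestronglyMeasurable
      (Filter.Eventually.of_forall fun ω => ?_)
    rw [Real.norm_of_nonneg (sq_nonneg _)]
    exact (hgb ω).2.2
  have hEV : ∫ ω, g (W₀ ω) ∂P₀ ≤ m := integral_mono hVint hi fun ω => (hgb ω).2.1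
  have hEV2 : ∫ ω, g (W₀ ω) ^ 2 ∂P₀ ≤ b ^ (1 / 2 : ℝ) * R := by
    rw [← integral_const_mul]
    exact integral_mono hV2.integrable_sq (h32.const_mul _) fun ω => (hgb ω).2.2
  have hsub : {ω | ¬ (sampleMean fun i => W i ω) ≤ 2 * m}
      ⊆ (⋃ i, {ω | b < W i ω}) ∪
        {ω | ¬ |(sampleMean fun i => g (W i ω)) - ∫ ω, g (W₀ ω) ∂P₀| ≤ m} := by
    intro ω hω
    by_cases hex : ∃ i, b < W i ω
    · exact Or.inl (Set.mem_iUnion.2 hex)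
    · push Not at hex
      refine Or.inr ?_
      have e : (sampleMean fun i => g (W i ω)) = sampleMean fun i => W i ω := by
        congr 1 with i
        exact if_pos (hex i)
      simp only [Set.mem_ofPred_eq, not_le, e] at hω ⊢
      refine lt_of_lt_of_le ?_ (le_abs_self _)
      linarith
  have hU : P.real (⋃ i, {ω | b < W i ω}) ≤ n * (R / b ^ (3 / 2 : ℝ)) := by
    refine (measureReal_iUnion_fintype_le _).trans ?_
    calc ∑ i, P.real {ω | b < W i ω} ≤ ∑ i : Fin n, R / b ^ (3 / 2 : ℝ) := by
          refine Finset.sum_le_sum fun i _ => ?_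
          have h1 : P.real {ω | b < W i ω} = P₀.real {ω | b < W₀ ω} := by
            simp only [measureReal_def]
            congr 1
            exact (h.ident i).measure_mem_eq measurableSet_Ioi
          rw [h1, le_div_iff₀ (by positivity), mul_comm]
          refine le_trans ?_ (mul_meas_ge_le_integral_of_nonneg (Filter.Eventually.of_forall
            fun ω => Real.rpow_nonneg (hW0 ω) _) h32 (b ^ (3 / 2 : ℝ)))
          gcongr
          · exact measure_ne_top _ _
          · rename_i ω
            intro hω
            exact Real.rpow_le_rpow hb0.le (le_of_lt hω) (by norm_num)
      _ = _ := by simp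
  have hC := hV.chebyshev hV2 hn hpos
  have hR0 : 0 ≤ R := integral_nonneg fun ω => Real.rpow_nonneg (hW0 ω) _
  have e1 : n * (R / b ^ (3 / 2 : ℝ)) = R / m ^ (3 / 2 : ℝ) / √(n : ℝ) := by
    rw [hb, Real.mul_rpow hn0.le hpos.le, Real.sqrt_eq_rpow]
    have : (n : ℝ) ^ (3 / 2 : ℝ) = n * (n : ℝ) ^ (1 / 2 : ℝ) := by
      rw [show (3 / 2 : ℝ) = 1 + 1 / 2 by norm_num, Real.rpow_add hn0, Real.rpow_one]
    rw [this]
    field_simp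
  have e2 : b ^ (1 / 2 : ℝ) * R / (n * m ^ 2) = R / m ^ (3 / 2 : ℝ) / √(n : ℝ) := by
    rw [hb, Real.mul_rpow hn0.le hpos.le, Real.sqrt_eq_rpow]
    have h1 : (n : ℝ) = (n : ℝ) ^ (1 / 2 : ℝ) * (n : ℝ) ^ (1 / 2 : ℝ) := by
      rw [← Real.rpow_add hn0]; norm_num
    have h2 : m ^ 2 = m ^ (1 / 2 : ℝ) * m ^ (3 / 2 : ℝ) := by
      rw [← Real.rpow_add hpos, ← Real.rpow_natCast]; norm_num
    rw [h2]
    have hx : 0 < (n : ℝ) ^ (1 / 2 : ℝ) := by positivity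
    have hy : 0 < m ^ (1 / 2 : ℝ) := by positivity
    have hz : 0 < m ^ (3 / 2 : ℝ) := by positivity
    rw [div_div, div_eq_div_iff (by positivity) (by positivity)]
    calc _ = R * (m ^ (1 / 2 : ℝ) * m ^ (3 / 2 : ℝ))
          * ((n : ℝ) ^ (1 / 2 : ℝ) * (n : ℝ) ^ (1 / 2 : ℝ)) := by ring
      _ = _ := by rw [← h1]; ring
  calc _ ≤ P.real ((⋃ i, {ω | b < W i ω}) ∪
        {ω | ¬ |(sampleMean fun i => g (W i ω)) - ∫ ω, g (W₀ ω) ∂P₀| ≤ m}) := measureReal_mono hsub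
    _ ≤ _ := measureReal_union_le _ _
    _ ≤ n * (R / b ^ (3 / 2 : ℝ)) + b ^ (1 / 2 : ℝ) * R / (n * m ^ 2) :=
        add_le_add hU (hC.trans (by gcongr))
    _ = _ := by rw [e1, e2]; ring

end Chebyshev

end RobustSlope

/-! ### Normal approximation with constants given by moments -/

namespace RobustSlope

variable {Ω Ω₀ : Type*} [MeasurableSpace Ω] [MeasurableSpace Ω₀]
  {P : Measure Ω} {P₀ : Measure Ω₀} {n : ℕ}

lemma measureReal_union_le_add {A B : Set Ω} {a b : ℝ} (hA : P.real A ≤ a) (hB : P.real B ≤ b) :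
    P.real (A ∪ B) ≤ a + b :=
  (measureReal_union_le A B).trans (add_le_add hA hB)

lemma cdf_gaussianReal_one_sub_le {a b : ℝ} (hab : a ≤ b) :
    cdf (gaussianReal 0 1) b - cdf (gaussianReal 0 1) a ≤ (b - a) / √(2 * Real.pi) := by
  simpa using cdf_gaussianReal_sub_le one_ne_zero hab

/-- Transfer of a normal approximation to a close variable. -/
lemma abs_measureReal_sub_cdf_le_of_close [IsProbabilityMeasure P] {T U : Ω → ℝ} {B : Set Ω}
    {δ p b : ℝ} (hδ : 0 ≤ δ) (hB : P.real B ≤ p) (hTU : ∀ ω ∉ B, |T ω - U ω| ≤ δ)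
    (hU : ∀ z, |P.real {ω | U ω ≤ z} - cdf (gaussianReal 0 1) z| ≤ b) (z : ℝ) :
    |P.real {ω | T ω ≤ z} - cdf (gaussianReal 0 1) z| ≤ δ / √(2 * Real.pi) + (b + p) := by
  have h1 : P.real {ω | T ω ≤ z} ≤ P.real {ω | U ω ≤ z + δ} + p := by
    refine (measureReal_mono (s₂ := {ω | U ω ≤ z + δ} ∪ B) fun ω hω => ?_).trans
      (measureReal_union_le_add le_rfl hB)
    by_cases hb : ω ∈ B
    · exact Or.inr hb
    · have := (abs_le.1 (hTU ω hb)).1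
      simp only [Set.mem_ofPred_eq] at hω
      exact Or.inl (by simp only [Set.mem_ofPred_eq]; linarith)
  have h2 : P.real {ω | U ω ≤ z - δ} ≤ P.real {ω | T ω ≤ z} + p := by
    refine (measureReal_mono (s₂ := {ω | T ω ≤ z} ∪ B) fun ω hω => ?_).trans
      (measureReal_union_le_add le_rfl hB)
    by_cases hb : ω ∈ B
    · exact Or.inr hb
    · have := (abs_le.1 (hTU ω hb)).2
      simp only [Set.mem_ofPred_eq] at hω
      exact Or.inl (by simp only [Set.mem_ofPred_eq]; linarith)
  have h3 := cdf_gaussianReal_one_sub_le (show z ≤ z + δ by linarith)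
  have h4 := cdf_gaussianReal_one_sub_le (show z - δ ≤ z by linarith)
  have h5 := abs_le.1 (hU (z + δ))
  have h6 := abs_le.1 (hU (z - δ))
  rw [add_sub_cancel_left] at h3
  rw [sub_sub_cancel] at h4
  rw [abs_le]
  constructor <;> linarith [h5.1, h5.2, h6.1, h6.2]

/-- The subtracted term is linear in `w - m`, so it integrates to zero when `m` is the mean of `w`.
Centering a nonnegative variable thus does not increase its third absolute moment. -/
lemma abs_sub_cube_le {w m : ℝ} (hw : 0 ≤ w) (hm : 0 ≤ m) :
    |w - m| ^ 3 ≤ w ^ 3 - m ^ 2 * (w - m) := by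
  rcases le_total m w with h | h
  · rw [abs_of_nonneg (by linarith)]
    nlinarith [mul_nonneg hm (sq_nonneg (w - m)), mul_nonneg (sq_nonneg m) (sub_nonneg.2 h),
      pow_nonneg hm 3]
  · rw [abs_of_nonpos (by linarith)]
    have : w ^ 3 - m ^ 2 * (w - m) - (-(w - m)) ^ 3
        = w * (2 * (w - 3 / 4 * m) ^ 2 + 7 / 8 * m ^ 2) := by ring
    have : 0 ≤ w * (2 * (w - 3 / 4 * m) ^ 2 + 7 / 8 * m ^ 2) := by positivity
    linarith

lemma integral_abs_sub_mean_cube_le [IsProbabilityMeasure P₀] {w : Ω₀ → ℝ} (hw : ∀ ω, 0 ≤ w ω)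
    (h3 : MemLp w 3 P₀) :
    ∫ ω, |w ω - ∫ ω', w ω' ∂P₀| ^ 3 ∂P₀ ≤ ∫ ω, w ω ^ 3 ∂P₀ := by
  set m := ∫ ω', w ω' ∂P₀
  have hi : Integrable w P₀ := h3.integrable (by norm_num)
  have hi3 : Integrable (fun ω => w ω ^ 3) P₀ := by
    refine (h3.integrable_norm_pow (by norm_num)).congr (Filter.Eventually.of_forall fun ω => ?_)
    simp [abs_of_nonneg (hw ω)]
  have hil : Integrable (fun ω => m ^ 2 * (w ω - m)) P₀ :=
    (hi.sub (integrable_const m)).const_mul _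
  have hc : Integrable (fun ω => |w ω - m| ^ 3) P₀ :=
    (h3.sub (memLp_const m)).integrable_norm_pow (by norm_num)
  calc _ ≤ ∫ ω, (w ω ^ 3 - m ^ 2 * (w ω - m)) ∂P₀ :=
        integral_mono hc (hi3.sub hil) fun ω => abs_sub_cube_le (hw ω) (integral_nonneg hw)
    _ = _ := by
        rw [integral_sub hi3 hil, integral_const_mul, integral_sub hi (integrable_const m)]
        simp [m]

lemma memLp_pow_of_memLp [IsFiniteMeasure P₀] {f : Ω₀ → ℝ} {p q : ℝ≥0∞} (hf : MemLp f p P₀)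
    {k : ℕ} (hk : 0 < k) (hpq : k * q = p) : MemLp (fun ω => f ω ^ k) q P₀ := by
  have hk0 : (k : ℝ≥0∞) ≠ 0 := by exact_mod_cast hk.ne'
  have h := hf.norm_rpow_div (k : ℝ≥0∞)
  have hq : p / k = q := by
    rw [← hpq, mul_comm]; exact ENNReal.mul_div_cancel_right hk0 (ENNReal.natCast_ne_top k)
  rw [hq] at h
  refine (memLp_congr_norm (hf.1.pow k) h.1 (Filter.Eventually.of_forall fun ω => ?_)).2 h
  simp

lemma error_terms_le {D k b s R u₁ u₂ u₃ u₄ w₁ w₂ w₃ w₄ w₅ w₆ w₇ sX sY : ℝ}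
    (hR : 0 ≤ R) (h : u₄ ≤ w₄) :
    D + (k * b / (s ^ 3 * R) + (2 / R + 2 * u₁ / R + (2 / R + 2 * u₂ / R)
        + (2 / R + 2 * (k * b / s ^ 3) / R) + (2 / R + 2 * u₄ / R) + w₁ / R + w₂ / R + w₃ / R
        + 2 * w₅ / R + 2 * w₆ / R + w₇ / (sX ^ 2 / 8) / R + u₃ / (sY ^ 2 / 8) / R))
      ≤ D + (8 + 2 * u₁ + 2 * u₂ + 3 * (k * b / s ^ 3) + 2 * w₄ + w₁ + w₂ + w₃ + 2 * w₅ + 2 * w₆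
        + 8 * (w₇ / sX ^ 2) + 8 * (u₃ / sY ^ 2)) / R := by
  have h1 : 2 * u₄ / R ≤ 2 * w₄ / R := by gcongr
  refine le_of_sub_nonneg ((sub_nonneg.2 h1).trans (le_of_eq ?_))
  ring

/-- Normal approximation of the studentized statistic, with the constants given by moments. -/
theorem abs_measureReal_studentized_sub_le [IsProbabilityMeasure P] [IsProbabilityMeasure P₀]
    {xs ys : Fin n → Ω → ℝ} {x y : Ω₀ → ℝ} {c : ℝ≥0} {t M mX mY : ℝ}
    (hc : IsBerryEsseenConstant c)
    (h : IsIIDCopies P P₀ (fun i ω => (xs i ω, ys i ω)) (fun ω => (x ω + mX, y ω + mY)))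
    (hn : 1 ≤ n) (hx6 : MemLp x 6 P₀) (hy4 : MemLp y 4 P₀)
    (hxe : MemLp (fun ω => x ω * (y ω - t * x ω)) 6 P₀)
    (h21 : MemLp (fun ω => |x ω| ^ 2 * |y ω|) 2 P₀) (h12 : MemLp (fun ω => |x ω| * |y ω| ^ 2) 2 P₀)
    (i31 : Integrable (fun ω => |x ω| ^ 3 * |y ω|) P₀)
    (h31 : Integrable (fun ω => (|x ω| ^ 3 * |y ω|) ^ (3 / 2 : ℝ)) P₀)
    (hmx : ∫ ω, x ω ∂P₀ = 0) (hme : ∫ ω, (y ω - t * x ω) ∂P₀ = 0)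
    (hmxe : ∫ ω, x ω * (y ω - t * x ω) ∂P₀ = 0)
    (hE : 0 < ∫ ω, (y ω - t * x ω) ^ 2 ∂P₀)
    (hV : 0 < Var[fun ω => (x ω * (y ω - t * x ω)) ^ 2; P₀])
    (p21 : 0 < ∫ ω, |x ω| ^ 2 * |y ω| ∂P₀) (p12 : 0 < ∫ ω, |x ω| * |y ω| ^ 2 ∂P₀)
    (p31 : 0 < ∫ ω, |x ω| ^ 3 * |y ω| ∂P₀)
    (hM : MomentBounds (√(∫ ω, x ω ^ 2 ∂P₀)) (√(∫ ω, y ω ^ 2 ∂P₀))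
      (√(∫ ω, (y ω - t * x ω) ^ 2 ∂P₀)) (√(∫ ω, (x ω * (y ω - t * x ω)) ^ 2 ∂P₀)) t M
      (√(Real.log n / n)) (∫ ω, |x ω| ^ 2 * |y ω| ∂P₀) (∫ ω, |x ω| ^ 3 ∂P₀)
      (∫ ω, |x ω| * |y ω| ^ 2 ∂P₀) (∫ ω, |x ω| ^ 3 * |y ω| ∂P₀) (∫ ω, |x ω| ^ 4 ∂P₀)
      (√(∫ ω, (x ω * (y ω - t * x ω)) ^ 4 ∂P₀))) (z : ℝ) :
    |P.real {ω | studentized t (fun i => xs i ω) (fun i => ys i ω) ≤ z}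
        - cdf (gaussianReal 0 1) z|
      ≤ Real.log n / √(n : ℝ) * (3 * (√(∫ ω, x ω ^ 2 ∂P₀) * √(∫ ω, (y ω - t * x ω) ^ 2 ∂P₀)) /
          √(∫ ω, (x ω * (y ω - t * x ω)) ^ 2 ∂P₀) + M) / √(2 * Real.pi)
        + (8 + 2 * (c * (∫ ω, |x ω| ^ 3 ∂P₀) / √(∫ ω, x ω ^ 2 ∂P₀) ^ 3)
          + 2 * (c * (∫ ω, |y ω - t * x ω| ^ 3 ∂P₀) / √(∫ ω, (y ω - t * x ω) ^ 2 ∂P₀) ^ 3)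
          + 3 * (c * (∫ ω, |x ω * (y ω - t * x ω)| ^ 3 ∂P₀) /
              √(∫ ω, (x ω * (y ω - t * x ω)) ^ 2 ∂P₀) ^ 3)
          + 2 * (c * (∫ ω, (x ω * (y ω - t * x ω)) ^ 6 ∂P₀) /
              √Var[fun ω => (x ω * (y ω - t * x ω)) ^ 2; P₀] ^ 3)
          + √(∫ ω, (|x ω| ^ 2 * |y ω|) ^ 2 ∂P₀) / (∫ ω, |x ω| ^ 2 * |y ω| ∂P₀)
          + √(∫ ω, (|x ω| ^ 3) ^ 2 ∂P₀) / (∫ ω, |x ω| ^ 3 ∂P₀)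
          + √(∫ ω, (|x ω| * |y ω| ^ 2) ^ 2 ∂P₀) / (∫ ω, |x ω| * |y ω| ^ 2 ∂P₀)
          + 2 * ((∫ ω, (|x ω| ^ 3 * |y ω|) ^ (3 / 2 : ℝ) ∂P₀) /
              (∫ ω, |x ω| ^ 3 * |y ω| ∂P₀) ^ (3 / 2 : ℝ))
          + 2 * ((∫ ω, (|x ω| ^ 4) ^ (3 / 2 : ℝ) ∂P₀) / (∫ ω, |x ω| ^ 4 ∂P₀) ^ (3 / 2 : ℝ))
          + 8 * (√(∫ ω, (|x ω| ^ 2) ^ 2 ∂P₀) / √(∫ ω, x ω ^ 2 ∂P₀) ^ 2)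
          + 8 * (√(∫ ω, (|y ω| ^ 2) ^ 2 ∂P₀) / √(∫ ω, y ω ^ 2 ∂P₀) ^ 2)) / √(n : ℝ) := by
  have hn0 : (0 : ℝ) < n := by exact_mod_cast hn
  have hL : 0 ≤ Real.log n := Real.log_nonneg (by exact_mod_cast hn)
  set e : Ω₀ → ℝ := fun ω => y ω - t * x ω with he
  set r := √(Real.log n / n) with hr
  -- integrability
  have hx4 : MemLp x 4 P₀ := hx6.mono_exponent (by norm_num)
  have hx3 : MemLp x 3 P₀ := hx6.mono_exponent (by norm_num)
  have hx2 : MemLp x 2 P₀ := hx6.mono_exponent (by norm_num)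
  have he3 : MemLp e 3 P₀ := (hy4.mono_exponent (by norm_num)).sub (hx3.const_mul t)
  have he2 : MemLp e 2 P₀ := he3.mono_exponent (by norm_num)
  have hxe3 : MemLp (fun ω => x ω * e ω) 3 P₀ := hxe.mono_exponent (by norm_num)
  have hxe2 : MemLp (fun ω => x ω * e ω) 2 P₀ := hxe.mono_exponent (by norm_num)
  have hxx3 : MemLp (fun ω => (x ω * e ω) ^ 2) 3 P₀ :=
    memLp_pow_of_memLp hxe two_pos (by norm_num)
  have hxx2 : MemLp (fun ω => (x ω * e ω) ^ 2) 2 P₀ := hxx3.mono_exponent (by norm_num)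
  have hax2 : MemLp (fun ω => |x ω| ^ 2) 2 P₀ := memLp_pow_of_memLp hx4.abs two_pos (by norm_num)
  have hay2 : MemLp (fun ω => |y ω| ^ 2) 2 P₀ := memLp_pow_of_memLp hy4.abs two_pos (by norm_num)
  have hax3 : MemLp (fun ω => |x ω| ^ 3) 2 P₀ :=
    memLp_pow_of_memLp hx6.abs three_pos (by norm_num)
  have i40 : Integrable (fun ω => |x ω| ^ 4) P₀ := hx4.integrable_norm_pow (by norm_num)
  have i60 : Integrable (fun ω => (|x ω| ^ 4) ^ (3 / 2 : ℝ)) P₀ := by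
    refine (hx6.integrable_norm_pow (by norm_num)).congr (Filter.Eventually.of_forall fun ω => ?_)
    simp only [Real.norm_eq_abs]
    rw [← Real.rpow_natCast, ← Real.rpow_natCast, ← Real.rpow_mul (abs_nonneg _)]
    norm_num
  -- centered copies
  have hp : IsIIDCopies P P₀ (fun i ω => (xs i ω - mX, ys i ω - mY)) (fun ω => (x ω, y ω)) := by
    have := h.comp (g := fun p : ℝ × ℝ => (p.1 - mX, p.2 - mY)) (by fun_prop)
    simpa using this
  set xc : Fin n → Ω → ℝ := fun i ω => xs i ω - mX with hxc
  set yc : Fin n → Ω → ℝ := fun i ω => ys i ω - mY with hyc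
  have cp : ∀ g : ℝ × ℝ → ℝ, Measurable g →
      IsIIDCopies P P₀ (fun i ω => g (xc i ω, yc i ω)) (fun ω => g (x ω, y ω)) :=
    fun g hg => hp.comp hg
  have varx : Var[x; P₀] = ∫ ω, x ω ^ 2 ∂P₀ :=
    variance_of_integral_eq_zero hx2.1.aemeasurable hmx
  have vare : Var[e; P₀] = ∫ ω, e ω ^ 2 ∂P₀ :=
    variance_of_integral_eq_zero he2.1.aemeasurable hme
  have varxe : Var[fun ω => x ω * e ω; P₀] = ∫ ω, (x ω * e ω) ^ 2 ∂P₀ :=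
    variance_of_integral_eq_zero hxe2.1.aemeasurable hmxe
  have hsX := hM.sX_pos
  have hsY := hM.sY_pos
  have hs := hM.s_pos
  set sX := √(∫ ω, x ω ^ 2 ∂P₀) with hsXdef
  set sY := √(∫ ω, y ω ^ 2 ∂P₀) with hsYdef
  set sE := √(∫ ω, e ω ^ 2 ∂P₀) with hsEdef
  set s := √(∫ ω, (x ω * e ω) ^ 2 ∂P₀) with hsdef
  have sXsq : sX ^ 2 = ∫ ω, x ω ^ 2 ∂P₀ := Real.sq_sqrt (Real.sqrt_pos.1 hsX).le
  have sYsq : sY ^ 2 = ∫ ω, y ω ^ 2 ∂P₀ := Real.sq_sqrt (Real.sqrt_pos.1 hsY).le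
  have ssq : s ^ 2 = ∫ ω, (x ω * e ω) ^ 2 ∂P₀ := Real.sq_sqrt (Real.sqrt_pos.1 hs).le
  have p30 : 0 < ∫ ω, |x ω| ^ 3 ∂P₀ := lt_of_lt_of_le (by positivity) hM.cube_le
  have p40 : 0 < ∫ ω, |x ω| ^ 4 ∂P₀ := lt_of_lt_of_le (by positivity) hM.fourth_le
  -- the exceptional events
  have t1 := (cp Prod.fst measurable_fst).tail_le hc hx3 hmx
    (by rw [varx]; exact Real.sqrt_pos.1 hsX) hn
  have t2 := (cp (fun p => p.2 - t * p.1) (by fun_prop)).tail_le hc he3 hme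
    (by rw [vare]; exact hE) hn
  have t3 := (cp (fun p => p.1 * (p.2 - t * p.1)) (by fun_prop)).tail_le hc hxe3 hmxe
    (by rw [varxe]; exact Real.sqrt_pos.1 hs) hn
  set V := Var[fun ω => (x ω * e ω) ^ 2; P₀] with hVdef
  have varW : Var[fun ω => (x ω * e ω) ^ 2 - s ^ 2; P₀] = V := variance_sub_const hxx2.1 _
  have t4 := (cp (fun p => (p.1 * (p.2 - t * p.1)) ^ 2 - s ^ 2) (by fun_prop)).tail_le hc
    (hxx3.sub (memLp_const (s ^ 2)))
    (by
      simp only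
      rw [integral_sub (hxx2.integrable (by norm_num)) (integrable_const _), ← ssq]
      simp)
    (by rw [varW]; exact hV) hn
  rw [varx] at t1
  rw [vare] at t2
  rw [varxe] at t3
  rw [varW] at t4
  have t5 := (cp (fun p => |p.1| ^ 2 * |p.2|) (by fun_prop)).chebyshev_sqrt h21 hn p21
  have t6 := (cp (fun p => |p.1| ^ 3) (by fun_prop)).chebyshev_sqrt hax3 hn p30
  have t7 := (cp (fun p => |p.1| * |p.2| ^ 2) (by fun_prop)).chebyshev_sqrt h12 hn p12
  have t8 := (cp (fun p => |p.1| ^ 3 * |p.2|) (by fun_prop)).mean_le_two_mul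
    (fun ω => by positivity) i31 h31 p31 hn
  have t9 := (cp (fun p => |p.1| ^ 4) (by fun_prop)).mean_le_two_mul
    (fun ω => by positivity) i40 i60 p40 hn
  have t10 := (cp (fun p => |p.1| ^ 2) (by fun_prop)).chebyshev_sqrt hax2 hn
    (show 0 < sX ^ 2 / 8 by positivity)
  have t11 := (cp (fun p => |p.2| ^ 2) (by fun_prop)).chebyshev_sqrt hay2 hn
    (show 0 < sY ^ 2 / 8 by positivity)
  have hbad := measureReal_union_le_add (measureReal_union_le_add (measureReal_union_le_add
    (measureReal_union_le_add (measureReal_union_le_add (measureReal_union_le_add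
    (measureReal_union_le_add (measureReal_union_le_add (measureReal_union_le_add
    (measureReal_union_le_add t1 t2) t3) t4) t5) t6) t7) t8) t9) t10) t11
  have hBE := (cp (fun p => p.1 * (p.2 - t * p.1)) (by fun_prop)).berryEsseen hc hxe3 hmxe
    (by rw [varxe]; exact Real.sqrt_pos.1 hs) hn
  rw [varxe] at hBE
  -- The moment in the Berry–Esseen bound for `(x e)² - s²` is replaced by the sixth moment of `x e`
  -- that occurs in `H₂`.
  have hcubeW : ∫ ω, |(x ω * e ω) ^ 2 - s ^ 2| ^ 3 ∂P₀ ≤ ∫ ω, (x ω * e ω) ^ 6 ∂P₀ := by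
    rw [ssq]
    refine (integral_abs_sub_mean_cube_le (fun ω => sq_nonneg _) hxx3).trans (le_of_eq ?_)
    congr 1 with ω
    ring
  -- The deviation bound has threshold `√V r`, which is within the tolerance `√(E (x e)⁴) r` of
  -- `GoodSample`.
  have hVle : √V ≤ √(∫ ω, (x ω * e ω) ^ 4 ∂P₀) := by
    refine Real.sqrt_le_sqrt ((variance_le_expectation_sq hxx2.1).trans (le_of_eq ?_))
    congr 1 with ω
    simp only [Pi.pow_apply]
    ring
  have hδ : √(n : ℝ) * r ^ 2 * (3 * (sX * sE) / s + M)
      = Real.log n / √(n : ℝ) * (3 * (sX * sE) / s + M) := by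
    rw [hr, Real.sq_sqrt (by positivity)]
    congr 1
    rw [eq_div_iff (Real.sqrt_pos.2 hn0).ne', mul_right_comm, Real.mul_self_sqrt hn0.le]
    field_simp
  have hδ0 : 0 ≤ √(n : ℝ) * r ^ 2 * (3 * (sX * sE) / s + M) := by
    have := hM.four_le
    positivity
  have hfin := abs_measureReal_sub_cdf_le_of_close hδ0 hbad
    (T := fun ω => studentized t (fun i => xs i ω) (fun i => ys i ω)) (fun ω hω => ?_) hBE z
  · rw [hδ] at hfin
    refine hfin.trans ?_
    refine error_terms_le (Real.sqrt_nonneg _) (div_le_div_of_nonneg_right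
      (mul_le_mul_of_nonneg_left hcubeW c.2) (by positivity))
  · simp only [Set.mem_union, not_or, Set.mem_ofPred_eq, not_not] at hω
    obtain ⟨⟨⟨⟨⟨⟨⟨⟨⟨⟨g1, g2⟩, g3⟩, g4⟩, g5⟩, g6⟩, g7⟩, g8⟩, g9⟩, g10⟩, g11⟩ := hω
    have g : GoodSample (fun i => xc i ω) (fun i => yc i ω) sX sY sE s t r
        (∫ ω, |x ω| ^ 2 * |y ω| ∂P₀) (∫ ω, |x ω| ^ 3 ∂P₀)
        (∫ ω, |x ω| * |y ω| ^ 2 ∂P₀) (∫ ω, |x ω| ^ 3 * |y ω| ∂P₀) (∫ ω, |x ω| ^ 4 ∂P₀)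
        (√(∫ ω, (x ω * e ω) ^ 4 ∂P₀)) := by
      have a10 : ∫ ω, |x ω| ^ 2 ∂P₀ = sX ^ 2 := by simp only [sq_abs, sXsq]
      have a11 : ∫ ω, |y ω| ^ 2 ∂P₀ = sY ^ 2 := by simp only [sq_abs, sYsq]
      rw [a10] at g10
      rw [a11] at g11
      rw [sampleMean_sub, sampleMean_const hn] at g4
      refine ⟨g1, g2, g3, g4.trans (by gcongr), ?_, ?_, ?_, g8, g9, ?_, ?_, ?_⟩
      · linarith [(abs_le.1 g5).2]
      · linarith [(abs_le.1 g6).2]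
      · linarith [(abs_le.1 g7).2]
      · linarith [(abs_le.1 g10).1]
      · linarith [(abs_le.1 g10).2]
      · linarith [(abs_le.1 g11).2]
    exact g.abs_studentized_sub_le hM hn (a := mX) (b := mY) (fun i => by simp [hxc])
      (fun i => by simp [hyc])

end RobustSlope

/-! ### Population moments, the slope and the error -/

namespace RobustSlope

section Population
variable {Ω : Type*} [MeasurableSpace Ω] {μ : Measure Ω} {f : Ω → ℝ}

lemma eLpNorm_toReal_rpow {p : ℝ≥0∞} (hp0 : p ≠ 0) (hpt : p ≠ ∞) (hf : MemLp f p μ) :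
    (eLpNorm f p μ).toReal ^ p.toReal = ∫ ω, |f ω| ^ p.toReal ∂μ := by
  rw [hf.eLpNorm_eq_integral_rpow_norm hp0 hpt]
  have h0 : 0 ≤ ∫ ω, ‖f ω‖ ^ p.toReal ∂μ := integral_nonneg fun ω => by positivity
  rw [ENNReal.toReal_ofReal (by positivity), ← Real.rpow_mul h0,
    inv_mul_cancel₀ (ENNReal.toReal_ne_zero.2 ⟨hp0, hpt⟩), Real.rpow_one]
  simp

lemma eLpNorm_toReal_pow {p : ℝ≥0∞} {k : ℕ} (hp : p = k) (hk : k ≠ 0) (hf : MemLp f p μ) :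
    (eLpNorm f p μ).toReal ^ k = ∫ ω, |f ω| ^ k ∂μ := by
  subst hp
  have := eLpNorm_toReal_rpow (by exact_mod_cast hk) (ENNReal.natCast_ne_top k) hf
  simpa using this

lemma eLpNorm_one_toReal (hf : MemLp f 1 μ) : (eLpNorm f 1 μ).toReal = ∫ ω, |f ω| ∂μ := by
  simpa using eLpNorm_toReal_pow (k := 1) (by simp) one_ne_zero hf

lemma eLpNorm_two_toReal (hf : MemLp f 2 μ) : (eLpNorm f 2 μ).toReal = √(∫ ω, f ω ^ 2 ∂μ) := by
  have := eLpNorm_toReal_pow (k := 2) (by simp) two_ne_zero hf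
  simp only [sq_abs] at this
  rw [← this, Real.sqrt_sq ENNReal.toReal_nonneg]

lemma eLpNorm_ne_zero_of_not_ae_zero {p : ℝ≥0∞} (hf : AEStronglyMeasurable f μ) (hp : p ≠ 0)
    (h : ¬ f =ᵐ[μ] 0) : eLpNorm f p μ ≠ 0 :=
  fun h0 => h ((eLpNorm_eq_zero_iff hf hp).1 h0)

variable {X Y : Ω → ℝ}

lemma variance_eq_integral_centered (hX : AEMeasurable X μ) :
    Var[X; μ] = ∫ ω, centered μ X ω ^ 2 ∂μ := variance_eq_integral hX

lemma integral_centered_mul_centered :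
    ∫ ω, centered μ X ω * centered μ Y ω ∂μ = cov[Y, X; μ] := by
  rw [covariance]
  exact integral_congr_ae (Filter.Eventually.of_forall fun ω => mul_comm _ _)

/-- If the product of the centered variables vanishes, so does the product of the centered
regressor and the error. -/
lemma not_ae_zero_of_mul_err (h : ¬ centered μ X * err μ X Y =ᵐ[μ] 0) :
    ¬ centered μ X * centered μ Y =ᵐ[μ] 0 := by
  refine fun hxy => h ?_
  -- A vanishing product forces zero covariance, hence zero slope, and then the error is the
  -- centered response itself.
  have h1 : cov[Y, X; μ] = 0 := by
    rw [← integral_centered_mul_centered]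
    exact (integral_congr_ae hxy).trans (by simp)
  have h2 : slope μ X Y = 0 := by rw [slope, h1, zero_div]
  filter_upwards [hxy] with ω hω
  simpa [err, h2] using hω

variable [IsProbabilityMeasure μ]

lemma memLp_centered {p : ℝ≥0∞} (hX : MemLp X p μ) : MemLp (centered μ X) p μ :=
  hX.sub (memLp_const _)

lemma integral_centered (hX : Integrable X μ) : ∫ ω, centered μ X ω ∂μ = 0 := by
  simp only [centered]
  rw [integral_sub hX (integrable_const _)]
  simp

lemma memLp_err {p : ℝ≥0∞} (hX : MemLp X p μ) (hY : MemLp Y p μ) : MemLp (err μ X Y) p μ :=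
  (memLp_centered hY).sub ((memLp_centered hX).const_mul _)

lemma integral_err (hX : Integrable X μ) (hY : Integrable Y μ) : ∫ ω, err μ X Y ω ∂μ = 0 := by
  simp only [err]
  rw [integral_sub, integral_const_mul, integral_centered hX, integral_centered hY]
  · simp
  · exact hY.sub (integrable_const _)
  · exact (hX.sub (integrable_const _)).const_mul _

lemma integral_centered_mul_err (hX : MemLp X 2 μ) (hY : MemLp Y 2 μ) (h0 : Var[X; μ] ≠ 0) :
    ∫ ω, centered μ X ω * err μ X Y ω ∂μ = 0 := by
  have e : ∀ ω, centered μ X ω * err μ X Y ω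
      = centered μ X ω * centered μ Y ω - slope μ X Y * centered μ X ω ^ 2 := fun ω => by
    simp only [err]; ring
  simp only [e]
  have i1 : Integrable (fun ω => centered μ X ω * centered μ Y ω) μ :=
    (memLp_centered hX).integrable_mul (memLp_centered hY)
  rw [integral_sub i1 ((memLp_centered hX).integrable_sq.const_mul _), integral_const_mul,
    integral_centered_mul_centered, ← variance_eq_integral_centered hX.1.aemeasurable, slope]
  field_simp
  simp

lemma integral_err_sq (hX : MemLp X 2 μ) (hY : MemLp Y 2 μ) (h0 : Var[X; μ] ≠ 0) :
    ∫ ω, err μ X Y ω ^ 2 ∂μ = Var[Y; μ] - slope μ X Y ^ 2 * Var[X; μ] := by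
  have e : ∀ ω, err μ X Y ω ^ 2 = centered μ Y ω ^ 2
      - slope μ X Y ^ 2 * centered μ X ω ^ 2
      - 2 * slope μ X Y * (centered μ X ω * err μ X Y ω) := fun ω => by
    simp only [err]; ring
  simp only [e]
  have hx := memLp_centered hX
  have hy := memLp_centered hY
  have i1 : Integrable (fun ω => centered μ X ω * err μ X Y ω) μ :=
    hx.integrable_mul (memLp_err hX hY)
  have i2 : Integrable (fun ω => centered μ Y ω ^ 2 - slope μ X Y ^ 2 * centered μ X ω ^ 2) μ :=
    hy.integrable_sq.sub (hx.integrable_sq.const_mul _)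
  rw [integral_sub i2 (i1.const_mul _),
    integral_sub hy.integrable_sq (hx.integrable_sq.const_mul _), integral_const_mul,
    integral_const_mul, integral_centered_mul_err hX hY h0,
    variance_eq_integral_centered hX.1.aemeasurable,
    variance_eq_integral_centered hY.1.aemeasurable]
  ring

lemma variance_err (hX : MemLp X 2 μ) (hY : MemLp Y 2 μ) :
    Var[err μ X Y; μ] = ∫ ω, err μ X Y ω ^ 2 ∂μ :=
  variance_of_integral_eq_zero (memLp_err hX hY).1.aemeasurable
    (integral_err (hX.integrable (by norm_num)) (hY.integrable (by norm_num)))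

lemma sqrt_variance_err_le (hX : MemLp X 2 μ) (hY : MemLp Y 2 μ) (h0 : Var[X; μ] ≠ 0) :
    √Var[err μ X Y; μ] ≤ √Var[Y; μ] := by
  rw [variance_err hX hY, integral_err_sq hX hY h0]
  refine Real.sqrt_le_sqrt ?_
  have := mul_nonneg (sq_nonneg (slope μ X Y)) (variance_nonneg X μ)
  linarith

lemma abs_slope_mul_sqrt_variance_le (hX : MemLp X 2 μ) (hY : MemLp Y 2 μ)
    (h0 : Var[X; μ] ≠ 0) : |slope μ X Y| * √Var[X; μ] ≤ √Var[Y; μ] := by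
  refine Real.le_sqrt_of_sq_le ?_
  rw [mul_pow, sq_abs, Real.sq_sqrt (variance_nonneg _ _)]
  have h1 := integral_err_sq hX hY h0
  have h2 : 0 ≤ ∫ ω, err μ X Y ω ^ 2 ∂μ := integral_nonneg fun ω => sq_nonneg _
  linarith

end Population

/-- A fair sign with `n = 1` has distribution function 1 at `x = 1`, while the Gaussian one is below
1 there. Positivity of the constant matters because `0 · ∞ = 0`: with `c = 0`, finiteness of `H₂`
would not show that `x e` has a sixth moment or that `Var(x² e²) > 0`. -/
lemma IsBerryEsseenConstant.ne_zero {c : ℝ≥0} (hc : IsBerryEsseenConstant c) : c ≠ 0 := by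
  rintro rfl
  set ν : Measure ℝ := (2⁻¹ : ℝ≥0∞) • Measure.dirac 1 + (2⁻¹ : ℝ≥0∞) • Measure.dirac (-1) with hν
  have hp : IsProbabilityMeasure ν := ⟨by simp [hν, ENNReal.inv_two_add_inv_two]⟩
  have hae : ∀ᵐ z ∂ν, ‖z‖ ≤ 1 := by
    rw [hν, ae_add_measure_iff]
    exact ⟨Measure.ae_smul_measure (by simp [ae_dirac_eq]) _,
      Measure.ae_smul_measure (by simp [ae_dirac_eq]) _⟩
  have hm : ∀ p, MemLp (fun z : ℝ => z) p ν := fun p =>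
    MemLp.of_bound aestronglyMeasurable_id 1 hae
  have hint : ∀ f : ℝ → ℝ, Measurable f → ∫ z, f z ∂ν = (f 1 + f (-1)) / 2 := fun f hf => by
    have hi : ∀ a : ℝ, Integrable f ((2⁻¹ : ℝ≥0∞) • Measure.dirac a) := fun a =>
      (integrable_dirac (by simp)).smul_measure (by simp)
    rw [hν, integral_add_measure (hi _) (hi _), integral_smul_measure, integral_smul_measure,
      integral_dirac, integral_dirac]
    simp; ring
  have hmean : ∫ z, z ∂ν = 0 := by rw [hint _ measurable_id']; norm_num
  have hv : Var[fun z : ℝ => z; ν] = 1 := by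
    rw [variance_of_integral_eq_zero aemeasurable_id' hmean, hint _ (by fun_prop)]; norm_num
  have h := hc ν (hm 3) hmean (by rw [hv]; exact one_pos) 1 le_rfl 1
  have h1 : (Measure.pi fun _ : Fin 1 => ν).real
      {z | √((1 : ℕ) : ℝ) * sampleMean z / √(Var[fun z : ℝ => z; ν]) ≤ 1} = 1 := by
    rw [measureReal_def, ENNReal.toReal_eq_one_iff]
    rw [← prob_compl_eq_zero_iff]
    · have := (measurePreserving_eval (fun _ : Fin 1 => ν) 0).quasiMeasurePreserving.ae
        (p := fun z => ‖z‖ ≤ 1) hae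
      refine measure_mono_null (fun z hz => ?_) this
      intro hz1
      apply hz
      simp only [hv, Set.mem_ofPred_eq]
      simpa [sampleMean] using (le_abs_self _).trans hz1
    · exact measurableSet_le ((measurable_sampleMean.const_mul _).div_const _) measurable_const
  rw [h1] at h
  have h2 : cdf (gaussianReal 0 1) 1 = 1 := by
    simp only [NNReal.coe_zero, zero_mul, zero_div, abs_nonpos_iff, sub_eq_zero] at h
    exact h.symm
  rw [cdf_eq_real, measureReal_def, ENNReal.toReal_eq_one_iff,
    ← prob_compl_eq_zero_iff measurableSet_Iic, Set.compl_Iic] at h2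
  have h3 := gaussianReal_absolutelyContinuous' 0 one_ne_zero h2
  simp at h3

section Ratios

lemma ne_top_of_div_ne_top {a b : ℝ≥0∞} (h : a / b ≠ ∞) (hb : b ≠ ∞) : a ≠ ∞ := by
  rintro rfl
  exact h (ENNReal.top_div_of_ne_top hb)

lemma ne_top_of_mul_ne_top {a b : ℝ≥0∞} (h : a * b ≠ ∞) (ha : a ≠ 0) : b ≠ ∞ := by
  rintro rfl
  exact h (ENNReal.mul_top ha)

/-- Each ratio in `K` becomes a real inequality with `M = 1/K`. Since `A / B * B ≤ A` also for `B =
0` and `B = ∞`, no condition on `B` appears. -/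
lemma four_mul_le_of_le_mul_div {k N A B : ℝ≥0∞} (h : k ≤ N / 4 * (A / B)) (hk0 : k ≠ 0)
    (hk : k ≠ ∞) (hN : N ≠ ∞) (hA : A ≠ ∞) :
    4 * B.toReal ≤ k.toReal⁻¹ * (N.toReal * A.toReal) := by
  have h1 : k * (4 * B) ≤ N * A :=
    calc k * (4 * B) ≤ N / 4 * (A / B) * (4 * B) := by gcongr
      _ = (N / 4 * 4) * (A / B * B) := by ring
      _ ≤ N * A := mul_le_mul' (ENNReal.mul_le_of_le_div le_rfl) (ENNReal.mul_le_of_le_div le_rfl)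
  have h2 := ENNReal.toReal_mono (ENNReal.mul_ne_top hN hA) h1
  simp only [ENNReal.toReal_mul, ENNReal.toReal_ofNat] at h2
  have h3 : 0 < k.toReal := ENNReal.toReal_pos hk0 hk
  rw [inv_mul_eq_div, le_div_iff₀ h3]
  linarith

end Ratios

end RobustSlope

/-! ### Selection of the needed ratios, and lower bounds on the sample size -/

namespace RobustSlope

section Domination
variable {Ω : Type*} [MeasurableSpace Ω] {μ : Measure Ω} {x y : Ω → ℝ}

lemma eLpNorm_sq_mul (p : ℝ≥0∞) :
    eLpNorm (x ^ 2 * y) p μ = eLpNorm (fun ω => |x ω| ^ 2 * |y ω|) p μ :=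
  eLpNorm_congr_norm_ae (Filter.Eventually.of_forall fun ω => by simp)

lemma eLpNorm_sq_mul' (p : ℝ≥0∞) :
    eLpNorm (y ^ 2 * x) p μ = eLpNorm (fun ω => |x ω| * |y ω| ^ 2) p μ :=
  eLpNorm_congr_norm_ae (Filter.Eventually.of_forall fun ω => by simp [mul_comm])

lemma eLpNorm_cube_mul (p : ℝ≥0∞) :
    eLpNorm (x ^ 3 * y) p μ = eLpNorm (fun ω => |x ω| ^ 3 * |y ω|) p μ :=
  eLpNorm_congr_norm_ae (Filter.Eventually.of_forall fun ω => by simp)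

lemma integrable_sq_mul (hx : MemLp x 4 μ) (hy : MemLp y 2 μ) :
    Integrable (fun ω => |x ω| ^ 2 * |y ω|) μ := by
  have h1 := hx.integrable_norm_pow (p := 4) (by norm_num)
  refine (h1.add hy.integrable_sq).mono' (((hx.1.norm.pow 2).mul hy.1.norm))
    (Filter.Eventually.of_forall fun ω => ?_)
  simp only [Real.norm_eq_abs, abs_mul, abs_pow, abs_abs, Pi.add_apply]
  rw [← sq_abs (y ω)]
  nlinarith [sq_nonneg (|x ω| ^ 2 - |y ω|), sq_nonneg (|x ω| ^ 2), sq_nonneg |y ω|]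

lemma integrable_mul_sq (hx : MemLp x 2 μ) (hy : MemLp y 4 μ) :
    Integrable (fun ω => |x ω| * |y ω| ^ 2) μ := by
  simpa only [mul_comm] using integrable_sq_mul hy hx

lemma integrable_cube_mul (hx : MemLp x 6 μ) (hy : MemLp y 2 μ) :
    Integrable (fun ω => |x ω| ^ 3 * |y ω|) μ := by
  have h1 := hx.integrable_norm_pow (p := 6) (by norm_num)
  refine (h1.add hy.integrable_sq).mono' (((hx.1.norm.pow 3).mul hy.1.norm))
    (Filter.Eventually.of_forall fun ω => ?_)
  simp only [Real.norm_eq_abs, abs_mul, abs_pow, abs_abs, Pi.add_apply]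
  rw [← sq_abs (y ω)]
  nlinarith [sq_nonneg (|x ω| ^ 3 - |y ω|), sq_nonneg (|x ω| ^ 3), sq_nonneg |y ω|]

lemma integral_pos_of_not_ae_zero {g f : Ω → ℝ} (hg : Integrable g μ) (h0 : ∀ ω, 0 ≤ g ω)
    (h : ¬ f =ᵐ[μ] 0) (hfg : ∀ ω, g ω = 0 → f ω = 0) : 0 < ∫ ω, g ω ∂μ := by
  refine lt_of_le_of_ne (integral_nonneg h0) fun h1 => h ?_
  filter_upwards [(integral_eq_zero_iff_of_nonneg h0 hg).1 h1.symm] with ω hω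
  exact hfg ω hω

end Domination

section Selection

lemma le_mul_inf {k N a₁ a₂ a₃ a₄ a₅ a₆ a₇ a₈ a₉ : ℝ≥0∞}
    (h : k = N / 4 * (a₁ ⊓ a₂ ⊓ a₃ ⊓ a₄ ⊓ a₅ ⊓ a₆ ⊓ a₇ ⊓ a₈ ⊓ a₉)) :
    k ≤ N / 4 * a₁ ∧ k ≤ N / 4 * a₃ ∧ k ≤ N / 4 * a₄ ∧ k ≤ N / 4 * a₅ ∧ k ≤ N / 4 * a₆ ∧
      k ≤ N / 4 * a₇ ∧ k ≤ N / 4 * a₈ ∧ k ≤ N / 4 * a₉ := by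
  rw [h]
  refine ⟨?_, ?_, ?_, ?_, ?_, ?_, ?_, ?_⟩ <;> refine mul_le_mul' le_rfl ?_ <;>
    simp only [inf_le_iff, le_refl, or_true, true_or]

variable {Ω : Type*} [MeasurableSpace Ω]

lemma K_le (μ : Measure Ω) (X Y : Ω → ℝ) :
    let N : ℝ≥0∞ → (Ω → ℝ) → ℝ≥0∞ := fun q Z => eLpNorm Z q μ
    let x := centered μ X
    let y := centered μ Y
    let n := N 2 (x * err μ X Y)
    let t := ENNReal.ofReal |slope μ X Y|
    K μ X Y ≤ n / 4 * (n / (36 * N 1 (x ^ 2 * y) * sd μ Y)) ∧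
    K μ X Y ≤ n / 4 * (n * sd μ X / (72 * N 3 x ^ 3 * sd μ Y ^ 2)) ∧
    K μ X Y ≤ n / 4 * (n / (36 * t * N 3 x ^ 3 * sd μ Y)) ∧
    K μ X Y ≤ n / 4 * (sd μ X ^ 2 / (288 * N 1 (x ^ 3 * y))) ∧
    K μ X Y ≤ n / 4 * (sd μ X ^ 3 / (288 * N 4 x ^ 4 * sd μ Y)) ∧
    K μ X Y ≤ n / 4 * (sd μ X ^ 2 / (72 * t * N 4 x ^ 4)) ∧
    K μ X Y ≤ n / 4 * (n / N 4 (x * err μ X Y) ^ 2) ∧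
    K μ X Y ≤ n / 4 * (n / (8 * N 1 (y ^ 2 * x) * sd μ X)) :=
  le_mul_inf rfl

/-- Only these summands of `H₂` serve the bound; the discarded ones are nonnegative. -/
lemma le_H₂ (c : ℝ≥0) (μ : Measure Ω) (X Y : Ω → ℝ) :
    19 + eLpNorm (centered μ Y ^ 2 * centered μ X) 2 μ
        / eLpNorm (centered μ Y ^ 2 * centered μ X) 1 μ
      + 9 * c * eLpNorm (centered μ X * err μ X Y) 3 μ ^ 3
        / eLpNorm (centered μ X * err μ X Y) 2 μ ^ 3
      + 6 * c * eLpNorm (err μ X Y) 3 μ ^ 3 / sd μ (err μ X Y) ^ 3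
      + 16 * c * eLpNorm (centered μ X) 3 μ ^ 3 / sd μ X ^ 3
      + 2 * c * eLpNorm (centered μ X * err μ X Y) 6 μ ^ 6
        / evariance (centered μ X ^ 2 * err μ X Y ^ 2) μ ^ (3 / 2 : ℝ)
      + 4 * (eLpNorm (centered μ X ^ 2 * centered μ Y) 2 μ
        / eLpNorm (centered μ X ^ 2 * centered μ Y) 1 μ)
      + 9 * (eLpNorm (centered μ X) 6 μ ^ 3 / eLpNorm (centered μ X) 3 μ ^ 3)
      + 12 * (eLpNorm (centered μ Y) 4 μ ^ 2 / sd μ Y ^ 2)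
      + 32 * (eLpNorm (centered μ X) 4 μ ^ 2 / sd μ X ^ 2)
      + 2 ^ (11 / 2 : ℝ) * (eLpNorm (centered μ X ^ 3 * centered μ Y) (3 / 2) μ ^ (3 / 2 : ℝ)
        / eLpNorm (centered μ X ^ 3 * centered μ Y) 1 μ ^ (3 / 2 : ℝ))
      + 16 * (eLpNorm (centered μ X) 6 μ ^ 6 / eLpNorm (centered μ X) 4 μ ^ 6)
      + 64 * ENNReal.ofReal (√2) * (eLpNorm (centered μ X * err μ X Y) 3 μ ^ 3
        / eLpNorm (centered μ X * err μ X Y) 2 μ ^ 3)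
      ≤ H₂ c μ X Y := by
  have aux : ∀ a b d f : ℝ≥0∞, b / a ≤ 1 / a * (2 * b + d + f) := fun a b d f => by
    rw [one_div, mul_comm, ← div_eq_mul_inv]
    gcongr
    rw [two_mul, add_assoc, add_assoc]
    exact le_self_add
  have select : ∀ t₁ u₁ t₂ t₃ t₄ t₅ t₆ t₇ t₈ t₉ s₁ s₂ s₃ s₄ s₅ s₆ s₇ s₈ s₉ r₁ r₂ r₃ r₄ r₅ r₆ r₇
      : ℝ≥0∞, t₁ ≤ u₁ →
      19 + t₁ + t₂ + t₃ + t₄ + t₅ + t₇ + s₁ + s₂ + s₃ + s₄ + s₆ + r₁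
      ≤ 19 + u₁ + t₂ + t₃ + t₄ + t₅ + t₆ + t₇ + t₈ + t₉ + s₁ + s₂ + s₃ + s₄ + s₅ + s₆ + s₇ + s₈
        + s₉ + r₁ + r₂ + r₃ + r₄ + r₅ + r₆ + r₇ := by
    intro t₁ u₁ t₂ t₃ t₄ t₅ t₆ t₇ t₈ t₉ s₁ s₂ s₃ s₄ s₅ s₆ s₇ s₈ s₉ r₁ r₂ r₃ r₄ r₅ r₆ r₇ h
    calc _ ≤ (19 + u₁ + t₂ + t₃ + t₄ + t₅ + t₇ + s₁ + s₂ + s₃ + s₄ + s₆ + r₁)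
          + (t₆ + t₈ + t₉ + s₅ + s₇ + s₈ + s₉ + r₂ + r₃ + r₄ + r₅ + r₆ + r₇) := by
          refine le_trans ?_ le_self_add
          gcongr
      _ = _ := by ring
  exact select _ _ _ _ _ _ _ _ _ _ _ _ _ _ _ _ _ _ _ _ _ _ _ _ _ _ (aux _ _ _ _)

end Selection

section Sample

lemma log_div_le_of_large {n : ℕ} (hn : 11881 ≤ n) :
    Real.log n / n ≤ 1 / 900 ∧ 9.3 ≤ Real.log n := by
  have hn' : (11881 : ℝ) ≤ n := by exact_mod_cast hn
  have hlog2 := Real.log_two_gt_d9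
  have hlog2' := Real.log_two_lt_d9
  constructor
  · have h1 : (8192 : ℝ) ≤ n := by linarith
    have he : Real.exp 1 ≤ (8192 : ℝ) := by
      have := Real.exp_one_lt_d9; linarith
    refine (Real.log_div_self_antitoneOn he (he.trans h1) h1).trans ?_
    simp only
    rw [show (8192 : ℝ) = 2 ^ 13 by norm_num, Real.log_pow]
    norm_num
    linarith
  · have h2 : (2 : ℝ) ^ 27 ≤ (n : ℝ) ^ 2 := by nlinarith
    have h3 := Real.log_le_log (by norm_num) h2
    rw [Real.log_pow, Real.log_pow] at h3
    norm_num at h3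
    linarith

/-- `19 + 64 · 1.41 > 109` and `109² = 11881`. -/
lemma le_of_sqrt_gt {n : ℕ} (h : 19 + 64 * √2 < √(n : ℝ)) : 11881 ≤ n := by
  have h2 : (1.41 : ℝ) < √2 := Real.lt_sqrt_of_sq_lt (by norm_num)
  have h3 : (109 : ℝ) < √(n : ℝ) := by linarith
  have h4 := (Real.lt_sqrt (by norm_num)).1 h3
  have : (11881 : ℝ) < n := by linarith
  exact_mod_cast this.le

/-- The square of the quantity assumed to be at most 1 is `(M r)² · log n / (2π)`, and `log n ≥ 9.3`
makes the last factor at least `(6/5)²`. -/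
lemma mul_sqrt_log_div_le {n : ℕ} {M : ℝ} (hn : 0 < n) (hL : 9.3 ≤ Real.log n) (hM0 : 0 ≤ M)
    (hM : Real.log n / √(n : ℝ) * (M / √(2 * Real.pi)) ≤ 1) :
    M * √(Real.log n / n) ≤ 5 / 6 := by
  have hn0 : (0 : ℝ) < n := by exact_mod_cast hn
  have hL0 : 0 < Real.log n := by linarith
  have hpi : 0 < √(2 * Real.pi) := by positivity
  refine abs_le_of_sq_le_sq' ?_ (by norm_num) |>.2
  have h1 : (Real.log n / √(n : ℝ) * (M / √(2 * Real.pi))) ^ 2 ≤ 1 :=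
    pow_le_one₀ (by positivity) hM
  have h2 : (Real.log n / √(n : ℝ) * (M / √(2 * Real.pi))) ^ 2
      = (M * √(Real.log n / n)) ^ 2 * (Real.log n / (2 * Real.pi)) := by
    rw [mul_pow, div_pow, div_pow, mul_pow, Real.sq_sqrt hn0.le, Real.sq_sqrt (by positivity),
      Real.sq_sqrt (by positivity)]
    field_simp
  rw [h2] at h1
  have h3 : 36 / 25 ≤ Real.log n / (2 * Real.pi) := by
    rw [div_le_div_iff₀ (by norm_num) (by positivity)]
    have := Real.pi_lt_d2
    linarith
  have h4 := mul_le_mul_of_nonneg_left h3 (sq_nonneg (M * √(Real.log n / n)))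
  linarith

end Sample

end RobustSlope

/-! ### Moments and positivity deduced from finite ratios -/

namespace RobustSlope

section Finite
variable {Ω : Type*} [MeasurableSpace Ω] {μ : Measure Ω} {X Y : Ω → ℝ} {c : ℝ≥0}

lemma sd_toReal : (sd μ X).toReal = √Var[X; μ] := ENNReal.toReal_ofReal (Real.sqrt_nonneg _)

lemma sd_ne_top : sd μ X ≠ ∞ := ENNReal.ofReal_ne_top

/-- Square-integrable variables for which `H₁` and `H₂` are finite. -/
structure FiniteRatios (c : ℝ≥0) (μ : Measure Ω) (X Y : Ω → ℝ) : Prop where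
  H₁_ne_top : H₁ μ X Y ≠ ∞
  H₂_ne_top : H₂ c μ X Y ≠ ∞
  two_X : MemLp X 2 μ
  two_Y : MemLp Y 2 μ
  var_pos : 0 < Var[X; μ]

namespace FiniteRatios

/-- `H₁` contains a multiple of `1/K`. -/
lemma K_ne_zero (h : FiniteRatios c μ X Y) : K μ X Y ≠ 0 := by
  intro hK
  have := (ENNReal.add_ne_top.1 (h.H₁_ne_top)).2
  simp [hK] at this

/-- Otherwise the prefactor of `K` is 0, and so is `K`, whatever the ratios in the minimum. -/
lemma not_ae_zero (h : FiniteRatios c μ X Y) : ¬ centered μ X * err μ X Y =ᵐ[μ] 0 := by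
  intro h0
  refine h.K_ne_zero ?_
  have : eLpNorm (centered μ X * err μ X Y) 2 μ = 0 := by
    rw [eLpNorm_congr_ae h0, eLpNorm_zero]
  simp [K, this]

end FiniteRatios

variable [IsProbabilityMeasure μ]

lemma variance_err_pos (hX : MemLp X 2 μ) (hY : MemLp Y 2 μ)
    (h : ¬ centered μ X * err μ X Y =ᵐ[μ] 0) : 0 < Var[err μ X Y; μ] := by
  rw [variance_err hX hY]
  refine integral_pos_of_not_ae_zero (memLp_err hX hY).integrable_sq (fun ω => sq_nonneg _) h
    fun ω hω => ?_
  simp [pow_eq_zero_iff two_ne_zero |>.1 hω]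

namespace FiniteRatios

lemma aestronglyMeasurable_X (h : FiniteRatios c μ X Y) :
    AEStronglyMeasurable (centered μ X) μ := (memLp_centered h.two_X).1

lemma aestronglyMeasurable_Y (h : FiniteRatios c μ X Y) :
    AEStronglyMeasurable (centered μ Y) μ := (memLp_centered h.two_Y).1

lemma aestronglyMeasurable_mul_err (h : FiniteRatios c μ X Y) :
    AEStronglyMeasurable (centered μ X * err μ X Y) μ :=
  h.aestronglyMeasurable_X.mul (memLp_err h.two_X h.two_Y).1

/-- If the `L⁴` norm were infinite, the ratio with its square in the denominator would be 0, and `K`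
with it. -/
lemma memLp_four_mul_err (h : FiniteRatios c μ X Y) :
    MemLp (centered μ X * err μ X Y) 4 μ := by
  refine ⟨h.aestronglyMeasurable_mul_err, lt_top_iff_ne_top.2 fun h4 => h.K_ne_zero ?_⟩
  obtain ⟨-, -, -, -, -, -, h8, -⟩ := K_le μ X Y
  simpa [h4] using h8

lemma K_ne_top (h : FiniteRatios c μ X Y) : K μ X Y ≠ ∞ := by
  obtain ⟨-, -, -, -, -, -, h8, -⟩ := K_le μ X Y
  have h2 : eLpNorm (centered μ X * err μ X Y) 2 μ ≠ ∞ :=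
    (h.memLp_four_mul_err.mono_exponent (p := 2) (by norm_num)).eLpNorm_ne_top
  refine ne_top_of_le_ne_top (ENNReal.mul_ne_top (ENNReal.div_ne_top h2 (by norm_num))
    (ENNReal.div_ne_top h2 (pow_ne_zero 2 ?_))) h8
  exact eLpNorm_ne_zero_of_not_ae_zero h.aestronglyMeasurable_mul_err (by norm_num) h.not_ae_zero

lemma variance_Y_pos (h : FiniteRatios c μ X Y) : 0 < Var[Y; μ] := by
  have h1 := Real.sqrt_pos.2 (variance_err_pos h.two_X h.two_Y h.not_ae_zero)
  exact Real.sqrt_pos.1 (h1.trans_le (sqrt_variance_err_le h.two_X h.two_Y h.var_pos.ne'))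

/-- A finite ratio bounds its numerator only once the denominator is known to be finite, as `∞/∞ =
0`. So the `L⁴` norm is read off first, over `sX²`; it makes the `L³` norm finite, and then the `L⁶`
norm follows from the ratio over the `L³` norm. -/
lemma memLp_six_X (h : FiniteRatios c μ X Y) : MemLp (centered μ X) 6 μ := by
  have ht := ne_top_of_le_ne_top h.H₂_ne_top (le_H₂ c μ X Y)
  simp only [ENNReal.add_ne_top] at ht
  have t6 := ht.1.1.1.1.1.2
  have t4 := ht.1.1.1.2
  have h4 : eLpNorm (centered μ X) 4 μ ≠ ∞ := by
    have := ne_top_of_div_ne_top (ne_top_of_mul_ne_top t4 (by norm_num))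
      (ENNReal.pow_ne_top sd_ne_top)
    exact fun h0 => this (by rw [h0]; simp)
  have h3 : eLpNorm (centered μ X) 3 μ ≠ ∞ :=
    (MemLp.mono_exponent ⟨h.aestronglyMeasurable_X, lt_top_iff_ne_top.2 h4⟩
      (by norm_num)).eLpNorm_ne_top
  have h6 := ne_top_of_div_ne_top (ne_top_of_mul_ne_top t6 (by norm_num))
      (ENNReal.pow_ne_top h3)
  exact ⟨h.aestronglyMeasurable_X, lt_top_iff_ne_top.2 fun h0 => h6 (by rw [h0]; simp)⟩

lemma memLp_four_Y (h : FiniteRatios c μ X Y) : MemLp (centered μ Y) 4 μ := by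
  have ht := ne_top_of_le_ne_top h.H₂_ne_top (le_H₂ c μ X Y)
  simp only [ENNReal.add_ne_top] at ht
  have t4 := ht.1.1.1.1.2
  have h4 := ne_top_of_div_ne_top (ne_top_of_mul_ne_top t4 (by norm_num))
      (ENNReal.pow_ne_top sd_ne_top)
  exact ⟨h.aestronglyMeasurable_Y, lt_top_iff_ne_top.2 fun h0 => h4 (by rw [h0]; simp)⟩

lemma memLp_two_sq (h : FiniteRatios c μ X Y) :
    MemLp (centered μ X ^ 2 * err μ X Y ^ 2) 2 μ := by
  have h1 := memLp_pow_of_memLp (q := 2) h.memLp_four_mul_err two_pos (by norm_num)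
  refine h1.congr_norm ?_ ?_ |> fun h => h
  · exact (h.aestronglyMeasurable_X.pow 2).mul ((memLp_err h.two_X h.two_Y).1.pow 2)
  · exact Filter.Eventually.of_forall fun ω => by simp [mul_pow]

lemma evariance_rpow_ne_top (h : FiniteRatios c μ X Y) :
    evariance (centered μ X ^ 2 * err μ X Y ^ 2) μ ^ (3 / 2 : ℝ) ≠ ∞ :=
  ENNReal.rpow_ne_top_of_nonneg (by norm_num) (evariance_lt_top h.memLp_two_sq).ne

lemma memLp_six_mul_err (h : FiniteRatios c μ X Y) (hc : c ≠ 0) :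
    MemLp (centered μ X * err μ X Y) 6 μ := by
  have ht := ne_top_of_le_ne_top h.H₂_ne_top (le_H₂ c μ X Y)
  simp only [ENNReal.add_ne_top] at ht
  have t6 := ht.1.1.1.1.1.1.1.2
  have h6 := ne_top_of_div_ne_top t6 h.evariance_rpow_ne_top
  refine ⟨h.aestronglyMeasurable_mul_err, lt_top_iff_ne_top.2 fun h0 => h6 ?_⟩
  rw [h0]
  simp [hc]

/-- With zero variance, the corresponding summand of `H₂` would be a nonzero number over 0, hence
infinite. -/
lemma variance_sq_pos (h : FiniteRatios c μ X Y) (hc : c ≠ 0) :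
    0 < Var[centered μ X ^ 2 * err μ X Y ^ 2; μ] := by
  have ht := ne_top_of_le_ne_top h.H₂_ne_top (le_H₂ c μ X Y)
  simp only [ENNReal.add_ne_top] at ht
  have t6 := ht.1.1.1.1.1.1.1.2
  have h0 : eLpNorm (centered μ X * err μ X Y) 6 μ ≠ 0 :=
    eLpNorm_ne_zero_of_not_ae_zero h.aestronglyMeasurable_mul_err (by norm_num) h.not_ae_zero
  rw [variance]
  refine ENNReal.toReal_pos (fun hv => t6 ?_) (evariance_lt_top h.memLp_two_sq).ne
  rw [hv, ENNReal.zero_rpow_of_pos (by norm_num), ENNReal.div_zero]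
  simp [hc, h0]

end FiniteRatios
end Finite
end RobustSlope

namespace RobustSlope

section Norms
variable {Ω : Type*} [MeasurableSpace Ω] {μ : Measure Ω} {f : Ω → ℝ}

lemma eLpNorm_toReal_mono [IsProbabilityMeasure μ] {p q : ℝ≥0∞} (hpq : p ≤ q)
    (hf : MemLp f q μ) : (eLpNorm f p μ).toReal ≤ (eLpNorm f q μ).toReal :=
  ENNReal.toReal_mono hf.eLpNorm_ne_top (eLpNorm_le_eLpNorm_of_exponent_le hpq hf.1)

lemma eLpNorm_one_toReal_of_nonneg (hf : Integrable f μ) (h0 : ∀ ω, 0 ≤ f ω) :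
    (eLpNorm f 1 μ).toReal = ∫ ω, f ω ∂μ := by
  rw [eLpNorm_one_toReal (memLp_one_iff_integrable.2 hf)]
  simp only [abs_of_nonneg (h0 _)]

lemma eLpNorm_four_toReal_sq (hf : MemLp f 4 μ) :
    (eLpNorm f 4 μ).toReal ^ 2 = √(∫ ω, f ω ^ 4 ∂μ) := by
  rw [← eLpNorm_four_toReal_pow hf, show ∀ a : ℝ, a ^ 4 = (a ^ 2) ^ 2 by intro a; ring,
    Real.sqrt_sq (sq_nonneg _)]

end Norms

namespace FiniteRatios
variable {Ω : Type*} [MeasurableSpace Ω] {μ : Measure Ω} {X Y : Ω → ℝ} {c : ℝ≥0}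

lemma sd_X_toReal (h : FiniteRatios c μ X Y) :
    (sd μ X).toReal = √(∫ ω, centered μ X ω ^ 2 ∂μ) := by
  rw [sd_toReal, variance_eq_integral_centered h.two_X.1.aemeasurable]

lemma sd_Y_toReal (h : FiniteRatios c μ X Y) :
    (sd μ Y).toReal = √(∫ ω, centered μ Y ω ^ 2 ∂μ) := by
  rw [sd_toReal, variance_eq_integral_centered h.two_Y.1.aemeasurable]

lemma sd_X_toReal_pos (h : FiniteRatios c μ X Y) : 0 < (sd μ X).toReal := by
  rw [sd_toReal]; exact Real.sqrt_pos.2 h.var_pos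

variable [IsProbabilityMeasure μ]

lemma sd_err_toReal (h : FiniteRatios c μ X Y) :
    (sd μ (err μ X Y)).toReal = √(∫ ω, err μ X Y ω ^ 2 ∂μ) := by
  rw [sd_toReal, variance_err h.two_X h.two_Y]

lemma eLpNorm_mul_err_toReal_pos (h : FiniteRatios c μ X Y) :
    0 < (eLpNorm (centered μ X * err μ X Y) 2 μ).toReal :=
  ENNReal.toReal_pos (eLpNorm_ne_zero_of_not_ae_zero h.aestronglyMeasurable_mul_err (by norm_num)
    h.not_ae_zero) (h.memLp_four_mul_err.mono_exponent (by norm_num)).eLpNorm_ne_top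

lemma sd_Y_toReal_pos (h : FiniteRatios c μ X Y) : 0 < (sd μ Y).toReal := by
  rw [sd_toReal]; exact Real.sqrt_pos.2 h.variance_Y_pos

/-- The moment inequalities of the deterministic expansion, for `M = 1 / K`. -/
lemma momentBounds (h : FiniteRatios c μ X Y) {r : ℝ} (hr0 : 0 < r) (hr : r ≤ 1 / 30)
    (hMr : (K μ X Y).toReal⁻¹ * r ≤ 5 / 6) :
    MomentBounds (sd μ X).toReal (sd μ Y).toReal (sd μ (err μ X Y)).toReal
      (eLpNorm (centered μ X * err μ X Y) 2 μ).toReal (slope μ X Y) (K μ X Y).toReal⁻¹ r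
      (eLpNorm (centered μ X ^ 2 * centered μ Y) 1 μ).toReal
      ((eLpNorm (centered μ X) 3 μ).toReal ^ 3)
      (eLpNorm (centered μ Y ^ 2 * centered μ X) 1 μ).toReal
      (eLpNorm (centered μ X ^ 3 * centered μ Y) 1 μ).toReal
      ((eLpNorm (centered μ X) 4 μ).toReal ^ 4)
      ((eLpNorm (centered μ X * err μ X Y) 4 μ).toReal ^ 2) := by
  have hs := h.eLpNorm_mul_err_toReal_pos
  have hN : eLpNorm (centered μ X * err μ X Y) 2 μ ≠ ∞ :=
    (h.memLp_four_mul_err.mono_exponent (by norm_num)).eLpNorm_ne_top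
  have hX2 : (sd μ X).toReal = (eLpNorm (centered μ X) 2 μ).toReal := by
    rw [h.sd_X_toReal, eLpNorm_two_toReal (memLp_centered h.two_X)]
  have hk0 := h.K_ne_zero
  have hk := h.K_ne_top
  obtain ⟨k1, k3, k4, k5, k6, k7, k8, k9⟩ := K_le μ X Y
  simp only at k1 k3 k4 k5 k6 k7 k8 k9
  have hsX : sd μ X ≠ ∞ := sd_ne_top
  have b1 := four_mul_le_of_le_mul_div k1 hk0 hk hN hN
  have b3 := four_mul_le_of_le_mul_div k3 hk0 hk hN (ENNReal.mul_ne_top hN hsX)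
  have b4 := four_mul_le_of_le_mul_div k4 hk0 hk hN hN
  have b5 := four_mul_le_of_le_mul_div k5 hk0 hk hN (ENNReal.pow_ne_top hsX)
  have b6 := four_mul_le_of_le_mul_div k6 hk0 hk hN (ENNReal.pow_ne_top hsX)
  have b7 := four_mul_le_of_le_mul_div k7 hk0 hk hN (ENNReal.pow_ne_top hsX)
  have b8 := four_mul_le_of_le_mul_div k8 hk0 hk hN hN
  have b9 := four_mul_le_of_le_mul_div k9 hk0 hk hN hN
  simp only [ENNReal.toReal_mul, ENNReal.toReal_pow, ENNReal.toReal_ofNat,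
    ENNReal.toReal_ofReal (abs_nonneg (slope μ X Y))] at b1 b3 b4 b5 b6 b7 b8 b9
  -- The ratio with the `L⁴` norm of `x e` gives `4 ‖x e‖₄² ≤ M ‖x e‖₂²`, and the `L²` norm is at
  -- most the `L⁴` norm.
  have hM : 4 ≤ (K μ X Y).toReal⁻¹ := by
    have h1 := eLpNorm_toReal_mono (p := 2) (q := 4) (by norm_num) h.memLp_four_mul_err
    have h2 := pow_le_pow_left₀ hs.le h1 2
    have h3 : 0 < (eLpNorm (centered μ X * err μ X Y) 2 μ).toReal ^ 2 := by positivity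
    refine le_of_mul_le_mul_right ?_ h3
    linarith
  refine ⟨h.sd_X_toReal_pos, h.sd_Y_toReal_pos, ENNReal.toReal_nonneg, hs, hr0, hr, hM, hMr,
    ?_, ?_, ?_, ?_, ?_, ?_, ?_, ?_, ?_, ?_, ?_, ?_⟩
  · rw [sd_toReal, sd_toReal]
    exact sqrt_variance_err_le h.two_X h.two_Y h.var_pos.ne'
  · rw [sd_toReal, sd_toReal]
    exact abs_slope_mul_sqrt_variance_le h.two_X h.two_Y h.var_pos.ne'
  · rw [hX2]
    exact pow_le_pow_left₀ ENNReal.toReal_nonneg (eLpNorm_toReal_mono (by norm_num)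
      (h.memLp_six_X.mono_exponent (by norm_num))) 3
  · rw [hX2]
    exact pow_le_pow_left₀ ENNReal.toReal_nonneg (eLpNorm_toReal_mono (by norm_num)
      (h.memLp_six_X.mono_exponent (by norm_num))) 4
  all_goals linarith

end FiniteRatios

end RobustSlope

namespace RobustSlope

section Selection

lemma toReal_add_twelve {a₀ a₁ a₂ a₃ a₄ a₅ a₆ a₇ a₈ a₉ b₀ b₁ b₂ : ℝ≥0∞}
    (h : a₀ + a₁ + a₂ + a₃ + a₄ + a₅ + a₆ + a₇ + a₈ + a₉ + b₀ + b₁ + b₂ ≠ ∞) :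
    (a₀ + a₁ + a₂ + a₃ + a₄ + a₅ + a₆ + a₇ + a₈ + a₉ + b₀ + b₁ + b₂).toReal
      = a₀.toReal + a₁.toReal + a₂.toReal + a₃.toReal + a₄.toReal + a₅.toReal + a₆.toReal
        + a₇.toReal + a₈.toReal + a₉.toReal + b₀.toReal + b₁.toReal + b₂.toReal := by
  simp only [ENNReal.add_ne_top] at h
  obtain ⟨⟨⟨⟨⟨⟨⟨⟨⟨⟨⟨⟨h0, h1⟩, h2⟩, h3⟩, h4⟩, h5⟩, h6⟩, h7⟩, h8⟩, h9⟩, h10⟩, h11⟩, h12⟩ := h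
  simp [ENNReal.toReal_add, *]

end Selection

namespace FiniteRatios
variable {Ω : Type*} [MeasurableSpace Ω] {μ : Measure Ω} {X Y : Ω → ℝ} {c : ℝ≥0}

lemma le_H₂_toReal (h : FiniteRatios c μ X Y) :
    19 + (eLpNorm (centered μ Y ^ 2 * centered μ X) 2 μ).toReal
        / (eLpNorm (centered μ Y ^ 2 * centered μ X) 1 μ).toReal
      + 9 * c * (eLpNorm (centered μ X * err μ X Y) 3 μ).toReal ^ 3
        / (eLpNorm (centered μ X * err μ X Y) 2 μ).toReal ^ 3
      + 6 * c * (eLpNorm (err μ X Y) 3 μ).toReal ^ 3 / (sd μ (err μ X Y)).toReal ^ 3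
      + 16 * c * (eLpNorm (centered μ X) 3 μ).toReal ^ 3 / (sd μ X).toReal ^ 3
      + 2 * c * (eLpNorm (centered μ X * err μ X Y) 6 μ).toReal ^ 6
        / √Var[centered μ X ^ 2 * err μ X Y ^ 2; μ] ^ 3
      + 4 * ((eLpNorm (centered μ X ^ 2 * centered μ Y) 2 μ).toReal
        / (eLpNorm (centered μ X ^ 2 * centered μ Y) 1 μ).toReal)
      + 9 * ((eLpNorm (centered μ X) 6 μ).toReal ^ 3 / (eLpNorm (centered μ X) 3 μ).toReal ^ 3)
      + 12 * ((eLpNorm (centered μ Y) 4 μ).toReal ^ 2 / (sd μ Y).toReal ^ 2)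
      + 32 * ((eLpNorm (centered μ X) 4 μ).toReal ^ 2 / (sd μ X).toReal ^ 2)
      + 2 ^ (11 / 2 : ℝ) *
        ((eLpNorm (centered μ X ^ 3 * centered μ Y) (3 / 2) μ).toReal ^ (3 / 2 : ℝ)
        / (eLpNorm (centered μ X ^ 3 * centered μ Y) 1 μ).toReal ^ (3 / 2 : ℝ))
      + 16 * ((eLpNorm (centered μ X) 6 μ).toReal ^ 6 / (eLpNorm (centered μ X) 4 μ).toReal ^ 6)
      + 64 * √2 * ((eLpNorm (centered μ X * err μ X Y) 3 μ).toReal ^ 3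
        / (eLpNorm (centered μ X * err μ X Y) 2 μ).toReal ^ 3)
      ≤ (H₂ c μ X Y).toReal := by
  have h1 := le_H₂ c μ X Y
  have h2 := ENNReal.toReal_mono h.H₂_ne_top h1
  rw [toReal_add_twelve (ne_top_of_le_ne_top h.H₂_ne_top h1)] at h2
  refine le_of_eq_of_le ?_ h2
  have hv : (evariance (centered μ X ^ 2 * err μ X Y ^ 2) μ ^ (3 / 2 : ℝ)).toReal
      = √Var[centered μ X ^ 2 * err μ X Y ^ 2; μ] ^ 3 := by
    rw [← ENNReal.toReal_rpow, ← variance, Real.sqrt_eq_rpow, ← Real.rpow_natCast,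
      ← Real.rpow_mul (variance_nonneg _ _)]
    norm_num
  simp only [ENNReal.toReal_mul, ENNReal.toReal_div, ENNReal.toReal_pow, ENNReal.toReal_ofNat, hv,
    ENNReal.toReal_rpow, ENNReal.coe_toReal, ENNReal.toReal_ofReal (Real.sqrt_nonneg _)]
  simp only [← ENNReal.toReal_rpow, ENNReal.toReal_ofNat]

lemma H₁_toReal (h : FiniteRatios c μ X Y) :
    (H₁ μ X Y).toReal = (3 * ((sd μ X).toReal * (sd μ (err μ X Y)).toReal) /
      (eLpNorm (centered μ X * err μ X Y) 2 μ).toReal + (K μ X Y).toReal⁻¹) / √(2 * Real.pi) := by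
  obtain ⟨h1, h2⟩ := ENNReal.add_ne_top.1 h.H₁_ne_top
  rw [H₁, ENNReal.toReal_add h1 h2]
  simp only [ENNReal.toReal_mul, ENNReal.toReal_div, ENNReal.toReal_ofNat,
    ENNReal.toReal_ofReal (Real.sqrt_nonneg _), ENNReal.toReal_one]
  rw [add_div, div_div, inv_eq_one_div, div_div]
  ring

variable [IsProbabilityMeasure μ]

/-- Monotonicity of `L^p` norms. Through the coefficient `64√2` in `H₂`, it forces `n` to be large
whenever `H₂ < √n`. -/
lemma one_le_ratio (h : FiniteRatios c μ X Y) :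
    1 ≤ (eLpNorm (centered μ X * err μ X Y) 3 μ).toReal ^ 3
        / (eLpNorm (centered μ X * err μ X Y) 2 μ).toReal ^ 3 := by
  rw [one_le_div (by have := h.eLpNorm_mul_err_toReal_pos; positivity)]
  exact pow_le_pow_left₀ ENNReal.toReal_nonneg (eLpNorm_toReal_mono (by norm_num)
    (h.memLp_four_mul_err.mono_exponent (by norm_num))) 3

lemma nineteen_add_le_H₂ (h : FiniteRatios c μ X Y) : 19 + 64 * √2 ≤ (H₂ c μ X Y).toReal := by
  refine le_trans ?_ h.le_H₂_toReal
  have h1 := mul_le_mul_of_nonneg_left h.one_le_ratio (show 0 ≤ 64 * √2 by positivity)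
  rw [mul_one] at h1
  refine add_le_add ?_ h1
  simp only [add_assoc]
  exact le_add_of_nonneg_right (by positivity)

lemma memLp_sq_mul (h : FiniteRatios c μ X Y) :
    MemLp (fun ω => |centered μ X ω| ^ 2 * |centered μ Y ω|) 2 μ := by
  have ht := ne_top_of_le_ne_top h.H₂_ne_top (le_H₂ c μ X Y)
  simp only [ENNReal.add_ne_top] at ht
  have t := ne_top_of_mul_ne_top ht.1.1.1.1.1.1.2 (by norm_num)
  have hi := integrable_sq_mul (h.memLp_six_X.mono_exponent (by norm_num))
    (memLp_centered h.two_Y)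
  have := ne_top_of_div_ne_top t
    (by rw [eLpNorm_sq_mul]; exact (memLp_one_iff_integrable.2 hi).eLpNorm_ne_top)
  rw [eLpNorm_sq_mul] at this
  exact ⟨hi.1, lt_top_iff_ne_top.2 this⟩

lemma memLp_mul_sq (h : FiniteRatios c μ X Y) :
    MemLp (fun ω => |centered μ X ω| * |centered μ Y ω| ^ 2) 2 μ := by
  have ht := ne_top_of_le_ne_top h.H₂_ne_top (le_H₂ c μ X Y)
  simp only [ENNReal.add_ne_top] at ht
  have t := ht.1.1.1.1.1.1.1.1.1.1.1.2
  have hi := integrable_mul_sq (memLp_centered h.two_X) h.memLp_four_Y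
  have := ne_top_of_div_ne_top t
    (by rw [eLpNorm_sq_mul']; exact (memLp_one_iff_integrable.2 hi).eLpNorm_ne_top)
  rw [eLpNorm_sq_mul'] at this
  exact ⟨hi.1, lt_top_iff_ne_top.2 this⟩

lemma memLp_cube_mul (h : FiniteRatios c μ X Y) :
    MemLp (fun ω => |centered μ X ω| ^ 3 * |centered μ Y ω|) (3 / 2) μ := by
  have ht := ne_top_of_le_ne_top h.H₂_ne_top (le_H₂ c μ X Y)
  simp only [ENNReal.add_ne_top] at ht
  have t := ne_top_of_mul_ne_top ht.1.1.2 (by simp)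
  have hi := integrable_cube_mul h.memLp_six_X (memLp_centered h.two_Y)
  have := ne_top_of_div_ne_top t (ENNReal.rpow_ne_top_of_nonneg (by norm_num)
    (by rw [eLpNorm_cube_mul]; exact (memLp_one_iff_integrable.2 hi).eLpNorm_ne_top))
  rw [eLpNorm_cube_mul] at this
  exact ⟨hi.1, lt_top_iff_ne_top.2 fun h0 => this
    (by rw [h0]; exact ENNReal.top_rpow_of_pos (by norm_num))⟩

end FiniteRatios

end RobustSlope

/-! ### The bound by `H₁` and `H₂` -/

namespace RobustSlope

variable {Ω Ω₀ : Type*} [MeasurableSpace Ω] [MeasurableSpace Ω₀] {P : Measure Ω}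
  {P₀ : Measure Ω₀} [IsProbabilityMeasure P] [IsProbabilityMeasure P₀] {X Y : Ω₀ → ℝ} {n : ℕ}
  {Xs Ys : Fin n → Ω → ℝ} {c : ℝ≥0}

/-- A comparison of coefficients: every ratio in the normal approximation occurs in `H₂` with at
least the same weight, for instance `2 ≤ 2^(11/2)`. -/
lemma sum_ratios_le {u₁ u₂ u₃ u₄ w₁ w₂ w₃ w₅ w₆ w₇ w₈ q k a₁ a₂ a₃ a₄ b₁ b₂ b₃ b₄ T : ℝ}
    (h₁ : 0 ≤ u₁) (h₂ : 0 ≤ u₂) (h₃ : 0 ≤ u₃) (g₁ : 0 ≤ w₁) (g₂ : 0 ≤ w₂)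
    (g₅ : 0 ≤ w₅) (g₆ : 0 ≤ w₆) (g₇ : 0 ≤ w₇) (g₈ : 0 ≤ w₈) (hq : 0 ≤ q)
    (e₁ : u₁ = k * a₁ / b₁) (e₂ : u₂ = k * a₂ / b₂) (e₃ : u₃ = k * a₃ / b₃)
    (e₄ : u₄ = k * a₄ / b₄)
    (h : 19 + w₃ + 9 * k * a₃ / b₃ + 6 * k * a₂ / b₂ + 16 * k * a₁ / b₁ + 2 * k * a₄ / b₄
      + 4 * w₁ + 9 * w₂ + 12 * w₈ + 32 * w₇ + 2 ^ (11 / 2 : ℝ) * w₅ + 16 * w₆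
      + 64 * √2 * q ≤ T) :
    8 + 2 * u₁ + 2 * u₂ + 3 * u₃ + 2 * u₄ + w₁ + w₂ + w₃ + 2 * w₅ + 2 * w₆ + 8 * w₇ + 8 * w₈
      ≤ T := by
  have h2 : (2 : ℝ) ≤ 2 ^ (11 / 2 : ℝ) := by
    conv_lhs => rw [← Real.rpow_one 2]
    exact Real.rpow_le_rpow_of_exponent_le (by norm_num) (by norm_num)
  have h5 := mul_le_mul_of_nonneg_right h2 g₅
  have h6 : 0 ≤ 64 * √2 * q := by positivity
  have f : ∀ m a b : ℝ, m * k * a / b = m * (k * a / b) := fun m a b => by ring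
  rw [f, f, f, f, ← e₁, ← e₂, ← e₃, ← e₄] at h
  linarith

theorem FiniteRatios.abs_measureReal_sub_cdf_le (h : FiniteRatios c P₀ X Y)
    (hc : IsBerryEsseenConstant c) (hn : 11881 ≤ n)
    (hK : Real.log n / √(n : ℝ) * ((K P₀ X Y).toReal⁻¹ / √(2 * Real.pi)) ≤ 1)
    (hcopies : IsIIDCopies P P₀ (fun i ω => (Xs i ω, Ys i ω)) (fun ω => (X ω, Y ω))) (z : ℝ) :
    |P.real {ω | studentized (slope P₀ X Y) (fun i => Xs i ω) (fun i => Ys i ω) ≤ z}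
        - cdf (gaussianReal 0 1) z|
      ≤ Real.log n / √(n : ℝ) * (H₁ P₀ X Y).toReal + (H₂ c P₀ X Y).toReal / √(n : ℝ) := by
  obtain ⟨hr, hL⟩ := log_div_le_of_large hn
  have hn0 : (0 : ℝ) < n := by exact_mod_cast (by omega : 0 < n)
  have hM0 : 0 ≤ (K P₀ X Y).toReal⁻¹ := inv_nonneg.2 ENNReal.toReal_nonneg
  have hX := h.memLp_six_X
  have hX4 : MemLp (centered P₀ X) 4 P₀ := hX.mono_exponent (by norm_num)
  have hX3 : MemLp (centered P₀ X) 3 P₀ := hX.mono_exponent (by norm_num)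
  have hY := h.memLp_four_Y
  have hXE6 := h.memLp_six_mul_err hc.ne_zero
  have hXE4 := h.memLp_four_mul_err
  have hXE3 : MemLp (centered P₀ X * err P₀ X Y) 3 P₀ := hXE6.mono_exponent (by norm_num)
  have hXE2 : MemLp (centered P₀ X * err P₀ X Y) 2 P₀ := hXE6.mono_exponent (by norm_num)
  have hE3 : MemLp (err P₀ X Y) 3 P₀ :=
    (hY.mono_exponent (by norm_num)).sub (hX3.const_mul _)
  have i21 := integrable_sq_mul hX4 (memLp_centered h.two_Y)
  have i12 := integrable_mul_sq (memLp_centered h.two_X) hY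
  have i31 := integrable_cube_mul hX (memLp_centered h.two_Y)
  have hxy := not_ae_zero_of_mul_err h.not_ae_zero
  have p21 := integral_pos_of_not_ae_zero i21 (fun ω => by positivity) hxy (fun ω => by simp)
  have p12 := integral_pos_of_not_ae_zero i12 (fun ω => by positivity) hxy (fun ω => by simp)
  have p31 := integral_pos_of_not_ae_zero i31 (fun ω => by positivity) hxy (fun ω => by simp)
  have hM := h.momentBounds (r := √(Real.log n / n)) (by positivity)
    (Real.sqrt_le_iff.2 ⟨by norm_num, hr.trans (by norm_num)⟩)
    (mul_sqrt_log_div_le (by omega) hL hM0 hK)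
  have E21 := eLpNorm_one_toReal_of_nonneg i21 (fun ω => by positivity)
  have E12 := eLpNorm_one_toReal_of_nonneg i12 (fun ω => by positivity)
  have E31 := eLpNorm_one_toReal_of_nonneg i31 (fun ω => by positivity)
  rw [← eLpNorm_sq_mul] at E21
  rw [← eLpNorm_sq_mul'] at E12
  rw [← eLpNorm_cube_mul] at E31
  have F3 := eLpNorm_toReal_pow (k := 3) (by simp) (by norm_num) hX3
  have F4 := eLpNorm_toReal_pow (k := 4) (by simp) (by norm_num) hX4
  have F6 := eLpNorm_toReal_pow (k := 6) (by simp) (by norm_num) hX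
  have FE := eLpNorm_toReal_pow (k := 3) (by simp) (by norm_num) hE3
  have FXE2 := eLpNorm_two_toReal hXE2
  have FXE3 := eLpNorm_toReal_pow (k := 3) (by simp) (by norm_num) hXE3
  have FXE4 := eLpNorm_four_toReal_sq hXE4
  have FXE6 := eLpNorm_toReal_pow (k := 6) (by simp) (by norm_num) hXE6
  have h32 : (3 / 2 : ℝ≥0∞) ≠ ∞ := ENNReal.div_ne_top (by norm_num) (by norm_num)
  have h32' : (3 / 2 : ℝ≥0∞).toReal = 3 / 2 := by simp
  have G21 := eLpNorm_two_toReal h.memLp_sq_mul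
  have G12 := eLpNorm_two_toReal h.memLp_mul_sq
  have G31 := eLpNorm_toReal_rpow (by norm_num) h32 h.memLp_cube_mul
  rw [← eLpNorm_sq_mul] at G21
  rw [← eLpNorm_sq_mul'] at G12
  rw [← eLpNorm_cube_mul, h32'] at G31
  simp only [abs_mul, abs_pow, abs_abs] at G31
  have F63 : (eLpNorm (centered P₀ X) 6 P₀).toReal ^ 3
      = √(∫ ω, (|centered P₀ X ω| ^ 3) ^ 2 ∂P₀) := by
    simp only [← pow_mul]
    rw [← F6, pow_mul _ 3 2, Real.sqrt_sq (by positivity)]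
  have rpow_aux : ∀ a : ℝ, 0 ≤ a → (a ^ 4) ^ (3 / 2 : ℝ) = a ^ 6 := fun a ha => by
    rw [← Real.rpow_natCast, ← Real.rpow_mul ha, ← Real.rpow_natCast]
    norm_num
  have F66 : (eLpNorm (centered P₀ X) 6 P₀).toReal ^ 6
      = ∫ ω, (|centered P₀ X ω| ^ 4) ^ (3 / 2 : ℝ) ∂P₀ := by
    simp only [rpow_aux _ (abs_nonneg _), F6]
  have F46 : (eLpNorm (centered P₀ X) 4 P₀).toReal ^ 6
      = (∫ ω, |centered P₀ X ω| ^ 4 ∂P₀) ^ (3 / 2 : ℝ) := by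
    rw [← F4, rpow_aux _ ENNReal.toReal_nonneg]
  have sq_aux : ∀ a : ℝ, (|a| ^ 2) ^ 2 = a ^ 4 := fun a => by rw [sq_abs]; ring
  have F42 : (eLpNorm (centered P₀ X) 4 P₀).toReal ^ 2
      = √(∫ ω, (|centered P₀ X ω| ^ 2) ^ 2 ∂P₀) := by
    simp only [sq_aux, eLpNorm_four_toReal_sq hX4]
  have Y42 : (eLpNorm (centered P₀ Y) 4 P₀).toReal ^ 2
      = √(∫ ω, (|centered P₀ Y ω| ^ 2) ^ 2 ∂P₀) := by
    simp only [sq_aux, eLpNorm_four_toReal_sq hY]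
  have G6 : (eLpNorm (centered P₀ X * err P₀ X Y) 6 P₀).toReal ^ 6
      = ∫ ω, (centered P₀ X ω * err P₀ X Y ω) ^ 6 ∂P₀ := by
    rw [FXE6]
    simp only [Even.pow_abs (show Even 6 by decide), Pi.mul_apply]
  have hvar : Var[fun ω => (centered P₀ X ω * (centered P₀ Y ω
      - slope P₀ X Y * centered P₀ X ω)) ^ 2; P₀]
      = Var[centered P₀ X ^ 2 * err P₀ X Y ^ 2; P₀] := by
    congr 1
    ext ω
    simp [err, mul_pow]
  have main := abs_measureReal_studentized_sub_le (P := P) (P₀ := P₀) (xs := Xs) (ys := Ys)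
    (x := centered P₀ X) (y := centered P₀ Y) (c := c) (t := slope P₀ X Y)
    (M := (K P₀ X Y).toReal⁻¹) (mX := ∫ ω, X ω ∂P₀) (mY := ∫ ω, Y ω ∂P₀) hc
    (by simpa [centered] using hcopies) (by omega) hX hY hXE6 h.memLp_sq_mul h.memLp_mul_sq i31
    (by
      refine (h.memLp_cube_mul.integrable_norm_rpow (by norm_num) h32).congr
        (Filter.Eventually.of_forall fun ω => ?_)
      simp only [h32', Real.norm_of_nonneg (show 0 ≤ |centered P₀ X ω| ^ 3 * |centered P₀ Y ω|
        by positivity)])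
    (integral_centered (h.two_X.integrable (by norm_num)))
    (integral_err (h.two_X.integrable (by norm_num)) (h.two_Y.integrable (by norm_num)))
    (integral_centered_mul_err h.two_X h.two_Y h.var_pos.ne')
    (by
      have := variance_err_pos h.two_X h.two_Y h.not_ae_zero
      rwa [variance_err h.two_X h.two_Y] at this)
    (by rw [hvar]; exact h.variance_sq_pos hc.ne_zero)
    p21 p12 p31
    (by
      rw [h.sd_X_toReal, h.sd_Y_toReal, h.sd_err_toReal, E21, E12, E31, F3, F4, FXE2, FXE4] at hM
      exact hM) z
  refine main.trans ?_
  rw [h.H₁_toReal, h.sd_X_toReal, h.sd_err_toReal, FXE2, mul_div_assoc]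
  refine add_le_add le_rfl (div_le_div_of_nonneg_right ?_ (Real.sqrt_nonneg _))
  have hH := h.le_H₂_toReal
  have hq : 0 ≤ (eLpNorm (centered P₀ X * err P₀ X Y) 3 P₀).toReal ^ 3
      / (eLpNorm (centered P₀ X * err P₀ X Y) 2 P₀).toReal ^ 3 := by positivity
  rw [h.sd_X_toReal, h.sd_Y_toReal, h.sd_err_toReal, E21, E12, E31, G21, G12, G31, F3, F63, F66,
    F46, F42, Y42, FE, FXE2, FXE3, G6, ← hvar] at hH
  rw [FXE2, FXE3] at hq
  exact sum_ratios_le (by positivity) (by positivity) (by positivity) (by positivity)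
    (by positivity) (by positivity) (by positivity) (by positivity) (by positivity) hq rfl rfl
    rfl rfl hH

end RobustSlope

namespace RobustSlope

variable {Ω Ω₀ : Type*} [MeasurableSpace Ω] [MeasurableSpace Ω₀] {P : Measure Ω}
  {P₀ : Measure Ω₀} {X Y : Ω₀ → ℝ} {n : ℕ} {Xs Ys : Fin n → Ω → ℝ} {c : ℝ≥0}

lemma nineteen_le_H₂ : 19 ≤ H₂ c P₀ X Y := by
  refine le_trans ?_ (le_H₂ c P₀ X Y)
  simp only [add_assoc]
  exact le_self_add

variable [IsProbabilityMeasure P] [IsProbabilityMeasure P₀]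

lemma abs_measureReal_sub_cdf_le_one (s : Set Ω) (z : ℝ) :
    |P.real s - cdf (gaussianReal 0 1) z| ≤ 1 := by
  rw [abs_le]
  constructor <;>
    linarith [measureReal_nonneg (μ := P) (s := s), measureReal_le_one (μ := P) (s := s),
      cdf_nonneg (gaussianReal 0 1) z, cdf_le_one (gaussianReal 0 1) z]

/-- A bound that is 1 or more holds trivially. A bound below 1 yields by itself the finiteness of
the ratios, the size of `n` and the smallness of `log n / (K √n)`. -/
theorem ofReal_abs_measureReal_sub_cdf_le (hX : MemLp X 2 P₀) (hY : MemLp Y 2 P₀)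
    (hvar : 0 < Var[X; P₀]) (hc : IsBerryEsseenConstant c) (hn : 1 ≤ n)
    (hcopies : IsIIDCopies P P₀ (fun i ω => (Xs i ω, Ys i ω)) (fun ω => (X ω, Y ω))) (z : ℝ) :
    ENNReal.ofReal
        |P.real {ω | studentized (slope P₀ X Y) (fun i => Xs i ω) (fun i => Ys i ω) ≤ z}
          - cdf (gaussianReal 0 1) z|
      ≤ ENNReal.ofReal (Real.log n / √(n : ℝ)) * H₁ P₀ X Y
        + H₂ c P₀ X Y / ENNReal.ofReal (√(n : ℝ)) := by
  have hn0 : (0 : ℝ) < √(n : ℝ) := Real.sqrt_pos.2 (by exact_mod_cast hn)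
  rcases le_or_gt 1 (ENNReal.ofReal (Real.log n / √(n : ℝ)) * H₁ P₀ X Y
        + H₂ c P₀ X Y / ENNReal.ofReal (√(n : ℝ))) with h1 | h1
  · refine le_trans ?_ h1
    rw [ENNReal.ofReal_le_one]
    exact abs_measureReal_sub_cdf_le_one _ z
  have hA := lt_of_le_of_lt le_self_add h1
  have hB := lt_of_le_of_lt le_add_self h1
  have hs0 : ENNReal.ofReal √(n : ℝ) ≠ 0 := (ENNReal.ofReal_pos.2 hn0).ne'
  have hH2 : H₂ c P₀ X Y < ENNReal.ofReal √(n : ℝ) := by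
    rwa [ENNReal.div_lt_iff (Or.inl hs0) (Or.inl ENNReal.ofReal_ne_top), one_mul] at hB
  have hH2t : H₂ c P₀ X Y ≠ ∞ := hH2.ne_top
  have h19 : (19 : ℝ) < √(n : ℝ) := by
    have := nineteen_le_H₂.trans_lt hH2
    rw [← ENNReal.ofReal_ofNat] at this
    exact (ENNReal.ofReal_lt_ofReal_iff hn0).1 this
  have hL : 0 < Real.log n := by
    refine Real.log_pos ?_
    have := Real.sq_sqrt (Nat.cast_nonneg (α := ℝ) n)
    nlinarith
  -- Positivity of `log n` is essential: at `n = 1` the product would be `0 · ∞ = 0` and would say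
  -- nothing about `H₁`.
  have hH1t : H₁ P₀ X Y ≠ ∞ := ne_top_of_mul_ne_top (hA.trans ENNReal.one_lt_top).ne
    (ENNReal.ofReal_pos.2 (by positivity)).ne'
  have h : FiniteRatios c P₀ X Y := ⟨hH1t, hH2t, hX, hY, hvar⟩
  have hlarge : 11881 ≤ n := by
    refine le_of_sqrt_gt (h.nineteen_add_le_H₂.trans_lt ?_)
    rw [← ENNReal.toReal_ofReal hn0.le]
    exact (ENNReal.toReal_lt_toReal hH2t ENNReal.ofReal_ne_top).2 hH2
  have hAr := ENNReal.toReal_mono ENNReal.one_ne_top hA.le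
  rw [ENNReal.toReal_mul, ENNReal.toReal_ofReal (by positivity), ENNReal.toReal_one] at hAr
  have hK : Real.log n / √(n : ℝ) * ((K P₀ X Y).toReal⁻¹ / √(2 * Real.pi)) ≤ 1 := by
    refine le_trans (mul_le_mul_of_nonneg_left ?_ (by positivity)) hAr
    rw [h.H₁_toReal]
    gcongr
    exact le_add_of_nonneg_left (by positivity)
  refine ENNReal.ofReal_le_of_le_toReal ((h.abs_measureReal_sub_cdf_le hc hlarge hK hcopies
    z).trans (le_of_eq ?_))
  rw [ENNReal.toReal_add (hA.trans ENNReal.one_lt_top).ne (hB.trans ENNReal.one_lt_top).ne,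
    ENNReal.toReal_mul, ENNReal.toReal_ofReal (by positivity), ENNReal.toReal_div,
    ENNReal.toReal_ofReal hn0.le]

end RobustSlope

/-! ### Finiteness of the ratios under moments of order 12 -/

namespace RobustSlope

variable {Ω : Type*} [MeasurableSpace Ω] {μ : Measure Ω} {X Y : Ω → ℝ}

/-- Variables with moments of order `12`, where the product of the regressor and the error does
not vanish. -/
structure TwelveMoments (μ : Measure Ω) (X Y : Ω → ℝ) : Prop where
  memLp_X : MemLp X 12 μ
  memLp_Y : MemLp Y 12 μ
  var_pos : 0 < Var[X; μ]
  not_ae_zero : ¬ centered μ X * err μ X Y =ᵐ[μ] 0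

lemma inv_ofNat_add_inv_ofNat {a b c : ℕ} [a.AtLeastTwo] [b.AtLeastTwo] [c.AtLeastTwo]
    (h : (OfNat.ofNat a : ℝ)⁻¹ + (OfNat.ofNat b : ℝ)⁻¹ = (OfNat.ofNat c : ℝ)⁻¹) :
    (OfNat.ofNat a : ℝ≥0∞)⁻¹ + (OfNat.ofNat b : ℝ≥0∞)⁻¹ = (OfNat.ofNat c : ℝ≥0∞)⁻¹ := by
  rw [← ENNReal.toReal_eq_toReal_iff' (by simp) (by simp),
    ENNReal.toReal_add (by simp) (by simp)]
  simpa using h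

namespace TwelveMoments

lemma sd_X_ne_zero (h : TwelveMoments μ X Y) : sd μ X ≠ 0 :=
  (ENNReal.ofReal_pos.2 (Real.sqrt_pos.2 h.var_pos)).ne'

lemma eLpNorm_ne_zero {f : Ω → ℝ} {p : ℝ≥0∞} (h : TwelveMoments μ X Y)
    (hf : AEStronglyMeasurable f μ) (hp : p ≠ 0)
    (hfxy : ∀ ω, f ω = 0 → centered μ X ω * centered μ Y ω = 0) : eLpNorm f p μ ≠ 0 :=
  eLpNorm_ne_zero_of_not_ae_zero hf hp fun h0 =>
    not_ae_zero_of_mul_err h.not_ae_zero (h0.mono fun ω hω => hfxy ω hω)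

variable [IsProbabilityMeasure μ]

lemma eLpNorm_X_ne_top (h : TwelveMoments μ X Y) {p : ℝ≥0∞} (hp : p ≤ 12) :
    eLpNorm (centered μ X) p μ ≠ ∞ :=
  ((memLp_centered h.memLp_X).mono_exponent hp).eLpNorm_ne_top

lemma eLpNorm_Y_ne_top (h : TwelveMoments μ X Y) {p : ℝ≥0∞} (hp : p ≤ 12) :
    eLpNorm (centered μ Y) p μ ≠ ∞ :=
  ((memLp_centered h.memLp_Y).mono_exponent hp).eLpNorm_ne_top

lemma eLpNorm_err_ne_top (h : TwelveMoments μ X Y) {p : ℝ≥0∞} (hp : p ≤ 12) :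
    eLpNorm (err μ X Y) p μ ≠ ∞ :=
  ((memLp_err h.memLp_X h.memLp_Y).mono_exponent hp).eLpNorm_ne_top

lemma memLp_mul_of_inv_add {f g : Ω → ℝ} {p q r s : ℝ≥0∞} (hf : MemLp f p μ) (hg : MemLp g q μ)
    (hr : p⁻¹ + q⁻¹ = r⁻¹) (hs : s ≤ r) : MemLp (f * g) s μ :=
  have : ENNReal.HolderTriple p q r := ⟨hr⟩
  (hg.mul hf).mono_exponent hs

lemma eLpNorm_mul_err_ne_top (h : TwelveMoments μ X Y) {p : ℝ≥0∞} (hp : p ≤ 6) :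
    eLpNorm (centered μ X * err μ X Y) p μ ≠ ∞ :=
  (memLp_mul_of_inv_add (r := 6) (memLp_centered h.memLp_X) (memLp_err h.memLp_X h.memLp_Y)
    (inv_ofNat_add_inv_ofNat (by norm_num)) hp).eLpNorm_ne_top

lemma eLpNorm_mul_ne_top (h : TwelveMoments μ X Y) {p : ℝ≥0∞} (hp : p ≤ 6) :
    eLpNorm (centered μ X * centered μ Y) p μ ≠ ∞ :=
  (memLp_mul_of_inv_add (r := 6) (memLp_centered h.memLp_X) (memLp_centered h.memLp_Y)
    (inv_ofNat_add_inv_ofNat (by norm_num)) hp).eLpNorm_ne_top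

lemma eLpNorm_sq_mul_ne_top (h : TwelveMoments μ X Y) {p : ℝ≥0∞} (hp : p ≤ 4) :
    eLpNorm (centered μ X ^ 2 * centered μ Y) p μ ≠ ∞ :=
  (memLp_mul_of_inv_add (p := 6) (r := 4)
    (memLp_pow_of_memLp (memLp_centered h.memLp_X) two_pos (by norm_num))
    (memLp_centered h.memLp_Y) (inv_ofNat_add_inv_ofNat (by norm_num)) hp).eLpNorm_ne_top

lemma eLpNorm_sq_mul_ne_top' (h : TwelveMoments μ X Y) {p : ℝ≥0∞} (hp : p ≤ 4) :
    eLpNorm (centered μ Y ^ 2 * centered μ X) p μ ≠ ∞ :=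
  (memLp_mul_of_inv_add (p := 6) (r := 4)
    (memLp_pow_of_memLp (memLp_centered h.memLp_Y) two_pos (by norm_num))
    (memLp_centered h.memLp_X) (inv_ofNat_add_inv_ofNat (by norm_num)) hp).eLpNorm_ne_top

lemma eLpNorm_cube_mul_ne_top (h : TwelveMoments μ X Y) {p : ℝ≥0∞} (hp : p ≤ 3) :
    eLpNorm (centered μ X ^ 3 * centered μ Y) p μ ≠ ∞ :=
  (memLp_mul_of_inv_add (p := 4) (r := 3)
    (memLp_pow_of_memLp (memLp_centered h.memLp_X) three_pos (by norm_num))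
    (memLp_centered h.memLp_Y) (inv_ofNat_add_inv_ofNat (by norm_num)) hp).eLpNorm_ne_top

lemma two_X (h : TwelveMoments μ X Y) : MemLp X 2 μ := h.memLp_X.mono_exponent (by norm_num)

lemma two_Y (h : TwelveMoments μ X Y) : MemLp Y 2 μ := h.memLp_Y.mono_exponent (by norm_num)

lemma sd_err_ne_zero (h : TwelveMoments μ X Y) : sd μ (err μ X Y) ≠ 0 :=
  (ENNReal.ofReal_pos.2 (Real.sqrt_pos.2 (variance_err_pos h.two_X h.two_Y h.not_ae_zero))).ne'

lemma sd_Y_ne_zero (h : TwelveMoments μ X Y) : sd μ Y ≠ 0 :=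
  (ENNReal.ofReal_pos.2 ((Real.sqrt_pos.2 (variance_err_pos h.two_X h.two_Y
    h.not_ae_zero)).trans_le (sqrt_variance_err_le h.two_X h.two_Y h.var_pos.ne'))).ne'

lemma aesm_X (h : TwelveMoments μ X Y) : AEStronglyMeasurable (centered μ X) μ :=
  (memLp_centered h.memLp_X).1

lemma aesm_Y (h : TwelveMoments μ X Y) : AEStronglyMeasurable (centered μ Y) μ :=
  (memLp_centered h.memLp_Y).1

lemma eLpNorm_X_ne_zero (h : TwelveMoments μ X Y) {p : ℝ≥0∞} (hp : p ≠ 0) :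
    eLpNorm (centered μ X) p μ ≠ 0 :=
  h.eLpNorm_ne_zero h.aesm_X hp fun ω hω => by simp [hω]

lemma eLpNorm_mul_err_ne_zero (h : TwelveMoments μ X Y) {p : ℝ≥0∞} (hp : p ≠ 0) :
    eLpNorm (centered μ X * err μ X Y) p μ ≠ 0 :=
  eLpNorm_ne_zero_of_not_ae_zero (h.aesm_X.mul (memLp_err h.memLp_X h.memLp_Y).1) hp h.not_ae_zero

lemma eLpNorm_sq_mul_ne_zero (h : TwelveMoments μ X Y) :
    eLpNorm (centered μ X ^ 2 * centered μ Y) 1 μ ≠ 0 :=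
  h.eLpNorm_ne_zero ((h.aesm_X.pow 2).mul h.aesm_Y) one_ne_zero fun ω hω => by simpa using hω

lemma eLpNorm_sq_mul_ne_zero' (h : TwelveMoments μ X Y) :
    eLpNorm (centered μ Y ^ 2 * centered μ X) 1 μ ≠ 0 :=
  h.eLpNorm_ne_zero ((h.aesm_Y.pow 2).mul h.aesm_X) one_ne_zero
    fun ω hω => by simpa [or_comm] using hω

lemma eLpNorm_cube_mul_ne_zero (h : TwelveMoments μ X Y) :
    eLpNorm (centered μ X ^ 3 * centered μ Y) 1 μ ≠ 0 :=
  h.eLpNorm_ne_zero ((h.aesm_X.pow 3).mul h.aesm_Y) one_ne_zero fun ω hω => by simpa using hω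

/-- A ratio in `[0, ∞]` vanishes only if its numerator is 0 or its denominator is infinite; the
moments and the nondegeneracy of `x e` exclude both. -/
lemma K_ne_zero (h : TwelveMoments μ X Y) : K μ X Y ≠ 0 := by
  have a1 := h.eLpNorm_mul_err_ne_zero (p := 2) (by norm_num)
  have a2 := h.eLpNorm_mul_err_ne_top (p := 4) (by norm_num)
  have a3 := h.sd_X_ne_zero
  have a4 := h.eLpNorm_sq_mul_ne_top (p := 1) (by norm_num)
  have a5 := h.eLpNorm_sq_mul_ne_top' (p := 1) (by norm_num)
  have a6 := h.eLpNorm_cube_mul_ne_top (p := 1) (by norm_num)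
  have a7 := h.eLpNorm_X_ne_top (p := 3) (by norm_num)
  have a8 := h.eLpNorm_X_ne_top (p := 4) (by norm_num)
  have a9 := sd_ne_top (μ := μ) (X := X)
  have a10 := sd_ne_top (μ := μ) (X := Y)
  simp only [K, ne_eq, ← nonpos_iff_eq_zero]
  simp [ENNReal.div_eq_zero_iff, ENNReal.mul_eq_top, ENNReal.pow_eq_top_iff, *]

lemma K_ne_top (h : TwelveMoments μ X Y) : K μ X Y ≠ ∞ := by
  obtain ⟨-, -, -, -, -, -, h8, -⟩ := K_le μ X Y
  have h2 := h.eLpNorm_mul_err_ne_top (p := 2) (by norm_num)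
  exact ne_top_of_le_ne_top (ENNReal.mul_ne_top (ENNReal.div_ne_top h2 (by norm_num))
    (ENNReal.div_ne_top h2 (pow_ne_zero 2 (h.eLpNorm_mul_err_ne_zero (by norm_num))))) h8

/-- Here and for the other ratios, each summand has a finite numerator by Hölder and a nonzero
denominator. The denominators with mixed moments are nonzero because `x y` is not almost surely 0.
-/
lemma H₁_lt_top (h : TwelveMoments μ X Y) : H₁ μ X Y < ∞ := by
  have a1 := h.eLpNorm_mul_err_ne_zero (p := 2) (by norm_num)
  have a2 := sd_ne_top (μ := μ) (X := X)
  have a3 := sd_ne_top (μ := μ) (X := err μ X Y)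
  have a4 := h.K_ne_zero
  have a5 := Real.pi_pos
  rw [lt_top_iff_ne_top, H₁]
  simp [ENNReal.div_eq_top, ENNReal.mul_eq_top, *]

lemma H₂_lt_top (h : TwelveMoments μ X Y) (c : ℝ≥0)
    (hv : 0 < Var[centered μ X ^ 2 * err μ X Y ^ 2; μ]) : H₂ c μ X Y < ∞ := by
  have a1 := h.eLpNorm_mul_err_ne_zero (p := 2) (by norm_num)
  have a2 := h.eLpNorm_mul_err_ne_top (p := 3) (by norm_num)
  have a3 := h.eLpNorm_mul_err_ne_top (p := 6) (by norm_num)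
  have a4 := h.eLpNorm_mul_ne_top (p := 2) (by norm_num)
  have a5 := h.eLpNorm_err_ne_top (p := 3) (by norm_num)
  have a6 := h.sd_err_ne_zero
  have a7 := h.sd_X_ne_zero
  have a8 := h.sd_Y_ne_zero
  have a9 := sd_ne_top (μ := μ) (X := X)
  have a10 := sd_ne_top (μ := μ) (X := Y)
  have b1 := h.eLpNorm_sq_mul_ne_top (p := 1) (by norm_num)
  have b2 := h.eLpNorm_sq_mul_ne_top (p := 2) (by norm_num)
  have b3 := h.eLpNorm_sq_mul_ne_top' (p := 1) (by norm_num)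
  have b4 := h.eLpNorm_sq_mul_ne_top' (p := 2) (by norm_num)
  have b5 := h.eLpNorm_cube_mul_ne_top (p := 1) (by norm_num)
  have b6 := h.eLpNorm_cube_mul_ne_top (p := 3 / 2)
    (ENNReal.div_le_of_le_mul (by norm_num))
  have b7 := h.eLpNorm_sq_mul_ne_zero
  have b8 := h.eLpNorm_sq_mul_ne_zero'
  have b9 := h.eLpNorm_cube_mul_ne_zero
  have d1 := h.eLpNorm_X_ne_top (p := 3) (by norm_num)
  have d2 := h.eLpNorm_X_ne_top (p := 4) (by norm_num)
  have d3 := h.eLpNorm_X_ne_top (p := 6) (by norm_num)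
  have d4 := h.eLpNorm_Y_ne_top (p := 3) (by norm_num)
  have d5 := h.eLpNorm_Y_ne_top (p := 4) (by norm_num)
  have d6 := h.eLpNorm_X_ne_zero (p := 3) (by norm_num)
  have d7 := h.eLpNorm_X_ne_zero (p := 4) (by norm_num)
  have v0 : evariance (centered μ X ^ 2 * err μ X Y ^ 2) μ ≠ 0 :=
    fun h0 => hv.ne' (by rw [variance, h0, ENNReal.toReal_zero])
  have v1 : (0 : ℝ) ≤ 3 / 2 := by norm_num
  rw [lt_top_iff_ne_top, H₂]
  simp [ENNReal.div_eq_top, ENNReal.mul_eq_top, ENNReal.add_eq_top, ENNReal.pow_eq_top_iff,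
    ENNReal.rpow_eq_top_iff, ENNReal.rpow_eq_zero_iff, *]

lemma H₃_lt_top (h : TwelveMoments μ X Y) : H₃ μ X Y < ∞ := by
  have a1 := h.eLpNorm_mul_err_ne_zero (p := 2) (by norm_num)
  have a2 := h.K_ne_top
  have a3 := h.sd_X_ne_zero
  have a4 := sd_ne_top (μ := μ) (X := err μ X Y)
  have a5 := sd_ne_top (μ := μ) (X := Y)
  have a6 := h.eLpNorm_cube_mul_ne_top (p := 1) (by norm_num)
  have a7 := h.eLpNorm_X_ne_top (p := 4) (by norm_num)
  rw [lt_top_iff_ne_top, H₃]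
  simp [ENNReal.div_eq_top, ENNReal.mul_eq_top, ENNReal.add_eq_top, ENNReal.pow_eq_top_iff, *]

lemma H₄_lt_top (h : TwelveMoments μ X Y) (c₁ : ℝ≥0) : H₄ c₁ μ X Y < ∞ := by
  have a1 := h.eLpNorm_mul_err_ne_zero (p := 2) (by norm_num)
  have a2 := h.sd_X_ne_zero
  have a3 := sd_ne_top (μ := μ) (X := err μ X Y)
  have a4 := sd_ne_top (μ := μ) (X := Y)
  have a5 := sd_ne_top (μ := μ) (X := X)
  have a6 := h.eLpNorm_cube_mul_ne_top (p := 1) (by norm_num)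
  have a7 := h.eLpNorm_X_ne_top (p := 4) (by norm_num)
  have a8 := h.eLpNorm_X_ne_zero (p := 3) (by norm_num)
  have a9 := h.eLpNorm_sq_mul_ne_zero'
  rw [lt_top_iff_ne_top, H₄]
  simp [ENNReal.div_eq_top, ENNReal.mul_eq_top, ENNReal.add_eq_top, ENNReal.pow_eq_top_iff, *]

lemma H₅_lt_top (h : TwelveMoments μ X Y) (c₂ : ℝ≥0) : H₅ c₂ μ X Y < ∞ := by
  have a1 := sd_ne_top (μ := μ) (X := X)
  have a2 := h.eLpNorm_X_ne_top (p := 4) (by norm_num)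
  have a3 := h.eLpNorm_Y_ne_top (p := 4) (by norm_num)
  have a4 := h.eLpNorm_X_ne_zero (p := 3) (by norm_num)
  have a5 := h.eLpNorm_sq_mul_ne_zero'
  rw [lt_top_iff_ne_top, H₅]
  simp [ENNReal.div_eq_top, ENNReal.mul_eq_top, ENNReal.add_eq_top, ENNReal.pow_eq_top_iff, *]

end TwelveMoments

end RobustSlope

theorem mainTheorem1 :
    (∃ c : ℝ≥0, IsBerryEsseenConstant c) ∧
    (∃ c₁ c₂ : ℝ≥0, IsRosenthalConstant 4 c₁ c₂) ∧
    ∀ cBE c₁ c₂ : ℝ≥0, IsBerryEsseenConstant cBE → IsRosenthalConstant 4 c₁ c₂ →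
      ∀ {Ω₀ : Type*} [MeasurableSpace Ω₀] (P₀ : Measure Ω₀) [IsProbabilityMeasure P₀]
        (X Y : Ω₀ → ℝ), MemLp X 2 P₀ → MemLp Y 2 P₀ → 0 < Var[X; P₀] →
        (∀ {Ω : Type*} [MeasurableSpace Ω] (P : Measure Ω) [IsProbabilityMeasure P]
            (n : ℕ) (Xs Ys : Fin n → Ω → ℝ), 1 ≤ n →
            (∀ i, IdentDistrib (fun ω => (Xs i ω, Ys i ω)) (fun ω => (X ω, Y ω)) P P₀) →
            iIndepFun (fun i ω => (Xs i ω, Ys i ω)) P →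
            (⨆ x : ℝ, ENNReal.ofReal
                |P.real {ω | studentized (slope P₀ X Y) (fun i => Xs i ω) (fun i => Ys i ω) ≤ x}
                  - cdf (gaussianReal 0 1) x|)
              ≤ ENNReal.ofReal (Real.log n / √(n : ℝ)) * H₁ P₀ X Y
                + H₂ cBE P₀ X Y / ENNReal.ofReal (√(n : ℝ))
                + H₃ P₀ X Y / ENNReal.ofReal (√(n * Real.log n))
                + H₄ c₁ P₀ X Y / n
                + H₅ c₂ P₀ X Y / (n : ℝ≥0∞) ^ (3 / 2 : ℝ)) ∧
        (MemLp X 12 P₀ → MemLp Y 12 P₀ → ¬ centered P₀ X * err P₀ X Y =ᵐ[P₀] 0 →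
          H₁ P₀ X Y < ∞ ∧
          (0 < Var[centered P₀ X ^ 2 * err P₀ X Y ^ 2; P₀] → H₂ cBE P₀ X Y < ∞) ∧
          H₃ P₀ X Y < ∞ ∧ H₄ c₁ P₀ X Y < ∞ ∧ H₅ c₂ P₀ X Y < ∞) := by
  refine ⟨exists_isBerryEsseenConstant, exists_isRosenthalConstant_four, ?_⟩
  intro cBE c₁ c₂ hBE _ Ω₀ _ P₀ _ X Y hX hY hvar
  refine ⟨?_, fun hX12 hY12 h0 => ?_⟩
  · intro Ω _ P _ n Xs Ys hn hid hindep
    refine iSup_le fun z => ?_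
    refine (ofReal_abs_measureReal_sub_cdf_le hX hY hvar hBE hn ⟨hid, hindep⟩ z).trans ?_
    -- The terms with `H₃`, `H₄`, `H₅` are nonnegative and are added to a bound that already holds.
    exact le_self_add.trans (le_self_add.trans le_self_add)
  · have h : TwelveMoments P₀ X Y := ⟨hX12, hY12, hvar, h0⟩
    exact ⟨h.H₁_lt_top, h.H₂_lt_top cBE, h.H₃_lt_top, h.H₄_lt_top c₁, h.H₅_lt_top c₂⟩
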